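/- Consider the equation $$u_{yy}=(u_x+x)\,u_{xy}-(u_{xx}+2)\,u_y \qquad (\mathcal E)$$ with internal coordinates $x$, $y$, $u_k=\partial_x^k u$, $v_k=\partial_x^k u_y$ ($k\ge 0$). For an integer $p\ne-2$ put $r_{-2}=1$, $r_{-1}=-(p+2)x$, $r_0=-(p+2)u+\tfrac12(p+2)^2x^2$, and let $\rho^p$ be the infinite-dimensional covering of $\mathcal E$ with nonlocal variables $r_1,r_2,\dots$ defined by $$r_{i,x}=(u_x+x)\,r_{i-1,x}-r_{i-1,y}-(p+i+3)\,r_{i-1},\qquad r_{i,y}=u_y\,r_{i-1,x},\qquad i\ge 1;$$ let $\rho^{-2}$ be the covering $\rho^{-1}$. Let $\tilde D_x,\tilde D_y$ be the total derivatives on $\rho^p$. A symmetry of $\rho^p$ is a vector field $S$ on the total space, whose coefficients are smooth functions (each depending on finitely many coordinates), such that $S(x)=S(y)=0$ and $[S,\tilde D_x]=[S,\tilde D_y]=0$. Assign the weights $|x|=1$, $|y|=0$, $|u_k|=|v_k|=2-k$, $|r_i|=i+2$; with $E=\sum_c |c|\,c\,\partial/\partial c$ (sum over all coordinates $c$), a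 vector field $S$ is homogeneous of weight $k\in\mathbb Z$ if $[E,S]=kS$. The algebra of nonlocal symmetries of $\mathcal E$ in $\rho^p$ is the real Lie algebra, under the commutator, of all finite sums of homogeneous symmetries of $\rho^p$. **Theorem.** For every $p\in\mathbb Z$, the algebra of nonlocal symmetries of $\mathcal E$ in the covering $\rho^p$ is isomorphic, as a real Lie algebra, to $\mathfrak w\oplus\mathfrak a_1$, where $\mathfrak w$ is the Witt algebra of vector fields $f(z)\,\partial/\partial z$, $f\in\mathbb R[z,z^{-1}]$ (with basis $z^{i+1}\partial/\partial z$, $i\in\mathbb Z$), and $\mathfrak a_1$ is the one-dimensional abelian Lie algebra. -/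

import Mathlib

open scoped ContDiff

namespace RdDym

/-- Coordinates on the total space of the covering: the independent variables `x`, `y`,
the internal jet coordinates `u k = ∂ₓᵏ u`, `v k = ∂ₓᵏ u_y` of the equation
`u_yy = (u_x + x) u_xy - (u_xx + 2) u_y`, and the nonlocal variables `r n = r_{n+1}`, so that
`r 0 = r₁`, `r 1 = r₂`, and so on. -/
inductive Coord : Type
  | x : Coord
  | y : Coord
  | u : ℕ → Coord
  | v : ℕ → Coord
  | r : ℕ → Coord

/-- The algebra of smooth functions on the (infinite-dimensional) total space: every function
depends on finitely many coordinates and is `C^∞` in them. -/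
def smoothSubalgebra : Subalgebra ℝ ((Coord → ℝ) → ℝ) where
  carrier := {f | ∃ (s : Finset Coord) (g : (s → ℝ) → ℝ),
    ContDiff ℝ ∞ g ∧ ∀ P : Coord → ℝ, f P = g (fun c => P c)}
  mul_mem' := by
    classical
    rintro f f' ⟨s, g, hg, hf⟩ ⟨s', g', hg', hf'⟩
    refine ⟨s ∪ s', fun q => g (fun c => q ⟨c, Finset.mem_union_left _ c.2⟩) *
      g' (fun c => q ⟨c, Finset.mem_union_right _ c.2⟩), ?_, fun P => by simp [hf, hf']⟩
    exact (hg.comp (contDiff_pi.2 fun c => contDiff_apply ℝ ℝ _)).mul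
      (hg'.comp (contDiff_pi.2 fun c => contDiff_apply ℝ ℝ _))
  add_mem' := by
    classical
    rintro f f' ⟨s, g, hg, hf⟩ ⟨s', g', hg', hf'⟩
    refine ⟨s ∪ s', fun q => g (fun c => q ⟨c, Finset.mem_union_left _ c.2⟩) +
      g' (fun c => q ⟨c, Finset.mem_union_right _ c.2⟩), ?_, fun P => by simp [hf, hf']⟩
    exact (hg.comp (contDiff_pi.2 fun c => contDiff_apply ℝ ℝ _)).add
      (hg'.comp (contDiff_pi.2 fun c => contDiff_apply ℝ ℝ _))
  algebraMap_mem' := fun a => ⟨∅, fun _ => a, contDiff_const, fun _ => rfl⟩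

/-- The ring of smooth functions on the total space. -/
def SmoothFun : Type := smoothSubalgebra

noncomputable instance : CommRing SmoothFun := inferInstanceAs (CommRing smoothSubalgebra)

noncomputable instance : Algebra ℝ SmoothFun := inferInstanceAs (Algebra ℝ smoothSubalgebra)

/-- The underlying function of an element of `SmoothFun`. -/
def SmoothFun.eval (f : SmoothFun) : (Coord → ℝ) → ℝ := f.1

theorem SmoothFun.ext {f g : SmoothFun} (h : ∀ P, f.eval P = g.eval P) : f = g :=
  Subtype.ext (funext h)

/-- A coordinate as a smooth function. -/
def coord (c : Coord) : SmoothFun :=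
  ⟨fun P => P c, {c}, fun q => q ⟨c, Finset.mem_singleton_self c⟩, contDiff_apply ℝ ℝ _,
    fun _ => rfl⟩

theorem hasLineDerivAt_of_rep {f : (Coord → ℝ) → ℝ} {s : Finset Coord} {g : (s → ℝ) → ℝ}
    (hg : ContDiff ℝ ∞ g) (hf : ∀ P : Coord → ℝ, f P = g (fun c => P c)) (P V : Coord → ℝ) :
    HasLineDerivAt ℝ f (fderiv ℝ g (fun c => P c) (fun c => V c)) P V := by
  have h := ((hg.differentiable (by simp)) (fun c : s => P c)).hasFDerivAt.hasLineDerivAt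
    (fun c : s => V c)
  unfold HasLineDerivAt at h ⊢
  refine h.congr_of_eventuallyEq (Filter.Eventually.of_forall fun t => ?_)
  simp only [hf]
  rfl

theorem SmoothFun.hasLineDerivAt (f : SmoothFun) (P V : Coord → ℝ) :
    HasLineDerivAt ℝ f.eval (lineDeriv ℝ f.eval P V) P V := by
  obtain ⟨s, g, hg, hf⟩ := f.2
  exact (hasLineDerivAt_of_rep hg hf P V).lineDifferentiableAt.hasLineDerivAt

theorem lineDeriv_mem (X : Coord → SmoothFun) (f : SmoothFun) :
    (fun P => lineDeriv ℝ f.eval P (fun c => (X c).eval P)) ∈ smoothSubalgebra := by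
  classical
  obtain ⟨s, g, hg, hf⟩ := f.2
  have key : (fun P => lineDeriv ℝ f.eval P (fun c => (X c).eval P)) =
      ∑ c : s, (fun P : Coord → ℝ => fderiv ℝ g (fun c => P c) (Pi.single c 1)) *
        (X c).eval := by
    funext P
    have h : HasLineDerivAt ℝ f.eval _ P (fun c => (X c).eval P) :=
      hasLineDerivAt_of_rep hg hf P _
    rw [h.lineDeriv, Finset.sum_apply, pi_eq_sum_univ' (fun c : s => (X c).eval P), map_sum]
    refine Finset.sum_congr rfl fun c _ => ?_
    rw [map_smul, smul_eq_mul, mul_comm, Pi.mul_apply]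
  rw [key]
  refine Subalgebra.sum_mem _ fun c _ => Subalgebra.mul_mem _
    ⟨s, fun q => fderiv ℝ g q (Pi.single c 1), ?_, fun P => rfl⟩ (X c).2
  exact (hg.fderiv_right (m := ∞) (by simp)).clm_apply contDiff_const

/-- The vector field `∑ X c ∂/∂c` on the total space, as a derivation of the ring of smooth
functions: `f` is sent to its derivative at `P` in the direction `(X c P)_c`. -/
noncomputable def vectorField (X : Coord → SmoothFun) : Derivation ℝ SmoothFun SmoothFun :=
  Derivation.mk'
    { toFun := fun f => ⟨fun P => lineDeriv ℝ f.eval P (fun c => (X c).eval P), lineDeriv_mem X f⟩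
      map_add' := fun f g => SmoothFun.ext fun P => by
        have h : HasLineDerivAt ℝ (f + g).eval _ P (fun c => (X c).eval P) :=
          HasDerivAt.add (f.hasLineDerivAt P _) (g.hasLineDerivAt P _)
        exact h.lineDeriv
      map_smul' := fun a f => SmoothFun.ext fun P => by
        have h : HasLineDerivAt ℝ (a • f).eval _ P (fun c => (X c).eval P) :=
          HasDerivAt.const_smul a (f.hasLineDerivAt P _)
        exact h.lineDeriv }
    (fun f g => SmoothFun.ext fun P => by
      have h : HasLineDerivAt ℝ (f * g).eval _ P (fun c => (X c).eval P) :=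
        HasDerivAt.mul (f.hasLineDerivAt P _) (g.hasLineDerivAt P _)
      refine h.lineDeriv.trans ?_
      simp only [zero_smul, add_zero]
      rw [add_comm, mul_comm (lineDeriv ℝ f.eval P _)]
      rfl)

/-- The right-hand side `(u_x + x) u_xy - (u_xx + 2) u_y` of the equation. -/
noncomputable def rhs : SmoothFun :=
  (coord (.u 1) + coord .x) * coord (.v 1) - (coord (.u 2) + 2) * coord (.v 0)

/-- The level at which the covering is cut. For `p = -2` the defining relations make `r₋₁`
constant and the covering `ρ⁻²` is, by convention, the covering `ρ⁻¹`. -/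
def level (p : ℤ) : ℤ := if p = -2 then -1 else p

/-- The sequence `r₋₂ = 1`, `r₋₁ = -(p+2) x`, `r₀ = -(p+2) u + (p+2)² x² / 2`, `r₁`, `r₂`, … of
the covering cut at level `p ≠ -2`; the value at `m` is `r_{m-2}`. -/
noncomputable def rSeq (p : ℤ) : ℕ → SmoothFun
  | 0 => 1
  | 1 => (-((p : ℝ) + 2)) • coord .x
  | 2 => (-((p : ℝ) + 2)) • coord (.u 0) + (((p : ℝ) + 2) ^ 2 / 2) • coord .x ^ 2
  | n + 3 => coord (.r n)

/-- The pairs `(r_{i,x}, r_{i,y})`, `i = m - 2`, given by the recursion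
`r_{i,x} = (u_x + x) r_{i-1,x} - r_{i-1,y} - (p + i + 3) r_{i-1}`, `r_{i,y} = u_y r_{i-1,x}`
for `i ≥ -1`, starting from `r₋₂ = 1`. For `i = -1, 0` the result agrees with the derivatives of
the explicit expressions in `rSeq`; for `i ≥ 1` these are the defining equations of the covering. -/
noncomputable def rXY (p : ℤ) : ℕ → SmoothFun × SmoothFun
  | 0 => (0, 0)
  | m + 1 =>
    ((coord (.u 1) + coord .x) * (rXY p m).1 - (rXY p m).2 - ((p : ℝ) + m + 2) • rSeq p m,
      coord (.v 0) * (rXY p m).1)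

/-- The total derivative with respect to `x` on the covering `ρᵖ`. -/
noncomputable def totalX (p : ℤ) : Derivation ℝ SmoothFun SmoothFun :=
  vectorField fun
    | .x => 1
    | .y => 0
    | .u k => coord (.u (k + 1))
    | .v k => coord (.v (k + 1))
    | .r n => (rXY (level p) (n + 3)).1

/-- The total derivative with respect to `y` on the covering `ρᵖ`. -/
noncomputable def totalY (p : ℤ) : Derivation ℝ SmoothFun SmoothFun :=
  vectorField fun
    | .x => 0
    | .y => 1
    | .u k => coord (.v k)
    | .v k => (totalX p)^[k] rhs
    | .r n => (rXY (level p) (n + 3)).2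

/-- The Lie algebra of all symmetries of the covering `ρᵖ` with smooth coefficients: vector fields
that are vertical (no `∂/∂x`, `∂/∂y` component) and commute with the total derivatives. Such a
field is `∑ D_x^k(φ) ∂/∂(u k) + ∑ D_x^k(D_y φ) ∂/∂(v k) + ∑ ψⁿ ∂/∂(r n)`, where `φ = S (u 0)`
satisfies the linearized equation and the `ψⁿ = S (r n)` the linearized covering equations. -/
noncomputable def allSymmetries (p : ℤ) :
    LieSubalgebra ℝ (Derivation ℝ SmoothFun SmoothFun) where
  carrier := {S | S (coord .x) = 0 ∧ S (coord .y) = 0 ∧ ⁅S, totalX p⁆ = 0 ∧ ⁅S, totalY p⁆ = 0}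
  add_mem' := by
    rintro S T ⟨h1, h2, h3, h4⟩ ⟨g1, g2, g3, g4⟩
    exact ⟨by simp [h1, g1], by simp [h2, g2], by simp [h3, g3], by simp [h4, g4]⟩
  zero_mem' := by simp
  smul_mem' := by
    rintro a S ⟨h1, h2, h3, h4⟩
    exact ⟨by simp [h1], by simp [h2], by simp [h3], by simp [h4]⟩
  lie_mem' := by
    rintro S T ⟨h1, h2, h3, h4⟩ ⟨g1, g2, g3, g4⟩
    exact ⟨by simp [Derivation.commutator_apply, h1, g1],
      by simp [Derivation.commutator_apply, h2, g2],
      by simp [lie_lie, h3, g3], by simp [lie_lie, h4, g4]⟩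

/-- The weights `|x| = 1`, `|y| = 0`, `|u| = 2`, `|∂ₓᵏ u| = |∂ₓᵏ u_y| = 2 - k`, `|r_i| = i + 2`. -/
def weight : Coord → ℤ
  | .x => 1
  | .y => 0
  | .u k => 2 - k
  | .v k => 2 - k
  | .r n => n + 3

/-- The weight (Euler) field `∑ |c| c ∂/∂c`. A function `Z` has weight `k` iff `euler Z = k Z`. -/
noncomputable def euler : Derivation ℝ SmoothFun SmoothFun :=
  vectorField fun c => (weight c : ℝ) • coord c

/-- A vector field is homogeneous of weight `k` if its `∂/∂c`-component has weight `k + |c|` for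
each coordinate `c`, that is, if `[euler, S] = k S`. -/
def IsHomogeneous (k : ℤ) (S : Derivation ℝ SmoothFun SmoothFun) : Prop :=
  ⁅euler, S⁆ = (k : ℝ) • S

theorem IsHomogeneous.lie {k l : ℤ} {S T : Derivation ℝ SmoothFun SmoothFun}
    (hS : IsHomogeneous k S) (hT : IsHomogeneous l T) : IsHomogeneous (k + l) ⁅S, T⁆ := by
  unfold IsHomogeneous at *
  rw [leibniz_lie, hS, hT, smul_lie, lie_smul, ← add_smul]
  push_cast
  rfl

/-- The (graded) Lie algebra of nonlocal symmetries in the covering `ρᵖ`: finite sums of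
weight-homogeneous symmetries. -/
noncomputable def nonlocalSymmetries (p : ℤ) :
    LieSubalgebra ℝ (Derivation ℝ SmoothFun SmoothFun) where
  __ := Submodule.span ℝ {S | S ∈ allSymmetries p ∧ ∃ k : ℤ, IsHomogeneous k S}
  lie_mem' := by
    intro S T hS hT
    refine Submodule.span_induction₂ (p := fun S T _ _ => ⁅S, T⁆ ∈ Submodule.span ℝ
      {S | S ∈ allSymmetries p ∧ ∃ k : ℤ, IsHomogeneous k S}) ?_ ?_ ?_ ?_ ?_ ?_ ?_ hS hT
    · rintro A B ⟨hA, k, hk⟩ ⟨hB, l, hl⟩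
      exact Submodule.subset_span ⟨(allSymmetries p).lie_mem hA hB, k + l, hk.lie hl⟩
    · intro B _; simp
    · intro A _; simp
    · intro A B C _ _ _ h1 h2; rw [add_lie]; exact Submodule.add_mem _ h1 h2
    · intro A B C _ _ _ h1 h2; rw [lie_add]; exact Submodule.add_mem _ h1 h2
    · intro a A B _ _ h; rw [smul_lie]; exact Submodule.smul_mem _ a h
    · intro a A B _ _ h; rw [lie_smul]; exact Submodule.smul_mem _ a h

/-- The Witt algebra: the polynomial vector fields `f(z) d/dz`, `f ∈ ℝ[z, z⁻¹]`, with basis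
`z^{i+1} d/dz`, `i ∈ ℤ`. -/
def WittAlgebra : Type :=
  Derivation ℝ (LaurentPolynomial ℝ) (LaurentPolynomial ℝ)

noncomputable instance : LieRing WittAlgebra :=
  inferInstanceAs (LieRing (Derivation ℝ (LaurentPolynomial ℝ) (LaurentPolynomial ℝ)))

noncomputable instance : LieAlgebra ℝ WittAlgebra :=
  inferInstanceAs (LieAlgebra ℝ (Derivation ℝ (LaurentPolynomial ℝ) (LaurentPolynomial ℝ)))

/-- The one-dimensional abelian Lie algebra: `ℝ` with the zero bracket. -/
def AbelianLine : Type := ℝ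

noncomputable instance : AddCommGroup AbelianLine := inferInstanceAs (AddCommGroup ℝ)

noncomputable instance : Module ℝ AbelianLine := inferInstanceAs (Module ℝ ℝ)

noncomputable instance : LieRing AbelianLine where
  bracket _ _ := 0
  add_lie := by simp
  lie_add := by simp
  lie_self := by simp
  leibniz_lie := by simp

noncomputable instance : LieAlgebra ℝ AbelianLine where
  lie_smul := fun t _ _ => (smul_zero t).symm

end RdDym

namespace RdDym

/-! ### Smooth parameter integrals and Hadamard's lemma. -/

section Hadamard

open MeasureTheory

/-! Put `q = p + 2`, with `p` replaced by `-1` when `p = -2`, so that `q ≠ 0`. Collect the nonlocal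
variables in `w = Σ r_{m-2} zᵐ = 1 + …` (`wS`) and let `Δ = 1 - (u_x + x) z + u_y z²` (`Del`). The
covering is then equivalent to the two equations `Δ w_x = -z (z w_z + q w)` and `w_y = z u_y w_x`.
Hence `W = z w^{1/q} = z + …` (`WU`) is annihilated by the Lax pair `Δ D_x + z (z ∂_z)`, `D_y - z
u_y D_x`, and so is every Laurent polynomial in `W`.

A symmetry `S` is encoded by the series `h = S(w) / w_x = S(u) z + …`. Commutation with the total
derivatives becomes a pair of linear equations for `h`, namely `TT` and `YY` with right-hand sides
in `z` and `z²`, together with the linearized equation for `S(u)` (`isSymSeries_symSeries`,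
`symField_mem`).

Existence. For a Laurent polynomial `F` the series `F(W) / W_x` solves the homogeneous equations,
and its part with positive exponents is the series of a symmetry `wittField F`. Adding the discarded
part times `D_x` to this symmetry gives a derivation that sends `W` to `F(W)`. Commutators of
discarded parts have no positive exponents, so `F ↦ wittField F` respects brackets
(`wittField_lie`). The vertical field `D_y - ∂_y`, with series `z u_y`, commutes with all of these,
because `W` does not involve `y`; it spans the abelian summand. Injectivity
(`eq_zero_of_wittField_add_eq_zero`) follows by bracketing with `W^{m+1} ∂_W` for large `m`, which
moves the lowest term of `F` into the part that survives truncation.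

Exhaustion (`exists_eq_basisField_add_yField`). Let `S` be homogeneous of weight `k` and `B_j` the
field of weight `j` obtained from `W^{1-j} ∂_W`. A function killed by both total derivatives is
constant, so a symmetry of weight at most `-3` with `S(u) = 0` is a multiple of a basis field. For
large `m` this applies to `[B_{-m}, S]`, giving numbers `c m` that satisfy a cocycle identity;
eventually `c m = α (m + k)`, and so `S + α B_k` commutes with all `B_{-m}`, `m` large. Since
`B_{-m} = q ∂/∂r_{m-2} + …`, the series `h` of this sum involves only finitely many nonlocal
variables, and `TT` bounds its jet variables too. Such an `h` is rational with denominator a power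
of `Δ`: differentiating the `TT` equation often in `u_x` and in `u_y` kills the polynomial
coefficients. The discriminant `(u_x + x)² - 4 u_y` is not a zero divisor, so there is no pole along
`Δ` and `h` is a polynomial in `z`. Its two highest coefficient equations leave only `h = β z u_y`.
-/

theorem contDiff_integral_unit {E : Type*} [NormedAddCommGroup E] [NormedSpace ℝ E]
    {G : E → ℝ → ℝ} (hG : ContDiff ℝ ∞ (fun z : E × ℝ => G z.1 z.2)) :
    ContDiff ℝ ∞ (fun x => ∫ t in (0 : ℝ)..1, G x t) := by
  -- The integral over `(0, 1]` is the convolution at `0` of the indicator function with `s ↦ χ s *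
  -- G p (-s)`. The cutoff supplies compact support and equals `1` for `|s| ≤ 2`, hence wherever the
  -- indicator is nonzero.
  let χ : ContDiffBump (0 : ℝ) := ⟨2, 3, by norm_num, by norm_num⟩
  let f : ℝ → ℝ := Set.indicator (Set.Ioc 0 1) 1
  let g : E → ℝ → ℝ := fun p s => χ s * G p (-s)
  have hf : LocallyIntegrable f volume := by
    apply Integrable.locallyIntegrable
    exact (integrable_indicator_iff measurableSet_Ioc).2
      (integrableOn_const (by simp) (by simp))
  have hg : ContDiffOn ℝ ∞ (Function.uncurry g) (Set.univ ×ˢ Set.univ) := by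
    refine ContDiff.contDiffOn ?_
    refine (χ.contDiff.comp contDiff_snd).mul ?_
    exact hG.comp (contDiff_fst.prodMk contDiff_snd.neg)
  have key := contDiffOn_convolution_right_with_param (μ := volume) (n := ⊤)
    (ContinuousLinearMap.mul ℝ ℝ) (f := f) (g := g) (s := Set.univ)
    (k := Metric.closedBall 0 3) isOpen_univ (isCompact_closedBall _ _) (by
      intro p s _ hs
      have : χ s = 0 := χ.zero_of_le_dist (by
        simpa using le_of_lt (not_le.1 fun h => hs (Metric.mem_closedBall.2 h)))
      simp [g, this]) hf (by exact_mod_cast hg)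
  rw [Set.univ_prod_univ, contDiffOn_univ] at key
  have key2 := key.comp (contDiff_id.prodMk (contDiff_const (c := (0 : ℝ))))
  convert key2 using 1
  funext x
  simp only [Function.comp_apply, id, MeasureTheory.convolution, ContinuousLinearMap.mul_apply']
  rw [intervalIntegral.integral_of_le zero_le_one, ← integral_indicator measurableSet_Ioc]
  refine integral_congr_ae (Filter.Eventually.of_forall fun t => ?_)
  by_cases ht : t ∈ Set.Ioc (0 : ℝ) 1
  · have : χ (-t) = 1 := χ.one_of_mem_closedBall (by
      rw [Metric.mem_closedBall, dist_zero_right, Real.norm_eq_abs, abs_neg]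
      exact (abs_le.2 ⟨by linarith [ht.1], ht.2⟩).trans (by norm_num [χ]))
    simp [f, g, ht, this]
  · simp [f, ht]

/-- Hadamard's lemma. -/
theorem exists_hadamard {ι : Type*} [Fintype ι] [DecidableEq ι] {g : (ι → ℝ) → ℝ}
    (hg : ContDiff ℝ ∞ g) (p : ι → ℝ) :
    ∃ G : ι → (ι → ℝ) → ℝ, (∀ i, ContDiff ℝ ∞ (G i)) ∧
      (∀ i, G i p = fderiv ℝ g p (Pi.single i 1)) ∧
      ∀ q, g q = g p + ∑ i, (q i - p i) * G i q := by
  refine ⟨fun i q => ∫ t in (0 : ℝ)..1, fderiv ℝ g (p + t • (q - p)) (Pi.single i 1), ?_, ?_, ?_⟩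
  · intro i
    refine contDiff_integral_unit (G := fun q t => fderiv ℝ g (p + t • (q - p)) (Pi.single i 1)) ?_
    refine ContDiff.clm_apply ?_ contDiff_const
    refine (hg.fderiv_right (m := ∞) (by simp)).comp ?_
    exact contDiff_const.add (contDiff_snd.smul (contDiff_fst.sub contDiff_const))
  · intro i
    simp
  · intro q
    have hcont : Continuous fun t : ℝ => fderiv ℝ g (p + t • (q - p)) :=
      (hg.continuous_fderiv (by simp)).comp (by fun_prop)
    have h1 : ∫ t in (0 : ℝ)..1, fderiv ℝ g (p + t • (q - p)) (q - p) = g q - g p := by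
      have := intervalIntegral.integral_eq_sub_of_hasDerivAt (a := 0) (b := 1)
        (f := fun t : ℝ => g (p + t • (q - p)))
        (f' := fun t => fderiv ℝ g (p + t • (q - p)) (q - p)) (fun t _ => by
          have h := ((hg.differentiable (by simp)) (p + t • (q - p))).hasFDerivAt
          have h2 : HasDerivAt (fun t : ℝ => p + t • (q - p)) (q - p) t := by
            simpa using ((hasDerivAt_id t).smul_const (q - p)).const_add p
          exact h.comp_hasDerivAt t h2)
        ((hcont.clm_apply continuous_const).intervalIntegrable _ _)
      simpa using this
    have h2 : ∀ t : ℝ, fderiv ℝ g (p + t • (q - p)) (q - p) =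
        ∑ i, (q i - p i) * fderiv ℝ g (p + t • (q - p)) (Pi.single i 1) := by
      intro t
      generalize fderiv ℝ g (p + t • (q - p)) = A
      conv_lhs => rw [pi_eq_sum_univ' (q - p), map_sum]
      refine Finset.sum_congr rfl fun i _ => ?_
      rw [map_smul, smul_eq_mul, Pi.sub_apply]
    simp only [h2] at h1
    rw [intervalIntegral.integral_finsetSum] at h1
    · simp only [intervalIntegral.integral_const_mul] at h1
      rw [h1]; ring
    · intro i _
      exact (continuous_const.mul (hcont.clm_apply continuous_const)).intervalIntegrable _ _

end Hadamard

/-! ### Abstract derivations of the ring of smooth functions are vector fields. -/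

section VectorFields

@[simp] theorem eval_add (f g : SmoothFun) (P : Coord → ℝ) :
    (f + g).eval P = f.eval P + g.eval P := rfl
@[simp] theorem eval_sub (f g : SmoothFun) (P : Coord → ℝ) :
    (f - g).eval P = f.eval P - g.eval P := rfl
@[simp] theorem eval_neg (f : SmoothFun) (P : Coord → ℝ) : (-f).eval P = -f.eval P := rfl
@[simp] theorem eval_mul (f g : SmoothFun) (P : Coord → ℝ) :
    (f * g).eval P = f.eval P * g.eval P := rfl
@[simp] theorem eval_zero (P : Coord → ℝ) : (0 : SmoothFun).eval P = 0 := rfl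
@[simp] theorem eval_one (P : Coord → ℝ) : (1 : SmoothFun).eval P = 1 := rfl
@[simp] theorem eval_smul (r : ℝ) (f : SmoothFun) (P : Coord → ℝ) :
    (r • f).eval P = r * f.eval P := rfl
@[simp] theorem eval_algebraMap (r : ℝ) (P : Coord → ℝ) :
    (algebraMap ℝ SmoothFun r).eval P = r := rfl
@[simp] theorem eval_coord (c : Coord) (P : Coord → ℝ) : (coord c).eval P = P c := rfl

theorem eval_sum {ι : Type*} (s : Finset ι) (f : ι → SmoothFun) (P : Coord → ℝ) :
    (∑ i ∈ s, f i).eval P = ∑ i ∈ s, (f i).eval P := by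
  classical
  induction s using Finset.induction_on with
  | empty => simp
  | insert i s hi ih => simp [Finset.sum_insert hi, ih]

theorem vectorField_eval (X : Coord → SmoothFun) (f : SmoothFun) (P : Coord → ℝ) :
    (vectorField X f).eval P = lineDeriv ℝ f.eval P (fun c => (X c).eval P) := rfl

@[simp] theorem vectorField_coord (X : Coord → SmoothFun) (c : Coord) :
    vectorField X (coord c) = X c := by
  refine SmoothFun.ext fun P => ?_
  rw [vectorField_eval]
  have h : HasLineDerivAt ℝ (coord c).eval ((X c).eval P) P (fun c => (X c).eval P) := by
    have : HasDerivAt (fun t : ℝ => P c + t * (X c).eval P) ((X c).eval P) 0 := by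
      simpa using ((hasDerivAt_id (0 : ℝ)).mul_const ((X c).eval P)).const_add (P c)
    exact this
  exact h.lineDeriv

open Classical in
/-- The partial derivative with respect to a coordinate. -/
noncomputable def pd (c : Coord) : Derivation ℝ SmoothFun SmoothFun :=
  vectorField fun d => if d = c then 1 else 0

open Classical in
theorem pd_coord (c d : Coord) : pd c (coord d) = if d = c then 1 else 0 := vectorField_coord _ _

@[simp] theorem pd_coord_self (c : Coord) : pd c (coord c) = 1 := by simp [pd_coord]

theorem pd_coord_of_ne {c d : Coord} (h : d ≠ c) : pd c (coord d) = 0 := by simp [pd_coord, h]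

/-- Hadamard's lemma at `P` writes `f = f(P) + Σ (c - P c) F_c`. Applying `D` and evaluating at `P`
leaves only `D(c) F_c(P)`, and `F_c(P)` is the partial derivative. The finite set depends on `f`
alone, so one set serves all derivations. -/
theorem exists_finset_derivation_apply (f : SmoothFun) :
    ∃ s : Finset Coord, (∀ c ∉ s, pd c f = 0) ∧
      ∀ D : Derivation ℝ SmoothFun SmoothFun, D f = ∑ c ∈ s, D (coord c) * pd c f := by
  classical
  obtain ⟨s, g, hg, hf⟩ := f.2
  have hpd : ∀ (c : Coord) (P : Coord → ℝ), (pd c f).eval P =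
      fderiv ℝ g (fun c => P c) (fun d : s => if (d : Coord) = c then 1 else 0) := by
    intro c P
    have h := (hasLineDerivAt_of_rep hg hf P (fun d => if d = c then 1 else 0)).lineDeriv
    rw [← h, pd, vectorField_eval]
    congr 1
    funext d
    split_ifs <;> rfl
  have h1 : ∀ c ∉ s, pd c f = 0 := by
    intro c hc
    refine SmoothFun.ext fun P => ?_
    rw [hpd]
    have : (fun d : s => if (d : Coord) = c then (1 : ℝ) else 0) = 0 := by
      funext d
      rw [if_neg]
      · rfl
      · rintro rfl; exact hc d.2
    rw [this, map_zero]; rfl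
  refine ⟨s, h1, fun D => SmoothFun.ext fun P => ?_⟩
  obtain ⟨G, hG, hGp, hsum⟩ := exists_hadamard hg (fun c : s => P c)
  let F : s → SmoothFun := fun i => ⟨fun Q => G i (fun c => Q c), s, G i, hG i, fun _ => rfl⟩
  have hdec : f = algebraMap ℝ SmoothFun (f.eval P) +
      ∑ i : s, (coord i - algebraMap ℝ SmoothFun (P i)) * F i := by
    refine SmoothFun.ext fun Q => ?_
    have h2 : f.eval Q = g (fun c => Q c) := hf Q
    have h3 : f.eval P = g (fun c => P c) := hf P
    rw [h2, hsum, eval_add, eval_algebraMap, h3, eval_sum]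
    rfl
  have hD : D f = ∑ i : s, (D (coord i) * F i +
      (coord i - algebraMap ℝ SmoothFun (P i)) * D (F i)) := by
    conv_lhs => rw [hdec]
    rw [map_add, Derivation.map_algebraMap, zero_add, map_sum]
    refine Finset.sum_congr rfl fun i _ => ?_
    rw [Derivation.leibniz, map_sub, Derivation.map_algebraMap, sub_zero, smul_eq_mul,
      smul_eq_mul]
    ring
  rw [hD, eval_sum, eval_sum, ← Finset.sum_coe_sort s]
  refine Finset.sum_congr rfl fun i _ => ?_
  have h4 : (F i).eval P = (pd i f).eval P := by
    rw [hpd]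
    refine (hGp i).trans (congrArg _ ?_)
    funext d
    rw [Pi.single_apply]
    exact if_congr Subtype.ext_iff rfl rfl
  rw [eval_add, eval_mul, eval_mul, eval_mul, h4, eval_sub, eval_coord, eval_algebraMap, sub_self,
    zero_mul, add_zero]

theorem derivation_ext {D D' : Derivation ℝ SmoothFun SmoothFun}
    (h : ∀ c, D (coord c) = D' (coord c)) : D = D' := by
  refine Derivation.ext fun f => ?_
  obtain ⟨s, -, hs⟩ := exists_finset_derivation_apply f
  rw [hs D, hs D']
  exact Finset.sum_congr rfl fun c _ => by rw [h]

theorem derivation_apply_eq_zero (D : Derivation ℝ SmoothFun SmoothFun) (f : SmoothFun)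
    (h : ∀ c, D (coord c) * pd c f = 0) : D f = 0 := by
  obtain ⟨s, -, hs⟩ := exists_finset_derivation_apply f
  rw [hs D]
  exact Finset.sum_eq_zero fun c _ => h c

theorem derivation_apply_eq_single (D : Derivation ℝ SmoothFun SmoothFun) (f : SmoothFun)
    (c₀ : Coord) (h : ∀ c ≠ c₀, D (coord c) * pd c f = 0) : D f = D (coord c₀) * pd c₀ f := by
  have h0 : (D - D (coord c₀) • pd c₀) f = 0 := by
    refine derivation_apply_eq_zero _ _ fun c => ?_
    by_cases hc : c = c₀
    · subst hc; simp
    · simpa [pd_coord_of_ne hc] using h c hc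
  simpa [sub_eq_zero] using h0

theorem exists_eq_algebraMap {f : SmoothFun} (h : ∀ c, pd c f = 0) :
    ∃ r : ℝ, f = algebraMap ℝ SmoothFun r := by
  classical
  obtain ⟨s, g, hg, hf⟩ := f.2
  refine ⟨f.eval 0, SmoothFun.ext fun P => ?_⟩
  have hlin : ∀ Q V : Coord → ℝ, fderiv ℝ g (fun c => Q c) (fun c => V c) = 0 := by
    intro Q V
    rw [← (hasLineDerivAt_of_rep hg hf Q V).lineDeriv]
    have h0 : vectorField (fun c => algebraMap ℝ SmoothFun (V c)) f = 0 :=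
      derivation_apply_eq_zero _ _ fun c => by rw [h, mul_zero]
    exact congrArg (fun k => SmoothFun.eval k Q) h0
  have hfd : ∀ q, fderiv ℝ g q = 0 := by
    intro q
    ext v
    have := hlin (fun c => if hc : c ∈ s then q ⟨c, hc⟩ else 0)
      (fun c => if hc : c ∈ s then v ⟨c, hc⟩ else 0)
    simpa using this
  have := is_const_of_fderiv_eq_zero (hg.differentiable (by simp)) hfd (fun c => P c) (fun _ => 0)
  rw [eval_algebraMap]
  exact (hf P).trans (this.trans (hf 0).symm)

theorem pd_pd_comm (c d : Coord) (f : SmoothFun) : pd c (pd d f) = pd d (pd c f) := by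
  have : ⁅pd c, pd d⁆ = 0 := derivation_ext fun e => by
    rw [Derivation.commutator_apply, pd_coord, pd_coord]
    split_ifs <;> simp
  simpa [Derivation.commutator_apply, sub_eq_zero] using congrArg (fun D => D f) this

open Classical in
-- Smooth functions do not form a domain. A factor that is affine with nonzero slope on every line
-- parallel to one axis vanishes at most once per line, and continuity of `f` fills in that point.
theorem eq_zero_of_mul_eq_zero_of_line {d f : SmoothFun} (c : Coord)
    (hd : ∀ P : Coord → ℝ, ∃ k : ℝ, k ≠ 0 ∧ ∀ t : ℝ,
      d.eval (P + t • Pi.single c 1) = d.eval P + t * k)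
    (h : d * f = 0) : f = 0 := by
  classical
  refine SmoothFun.ext fun P => ?_
  obtain ⟨k, hk, hline⟩ := hd P
  have hz : ∀ Q, d.eval Q ≠ 0 → f.eval Q = 0 := fun Q hQ => by
    have := congrArg (fun k => SmoothFun.eval k Q) h
    simpa [hQ] using this
  by_cases hP : d.eval P = 0
  · obtain ⟨s, g, hg, hf⟩ := f.2
    have hcont : Continuous fun t : ℝ => f.eval (P + t • Pi.single c 1) := by
      have : (fun t : ℝ => f.eval (P + t • Pi.single c 1)) =
          fun t => g (fun e : s => (P + t • Pi.single c (1 : ℝ) : Coord → ℝ) e) :=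
        funext fun t => hf _
      rw [this]
      refine hg.continuous.comp (continuous_pi fun e => ?_)
      simp only [Pi.add_apply, Pi.smul_apply]
      fun_prop
    have hev : (fun t : ℝ => f.eval (P + t • Pi.single c 1)) =ᶠ[nhdsWithin 0 {0}ᶜ] fun _ => 0 :=
      Filter.eventually_of_mem self_mem_nhdsWithin fun t ht => hz _ (by
        rw [hline, hP, zero_add]
        exact mul_ne_zero ht hk)
    have h1 := (hcont.tendsto 0).mono_left (nhdsWithin_le_nhds (s := {(0 : ℝ)}ᶜ))
    have h2 := (tendsto_const_nhds (x := (0 : ℝ))).congr' hev.symm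
    simpa using tendsto_nhds_unique h1 h2
  · exact hz P hP

end VectorFields

end RdDym

namespace RdDym

/-! ### Laurent series over a commutative algebra: derivations, leading terms, roots. -/

section LaurentSeriesTools

open HahnSeries

variable {A : Type*} [CommRing A] [Algebra ℝ A]

/-- The coefficientwise algebra structure, preferred to the one through power series. -/
noncomputable instance seriesAlgebra : Algebra ℝ (HahnSeries ℤ A) := HahnSeries.instAlgebra

/-- The map of Laurent series acting by `δ` on the coefficients and by `z ↦ κ z`. -/
noncomputable def liftLin (δ : Derivation ℝ A A) (κ : ℝ) : HahnSeries ℤ A →ₗ[ℝ] HahnSeries ℤ A where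
  toFun f := ⟨fun n => δ (f.coeff n) + (κ * n) • f.coeff n, f.isPWO_support.mono fun n hn hn0 =>
    hn (by simp only [hn0, map_zero, smul_zero, add_zero])⟩
  map_add' f g := by
    ext n
    simp only [HahnSeries.coeff_add, map_add, smul_add]
    abel
  map_smul' r f := by
    ext n
    simp [smul_comm r]

theorem liftLin_coeff (δ : Derivation ℝ A A) (κ : ℝ) (f : HahnSeries ℤ A) (n : ℤ) :
    (liftLin δ κ f).coeff n = δ (f.coeff n) + (κ * n) • f.coeff n := rfl

theorem liftLin_support (δ : Derivation ℝ A A) (κ : ℝ) (f : HahnSeries ℤ A) :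
    (liftLin δ κ f).support ⊆ f.support := fun n hn hn0 =>
  hn (by rw [liftLin_coeff, hn0, map_zero, smul_zero, add_zero])

theorem liftLin_mul (δ : Derivation ℝ A A) (κ : ℝ) (f g : HahnSeries ℤ A) :
    liftLin δ κ (f * g) = f * liftLin δ κ g + liftLin δ κ f * g := by
  ext n
  rw [HahnSeries.coeff_add, coeff_mul_right' g.isPWO_support (liftLin_support δ κ g),
    coeff_mul_left' f.isPWO_support (liftLin_support δ κ f), liftLin_coeff, HahnSeries.coeff_mul,
    map_sum, Finset.smul_sum, ← Finset.sum_add_distrib, ← Finset.sum_add_distrib]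
  refine Finset.sum_congr rfl fun ij hij => ?_
  have : n = ij.1 + ij.2 := (Finset.mem_antidiagonal.1 hij).2.2.symm
  subst this
  simp only [liftLin_coeff, Derivation.leibniz, smul_eq_mul, mul_add, mul_smul_comm, Int.cast_add,
    add_smul, add_mul, smul_mul_assoc, mul_comm (g.coeff ij.2)]
  abel

/-- The derivation of the ring of Laurent series in `z` acting by `δ` on the coefficients and by
`z ↦ κ z`. -/
noncomputable def liftDer (δ : Derivation ℝ A A) (κ : ℝ) :
    Derivation ℝ (HahnSeries ℤ A) (HahnSeries ℤ A) :=
  Derivation.mk' (liftLin δ κ) fun f g => by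
    rw [liftLin_mul, smul_eq_mul, smul_eq_mul, mul_comm g]

@[simp] theorem liftDer_coeff (δ : Derivation ℝ A A) (κ : ℝ) (f : HahnSeries ℤ A) (n : ℤ) :
    (liftDer δ κ f).coeff n = δ (f.coeff n) + (κ * n) • f.coeff n := rfl

theorem liftDer_single (δ : Derivation ℝ A A) (κ : ℝ) (n : ℤ) (r : A) :
    liftDer δ κ (single n r) = single n (δ r + (κ * n) • r) := by
  ext m
  rw [liftDer_coeff]
  by_cases h : m = n
  · subst h; simp
  · simp [coeff_single_of_ne h]

/-- The operators `κ z d/dz` commute with one another and with coefficientwise derivations, so only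
the bracket of the coefficient parts survives. -/
theorem liftDer_lie (δ δ' : Derivation ℝ A A) (κ κ' : ℝ) (f : HahnSeries ℤ A) :
    liftDer δ κ (liftDer δ' κ' f) - liftDer δ' κ' (liftDer δ κ f) = liftDer ⁅δ, δ'⁆ 0 f := by
  ext n
  simp only [HahnSeries.coeff_sub, liftDer_coeff, map_add, Derivation.map_smul, smul_add,
    Derivation.commutator_apply, zero_mul, zero_smul, add_zero, smul_smul, mul_comm (κ * n)]
  abel

/-- The part of a Laurent series with positive exponents. -/
noncomputable def posPart : HahnSeries ℤ A →ₗ[ℝ] HahnSeries ℤ A where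
  toFun f := ⟨fun n => if 1 ≤ n then f.coeff n else 0, f.isPWO_support.mono fun n hn => by
    contrapose! hn
    simp only [HahnSeries.mem_support, not_not] at hn
    simp [hn]⟩
  map_add' f g := by
    ext n
    simp only [HahnSeries.coeff_add]
    split_ifs <;> simp
  map_smul' r f := by
    ext n
    simp

theorem posPart_coeff (f : HahnSeries ℤ A) (n : ℤ) :
    (posPart f).coeff n = if 1 ≤ n then f.coeff n else 0 := rfl

/-- `HasLead f n r` says that `f = r zⁿ + (higher order terms)`. -/
def HasLead (f : HahnSeries ℤ A) (n : ℤ) (r : A) : Prop :=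
  (∀ j < n, f.coeff j = 0) ∧ f.coeff n = r

omit [Algebra ℝ A] in
theorem HasLead.exists_powerSeries {f : HahnSeries ℤ A} {n : ℤ} {r : A} (h : HasLead f n r) :
    ∃ g : PowerSeries A, PowerSeries.constantCoeff g = r ∧
      f = single n 1 * ofPowerSeries ℤ A g := by
  refine ⟨PowerSeries.mk fun k => f.coeff (n + k), by simp [h.2], ?_⟩
  ext m
  rw [coeff_single_mul, one_mul, PowerSeries.coeff_coe]
  split_ifs with hm
  · exact h.1 m (by omega)
  · rw [PowerSeries.coeff_mk]
    congr 1
    omega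

omit [Algebra ℝ A] in
theorem hasLead_powerSeries (g : PowerSeries A) (n : ℤ) :
    HasLead (single n 1 * ofPowerSeries ℤ A g) n (PowerSeries.constantCoeff g) := by
  constructor
  · intro j hj
    rw [coeff_single_mul, one_mul, PowerSeries.coeff_coe, if_pos (by omega)]
  · rw [coeff_single_mul, one_mul, PowerSeries.coeff_coe, if_neg (by omega)]
    simp

omit [Algebra ℝ A] in
theorem HasLead.mul {f g : HahnSeries ℤ A} {n m : ℤ} {r s : A} (hf : HasLead f n r)
    (hg : HasLead g m s) : HasLead (f * g) (n + m) (r * s) := by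
  obtain ⟨f', rfl, rfl⟩ := hf.exists_powerSeries
  obtain ⟨g', rfl, rfl⟩ := hg.exists_powerSeries
  have := hasLead_powerSeries (f' * g') (n + m)
  have h1 : (single (n + m) (1 : A)) = single n 1 * single m 1 := by
    rw [single_mul_single, one_mul]
  rwa [map_mul, map_mul, h1, mul_mul_mul_comm] at this

omit [Algebra ℝ A] in
theorem HasLead.exists_inv {f : HahnSeries ℤ A} {n : ℤ} {r s : A} (hf : HasLead f n r)
    (hr : r * s = 1) : ∃ g, f * g = 1 ∧ HasLead g (-n) s := by
  obtain ⟨f', hf', rfl⟩ := hf.exists_powerSeries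
  have hu : IsUnit f' := PowerSeries.isUnit_iff_constantCoeff.2 (hf' ▸ IsUnit.of_mul_eq_one s hr)
  obtain ⟨u, rfl⟩ := hu
  refine ⟨single (-n) 1 * ofPowerSeries ℤ A ↑u⁻¹, ?_, ?_⟩
  · rw [mul_mul_mul_comm, single_mul_single, ← map_mul, Units.mul_inv]
    simp
  · have h1 : PowerSeries.constantCoeff (u : PowerSeries A) *
        PowerSeries.constantCoeff (↑u⁻¹ : PowerSeries A) = 1 := by
      rw [← map_mul, Units.mul_inv, map_one]
    have h2 : PowerSeries.constantCoeff (↑u⁻¹ : PowerSeries A) = s := by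
      rw [hf'] at h1
      calc _ = s * (r * PowerSeries.constantCoeff (↑u⁻¹ : PowerSeries A)) := by
            rw [← mul_assoc, mul_comm s, hr, one_mul]
        _ = s := by rw [h1, mul_one]
    rw [← h2]
    exact hasLead_powerSeries _ _

/-- The Laurent series with finitely many nonzero coefficients. -/
def finiteSeries (A : Type*) [CommRing A] : Subring (HahnSeries ℤ A) where
  carrier := {f | f.support.Finite}
  mul_mem' {f g} hf hg := (Set.Finite.add hf hg).subset support_mul_subset
  one_mem' := by
    refine (Set.finite_singleton (0 : ℤ)).subset fun n hn => ?_
    contrapose! hn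
    have : n ≠ 0 := hn
    simp [HahnSeries.coeff_one, this]
  add_mem' {f g} hf hg := (Set.Finite.union hf hg).subset (support_add_subset (x := f) (y := g))
  zero_mem' := by simp
  neg_mem' {f} hf := by
    simpa using hf

omit [Algebra ℝ A] in
theorem single_mem_finiteSeries (n : ℤ) (r : A) : single n r ∈ finiteSeries A :=
  (Set.finite_singleton n).subset support_single_subset

theorem liftDer_mem_finiteSeries (δ : Derivation ℝ A A) (κ : ℝ) {f : HahnSeries ℤ A}
    (hf : f ∈ finiteSeries A) : liftDer δ κ f ∈ finiteSeries A :=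
  Set.Finite.subset hf fun n hn => by
    contrapose! hn
    simp only [HahnSeries.mem_support, not_not] at hn
    simp [hn]

omit [Algebra ℝ A] in
theorem finiteSeries_of_single_mul {n : ℤ} {f : HahnSeries ℤ A}
    (hf : single n 1 * f ∈ finiteSeries A) : f ∈ finiteSeries A := by
  have := (finiteSeries A).mul_mem (single_mem_finiteSeries (-n) 1) hf
  rw [← mul_assoc, single_mul_single] at this
  simpa using this

theorem derivation_units_zpow {B M : Type*} [CommRing B] [Algebra ℝ B] [AddCommGroup M]
    [Module B M] [Module ℝ M] (D : Derivation ℝ B M) (u : Bˣ) (n : ℤ) :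
    D ((u ^ n : Bˣ) : B) = (n : B) • ((u ^ (n - 1) : Bˣ) : B) • D u := by
  have hinv : D ((u⁻¹ : Bˣ) : B) = -((u ^ (-2 : ℤ) : Bˣ) : B) • D u := by
    have h := D.leibniz (u : B) ((u⁻¹ : Bˣ) : B)
    rw [Units.mul_inv, D.map_one_eq_zero] at h
    have h2 := congrArg (fun m => ((u⁻¹ : Bˣ) : B) • m) h
    simp only [smul_zero, smul_add, smul_smul, Units.inv_mul, one_smul] at h2
    rw [neg_smul, zpow_neg, eq_neg_iff_add_eq_zero, zpow_two, mul_inv, Units.val_mul]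
    exact h2.symm
  have hpos : ∀ m : ℕ, D ((u ^ (m : ℤ) : Bˣ) : B) =
      ((m : ℤ) : B) • ((u ^ ((m : ℤ) - 1) : Bˣ) : B) • D u := by
    intro m
    induction m with
    | zero => simp
    | succ m ih =>
      rw [Nat.cast_succ, zpow_add_one, Units.val_mul, D.leibniz, ih, smul_smul, smul_smul,
        smul_smul, ← add_smul, add_sub_cancel_right]
      congr 1
      have : (u : B) * ((u ^ ((m : ℤ) - 1) : Bˣ) : B) = ((u ^ (m : ℤ) : Bˣ) : B) := by
        rw [← Units.val_mul, ← zpow_one_add]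
        congr 2; ring
      rw [← this]
      push_cast
      ring
  obtain ⟨m, rfl | rfl⟩ := n.eq_nat_or_neg
  · exact hpos m
  · have h := D.leibniz ((u ^ (m : ℤ) : Bˣ) : B) ((u ^ (-(m : ℤ)) : Bˣ) : B)
    rw [← Units.val_mul, ← zpow_add, add_neg_cancel, zpow_zero, Units.val_one,
      D.map_one_eq_zero, hpos] at h
    have h2 := congrArg (fun x => ((u ^ (-(m : ℤ)) : Bˣ) : B) • x) h
    simp only [smul_zero, smul_add, smul_smul] at h2
    rw [← Units.val_mul, ← zpow_add, neg_add_cancel, zpow_zero, Units.val_one, one_smul] at h2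
    rw [eq_neg_of_add_eq_zero_left h2.symm, smul_smul, ← neg_smul]
    congr 1
    have : ((u ^ (-(m : ℤ) - 1) : Bˣ) : B) = ((u ^ (-(m : ℤ)) : Bˣ) : B) *
        ((u ^ (-(m : ℤ)) : Bˣ) : B) * ((u ^ ((m : ℤ) - 1) : Bˣ) : B) := by
      rw [← Units.val_mul, ← Units.val_mul, ← zpow_add, ← zpow_add]
      congr 2; ring
    rw [this]
    push_cast
    ring

/-- Hensel's lemma along the ideal `(X)`: modulo `X` the polynomial `Tⁿ - w` has the root `1`, with
derivative `n`, a unit because the coefficients form a real algebra. For a negative exponent take a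
root of `w⁻¹`. -/
theorem exists_powerSeries_root (w : PowerSeries A) (hw : PowerSeries.constantCoeff w = 1)
    {q : ℤ} (hq : q ≠ 0) : ∃ a : (PowerSeries A)ˣ,
      PowerSeries.constantCoeff (a : PowerSeries A) = 1 ∧ ((a ^ q : (PowerSeries A)ˣ) :
        PowerSeries A) = w := by
  have key : ∀ (n : ℕ) (v : PowerSeries A), n ≠ 0 → PowerSeries.constantCoeff v = 1 →
      ∃ b : PowerSeries A, PowerSeries.constantCoeff b = 1 ∧ b ^ n = v := by
    intro n v hn hv
    have hI : ∀ f : PowerSeries A, f ∈ Ideal.span {(PowerSeries.X : PowerSeries A)} ↔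
        PowerSeries.constantCoeff f = 0 := fun f => by
      rw [Ideal.mem_span_singleton, PowerSeries.X_dvd_iff]
    obtain ⟨b, hb, hb1⟩ := HenselianRing.is_henselian
      (I := Ideal.span {(PowerSeries.X : PowerSeries A)})
      (Polynomial.X ^ n - Polynomial.C v) (Polynomial.monic_X_pow_sub_C v hn) 1
      (by rw [hI]; simp [hv])
      (by
        have h1 : IsUnit (n : PowerSeries A) := by
          have : ((n : ℝ) : ℝ) ≠ 0 := Nat.cast_ne_zero.2 hn
          have h2 : IsUnit (algebraMap ℝ (PowerSeries A) (n : ℝ)) := (IsUnit.mk0 _ this).map _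
          simpa using h2
        simpa [Polynomial.derivative_X_pow] using h1.map
          (Ideal.Quotient.mk (Ideal.span {(PowerSeries.X : PowerSeries A)})))
    refine ⟨b, ?_, ?_⟩
    · rw [hI, map_sub, map_one, sub_eq_zero] at hb1
      exact hb1
    · simpa [sub_eq_zero] using hb
  have hwu : IsUnit w := PowerSeries.isUnit_iff_constantCoeff.2 (hw ▸ isUnit_one)
  obtain ⟨W, rfl⟩ := hwu
  have unit_root : ∀ (n : ℕ) (V : (PowerSeries A)ˣ), n ≠ 0 →
      PowerSeries.constantCoeff (V : PowerSeries A) = 1 →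
      ∃ a : (PowerSeries A)ˣ, PowerSeries.constantCoeff (a : PowerSeries A) = 1 ∧ a ^ n = V := by
    intro n V hn hV
    obtain ⟨b, hb, hbn⟩ := key n V hn hV
    have hbu : IsUnit b := PowerSeries.isUnit_iff_constantCoeff.2 (hb ▸ isUnit_one)
    obtain ⟨a, rfl⟩ := hbu
    exact ⟨a, hb, Units.ext (by simpa using hbn)⟩
  obtain ⟨m, rfl | rfl⟩ := q.eq_nat_or_neg
  · obtain ⟨a, ha, ham⟩ := unit_root m W (by simpa using hq) hw
    exact ⟨a, ha, by rw [zpow_natCast, ham]⟩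
  · have hWi : PowerSeries.constantCoeff ((W⁻¹ : (PowerSeries A)ˣ) : PowerSeries A) = 1 := by
      have : PowerSeries.constantCoeff (W : PowerSeries A) *
          PowerSeries.constantCoeff ((W⁻¹ : (PowerSeries A)ˣ) : PowerSeries A) = 1 := by
        rw [← map_mul, Units.mul_inv, map_one]
      rwa [hw, one_mul] at this
    obtain ⟨a, ha, ham⟩ := unit_root m W⁻¹ (by simpa using hq) hWi
    exact ⟨a, ha, by rw [zpow_neg, zpow_natCast, ham, inv_inv]⟩

end LaurentSeriesTools

/-! ### Derivations of the Laurent polynomial ring. -/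

section WittTools

open LaurentPolynomial

/-- The linear map `T d/dT` of the Laurent polynomials. -/
noncomputable def laurentEulerLin : LaurentPolynomial ℝ →ₗ[ℝ] LaurentPolynomial ℝ where
  toFun f := AddMonoidAlgebra.ofCoeff
    (Finsupp.onFinset f.coeff.support (fun n : ℤ => (n : ℝ) * f.coeff n) fun n hn =>
      Finsupp.mem_support_iff.2 (right_ne_zero_of_mul hn))
  map_add' f g := by
    ext n
    simp [mul_add]
  map_smul' r f := by
    ext n
    simp [mul_left_comm]

theorem laurentEulerLin_coeff (f : LaurentPolynomial ℝ) (n : ℤ) :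
    (laurentEulerLin f).coeff n = n * f.coeff n := rfl

theorem laurentEulerLin_C_mul_T (r : ℝ) (n : ℤ) :
    laurentEulerLin (C r * T n) = (n : ℝ) • (C r * T n) := by
  ext m
  have h1 : (C r * T n : LaurentPolynomial ℝ).coeff m = if n = m then r else 0 := by
    rw [← single_eq_C_mul_T, AddMonoidAlgebra.coeff_single, Finsupp.single_apply]
  rw [laurentEulerLin_coeff, AddMonoidAlgebra.coeff_smul, Finsupp.smul_apply, h1]
  by_cases h : n = m
  · subst h; simp
  · simp [h]

/-- The derivation `F d/dT` of the Laurent polynomials. -/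
noncomputable def laurentDer (F : LaurentPolynomial ℝ) :
    Derivation ℝ (LaurentPolynomial ℝ) (LaurentPolynomial ℝ) :=
  (F * T (-1)) • Derivation.mk' laurentEulerLin fun f g => by
    induction f using LaurentPolynomial.induction_on' with
    | add f f' hf hf' => rw [add_mul, map_add, map_add, hf, hf']; simp only [smul_eq_mul]; ring
    | C_mul_T n r =>
      induction g using LaurentPolynomial.induction_on' with
      | add g g' hg hg' => rw [mul_add, map_add, map_add, hg, hg']; simp only [smul_eq_mul]; ring
      | C_mul_T m s =>
        have : C r * T n * (C s * T m) = C (r * s) * T (n + m) := by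
          rw [T_add, map_mul]; ring
        rw [this, laurentEulerLin_C_mul_T, laurentEulerLin_C_mul_T, laurentEulerLin_C_mul_T, ← this]
        push_cast
        simp only [smul_eq_mul, add_smul, mul_smul_comm]
        rw [mul_comm (C s * T m), add_comm]

theorem laurentDer_T (F : LaurentPolynomial ℝ) (n : ℤ) :
    laurentDer F (T n) = (n : ℝ) • (T (n - 1) * F) := by
  have h : laurentEulerLin (T n) = (n : ℝ) • T n := by
    simpa using laurentEulerLin_C_mul_T 1 n
  change (F * T (-1)) • laurentEulerLin (T n) = _
  rw [h, smul_eq_mul, mul_smul_comm, sub_eq_add_neg, T_add]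
  congr 1
  ring

theorem laurentDer_T_one (F : LaurentPolynomial ℝ) : laurentDer F (T 1) = F := by
  simp [laurentDer_T]

/-- The variable as a unit. -/
noncomputable def laurentUnit : (LaurentPolynomial ℝ)ˣ :=
  ⟨T 1, T (-1), by rw [← T_add]; simp, by rw [← T_add]; simp⟩

theorem laurentUnit_zpow (k : ℤ) :
    ((laurentUnit ^ k : (LaurentPolynomial ℝ)ˣ) : LaurentPolynomial ℝ) = T k := by
  obtain ⟨m, rfl | rfl⟩ := k.eq_nat_or_neg
  · rw [zpow_natCast, Units.val_pow_eq_pow_val]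
    simp [laurentUnit, T_pow]
  · rw [zpow_neg, zpow_natCast, ← inv_pow, Units.val_pow_eq_pow_val]
    change T (-1) ^ m = _
    rw [T_pow]
    congr 1
    ring

theorem laurentDerivation_T (D : Derivation ℝ (LaurentPolynomial ℝ) (LaurentPolynomial ℝ))
    (n : ℤ) : D (T n) = (n : LaurentPolynomial ℝ) * (T (n - 1) * D (T 1)) := by
  rw [← laurentUnit_zpow n, derivation_units_zpow, laurentUnit_zpow]
  rfl

/-- A derivation over a ring homomorphism out of the Laurent polynomials is determined by its
value on the variable. -/
theorem derivation_eval₂ {B : Type*} [CommRing B] [Algebra ℝ B] (W : Bˣ) (δ : Derivation ℝ B B)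
    (D : Derivation ℝ (LaurentPolynomial ℝ) (LaurentPolynomial ℝ))
    (h : δ W = eval₂ (algebraMap ℝ B) W (D (T 1))) (G : LaurentPolynomial ℝ) :
    δ (eval₂ (algebraMap ℝ B) W G) = eval₂ (algebraMap ℝ B) W (D G) := by
  induction G using LaurentPolynomial.induction_on' with
  | add f g hf hg => simp only [map_add, hf, hg]
  | C_mul_T n r =>
    have hC : (C r : LaurentPolynomial ℝ) = algebraMap ℝ _ r := (C_eq_algebraMap r)
    rw [eval₂_C_mul_T, Derivation.leibniz, Derivation.leibniz, Derivation.map_algebraMap,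
      derivation_units_zpow, h, hC, Derivation.map_algebraMap, smul_zero, smul_zero, add_zero,
      add_zero, laurentDerivation_T D n, smul_eq_mul, smul_eq_mul, smul_eq_mul, smul_eq_mul, map_mul,
      map_mul, map_mul, eval₂_T, map_intCast, ← hC, eval₂_C]

theorem laurentDerivation_ext {D D' : Derivation ℝ (LaurentPolynomial ℝ) (LaurentPolynomial ℝ)}
    (h : D (T 1) = D' (T 1)) : D = D' := by
  refine Derivation.ext fun G => ?_
  induction G using LaurentPolynomial.induction_on' with
  | add f g hf hg => rw [map_add, map_add, hf, hg]
  | C_mul_T n r =>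
    rw [← smul_eq_C_mul, Derivation.map_smul, Derivation.map_smul, laurentDerivation_T,
      laurentDerivation_T D', h]

end WittTools

end RdDym

namespace RdDym

open HahnSeries

/-! ### The generating series of the covering and compatibility of the total derivatives. -/

section Covering

variable (p : ℤ)

theorem level_add_two_ne_zero : ((level p : ℝ) + 2) ≠ 0 := by
  unfold level
  split_ifs with h
  · norm_num
  · intro h2
    apply h
    have : ((p + 2 : ℤ) : ℝ) = 0 := by push_cast; exact h2
    have := Int.cast_eq_zero.1 this
    omega

/-- The function `u_x + x`. -/
noncomputable def fa : SmoothFun := coord (.u 1) + coord .x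
/-- The function `u_y`. -/
noncomputable def fb : SmoothFun := coord (.v 0)

@[simp] theorem totalX_x : totalX p (coord .x) = 1 := vectorField_coord _ _
@[simp] theorem totalX_y : totalX p (coord .y) = 0 := vectorField_coord _ _
@[simp] theorem totalX_u (k : ℕ) : totalX p (coord (.u k)) = coord (.u (k + 1)) :=
  vectorField_coord _ _
@[simp] theorem totalX_v (k : ℕ) : totalX p (coord (.v k)) = coord (.v (k + 1)) :=
  vectorField_coord _ _
theorem totalX_r (n : ℕ) : totalX p (coord (.r n)) = (rXY (level p) (n + 3)).1 :=
  vectorField_coord _ _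
@[simp] theorem totalY_x : totalY p (coord .x) = 0 := vectorField_coord _ _
@[simp] theorem totalY_y : totalY p (coord .y) = 1 := vectorField_coord _ _
@[simp] theorem totalY_u (k : ℕ) : totalY p (coord (.u k)) = coord (.v k) := vectorField_coord _ _
theorem totalY_v (k : ℕ) : totalY p (coord (.v k)) = (totalX p)^[k] rhs := vectorField_coord _ _
theorem totalY_r (n : ℕ) : totalY p (coord (.r n)) = (rXY (level p) (n + 3)).2 :=
  vectorField_coord _ _

theorem rXY_succ_fst (l : ℤ) (m : ℕ) : (rXY l (m + 1)).1 =
    fa * (rXY l m).1 - (rXY l m).2 - ((l : ℝ) + m + 2) • rSeq l m := rfl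
theorem rXY_succ_snd (l : ℤ) (m : ℕ) : (rXY l (m + 1)).2 = fb * (rXY l m).1 := rfl

theorem rXY_one (l : ℤ) : rXY l 1 = (-((l : ℝ) + 2) • 1, 0) := by
  refine Prod.ext ?_ ?_
  · rw [rXY_succ_fst l 0]
    simp only [rXY, rSeq, mul_zero, sub_zero, zero_sub, ← neg_smul]
    congr 1
    push_cast
    ring
  · rw [rXY_succ_snd l 0]
    simp [rXY]

theorem rXY_two (l : ℤ) : rXY l 2 =
    (-((l : ℝ) + 2) • fa + (((l : ℝ) + 3) * ((l : ℝ) + 2)) • coord .x,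
      -((l : ℝ) + 2) • fb) := by
  refine Prod.ext ?_ ?_
  · rw [rXY_succ_fst l 1, rXY_one]
    simp only [rSeq, smul_smul, mul_smul_comm, mul_one, sub_eq_add_neg, ← neg_smul]
    congr 1
    · rw [neg_zero, add_zero]
    · congr 1
      rw [Nat.cast_one]
      ring
  · rw [rXY_succ_snd l 1, rXY_one]
    simp

theorem totalX_rSeq (m : ℕ) : totalX p (rSeq (level p) m) = (rXY (level p) m).1 := by
  match m with
  | 0 => simp [rSeq, rXY]
  | 1 => rw [rXY_one]; simp [rSeq]
  | 2 =>
    rw [rXY_two]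
    simp only [rSeq, map_add, Derivation.map_smul, totalX_u, Derivation.leibniz_pow, totalX_x, fa,
      smul_add, nsmul_eq_mul, smul_eq_mul, mul_one, pow_one, Nat.add_one_sub_one]
    rw [add_assoc, ← add_smul]
    congr 1
    rw [Nat.cast_ofNat, two_mul, smul_add, ← add_smul]
    congr 1
    ring
  | n + 3 => exact totalX_r p n

theorem totalY_rSeq (m : ℕ) : totalY p (rSeq (level p) m) = (rXY (level p) m).2 := by
  match m with
  | 0 => simp [rSeq, rXY]
  | 1 => rw [rXY_one]; simp [rSeq]
  | 2 =>
    rw [rXY_two]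
    simp [rSeq, fb]
  | n + 3 => exact totalY_r p n

theorem totalX_fa : totalX p fa = coord (.u 2) + 1 := by simp [fa]
theorem totalX_fb : totalX p fb = coord (.v 1) := by simp [fb]
theorem totalY_fa : totalY p fa = coord (.v 1) := by simp [fa]
theorem totalY_fb : totalY p fb = fa * totalX p fb - (totalX p fa + 1) * fb := by
  rw [totalX_fa, totalX_fb, fb, totalY_v]
  simp only [Function.iterate_zero, id, rhs, fa]
  ring

/-- The total derivatives acting on Laurent series. -/
noncomputable def DX : Derivation ℝ (HahnSeries ℤ SmoothFun) (HahnSeries ℤ SmoothFun) :=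
  liftDer (totalX p) 0
noncomputable def DY : Derivation ℝ (HahnSeries ℤ SmoothFun) (HahnSeries ℤ SmoothFun) :=
  liftDer (totalY p) 0
/-- The derivation `z d/dz` of the ring of Laurent series. -/
noncomputable def TH : Derivation ℝ (HahnSeries ℤ SmoothFun) (HahnSeries ℤ SmoothFun) :=
  liftDer 0 1
/-- The variable of the Laurent series. -/
noncomputable def lam : HahnSeries ℤ SmoothFun := single 1 1

@[simp] theorem DX_coeff (f : HahnSeries ℤ SmoothFun) (n : ℤ) :
    (DX p f).coeff n = totalX p (f.coeff n) := by simp [DX]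
@[simp] theorem DY_coeff (f : HahnSeries ℤ SmoothFun) (n : ℤ) :
    (DY p f).coeff n = totalY p (f.coeff n) := by simp [DY]
@[simp] theorem TH_coeff (f : HahnSeries ℤ SmoothFun) (n : ℤ) :
    (TH f).coeff n = (n : ℝ) • f.coeff n := by simp [TH]
@[simp] theorem lam_mul_coeff (f : HahnSeries ℤ SmoothFun) (n : ℤ) :
    (lam * f).coeff n = f.coeff (n - 1) := by rw [lam, coeff_single_mul, one_mul]
/-- Constant series. -/
noncomputable def cst : SmoothFun →+* HahnSeries ℤ SmoothFun := HahnSeries.C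
theorem cst_apply (g : SmoothFun) : cst g = single 0 g := rfl
@[simp] theorem cst_mul_coeff (g : SmoothFun) (f : HahnSeries ℤ SmoothFun) (n : ℤ) :
    (cst g * f).coeff n = g * f.coeff n := by
  rw [cst_apply, coeff_single_zero_mul]
theorem cst_coeff (g : SmoothFun) (n : ℤ) : (cst g).coeff n = if n = 0 then g else 0 := by
  rw [cst_apply, coeff_single]; congr
@[simp] theorem liftDer_lam (δ : Derivation ℝ SmoothFun SmoothFun) (κ : ℝ) :
    liftDer δ κ lam = κ • lam := by
  rw [lam, liftDer_single]
  ext n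
  by_cases h : n = 1
  · subst h; simp
  · simp [coeff_single_of_ne h]
@[simp] theorem liftDer_cst (δ : Derivation ℝ SmoothFun SmoothFun) (κ : ℝ) (g : SmoothFun) :
    liftDer δ κ (cst g) = cst (δ g) := by
  rw [cst_apply, liftDer_single, cst_apply]; simp
@[simp] theorem cst_algebraMap_mul (r : ℝ) (f : HahnSeries ℤ SmoothFun) :
    cst (algebraMap ℝ SmoothFun r) * f = r • f := by
  ext n
  rw [cst_mul_coeff, coeff_smul, Algebra.smul_def]
@[simp] theorem DX_lam : DX p lam = 0 := by simp [DX]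
@[simp] theorem DY_lam : DY p lam = 0 := by simp [DY]
@[simp] theorem TH_lam : TH lam = lam := by simp [TH]
@[simp] theorem DX_cst (g : SmoothFun) : DX p (cst g) = cst (totalX p g) := by simp [DX]
@[simp] theorem DY_cst (g : SmoothFun) : DY p (cst g) = cst (totalY p g) := by simp [DY]
@[simp] theorem TH_cst (g : SmoothFun) : TH (cst g) = 0 := by simp [TH]

/-- The generating series of the nonlocal variables. -/
noncomputable def wPS : PowerSeries SmoothFun := PowerSeries.mk (rSeq (level p))
noncomputable def wS : HahnSeries ℤ SmoothFun := ofPowerSeries ℤ SmoothFun (wPS p)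

theorem wS_coeff_nat (m : ℕ) : (wS p).coeff m = rSeq (level p) m := by
  rw [wS, ofPowerSeries_apply_coeff, wPS, PowerSeries.coeff_mk]

theorem wS_coeff_neg {n : ℤ} (hn : n < 0) : (wS p).coeff n = 0 := by
  rw [wS, PowerSeries.coeff_coe, if_pos hn]

/-- The nonzero number `p + 2`. -/
noncomputable def qC : ℝ := (level p : ℝ) + 2

/-- The number `p + 2` as a constant series. -/
noncomputable def qS : HahnSeries ℤ SmoothFun := cst (algebraMap ℝ SmoothFun (qC p))
@[simp] theorem liftDer_qS (δ : Derivation ℝ SmoothFun SmoothFun) (κ : ℝ) :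
    liftDer δ κ (qS p) = 0 := by simp [qS]
@[simp] theorem DX_qS : DX p (qS p) = 0 := liftDer_qS _ _ _
@[simp] theorem DY_qS : DY p (qS p) = 0 := liftDer_qS _ _ _


theorem qC_ne_zero : qC p ≠ 0 := level_add_two_ne_zero p

theorem DX_wS : DX p (wS p) =
    lam * (cst fa * DX p (wS p) - DY p (wS p) - TH (wS p) - qS p * wS p) := by
  ext n
  simp only [DX_coeff, lam_mul_coeff, coeff_sub, cst_mul_coeff, DY_coeff, TH_coeff, qS, cst_algebraMap_mul,
    coeff_smul]
  rcases lt_or_ge n 1 with h | h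
  · rw [wS_coeff_neg p (by omega : n - 1 < 0)]
    rcases lt_or_ge n 0 with h0 | h0
    · simp [wS_coeff_neg p h0]
    · obtain rfl : n = 0 := by omega
      have := wS_coeff_nat p 0
      rw [Nat.cast_zero] at this
      simp [this, rSeq]
  · obtain ⟨m, rfl⟩ : ∃ m : ℕ, n = m + 1 := ⟨(n - 1).toNat, by omega⟩
    rw [add_sub_cancel_right, wS_coeff_nat, ← Nat.cast_succ, wS_coeff_nat, totalX_rSeq,
      totalX_rSeq, totalY_rSeq, rXY_succ_fst, sub_sub _ (_ • _), ← add_smul]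
    congr 2
    rw [qC]
    push_cast
    ring

theorem DY_wS : DY p (wS p) = lam * (cst fb * DX p (wS p)) := by
  ext n
  simp only [DX_coeff, lam_mul_coeff, cst_mul_coeff, DY_coeff]
  rcases lt_or_ge n 1 with h | h
  · rw [wS_coeff_neg p (by omega : n - 1 < 0)]
    rcases lt_or_ge n 0 with h0 | h0
    · simp [wS_coeff_neg p h0]
    · obtain rfl : n = 0 := by omega
      have := wS_coeff_nat p 0
      rw [Nat.cast_zero] at this
      simp [this, rSeq]
  · obtain ⟨m, rfl⟩ : ∃ m : ℕ, n = m + 1 := ⟨(n - 1).toNat, by omega⟩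
    rw [add_sub_cancel_right, wS_coeff_nat, ← Nat.cast_succ, wS_coeff_nat, totalX_rSeq,
      totalY_rSeq, rXY_succ_snd]

/-- The series `1 - (u_x + x) z + u_y z²`. -/
noncomputable def Del : HahnSeries ℤ SmoothFun := 1 - lam * cst fa + lam ^ 2 * cst fb

/-- Eliminating `w_y` from the recursion by means of `DY_wS` puts the `x`-equation in Lax form. -/
theorem Del_mul_DX_wS : Del * DX p (wS p) = -(lam * (TH (wS p) + qS p * wS p)) := by
  have h := DX_wS p
  rw [DY_wS] at h
  rw [Del]
  linear_combination h

theorem Del_unit : ∃ D' : HahnSeries ℤ SmoothFun, Del * D' = 1 ∧ HasLead D' 0 1 := by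
  have h : HasLead Del 0 1 := by
    constructor
    · intro j hj
      rw [Del, coeff_add, coeff_sub, lam_mul_coeff, coeff_one, if_neg hj.ne, cst_coeff,
        if_neg (by omega), pow_two, mul_assoc, lam_mul_coeff, lam_mul_coeff, cst_coeff,
        if_neg (by omega)]
      simp
    · rw [Del, coeff_add, coeff_sub, lam_mul_coeff, coeff_one, if_pos rfl, cst_coeff,
        if_neg (by omega), pow_two, mul_assoc, lam_mul_coeff, lam_mul_coeff, cst_coeff,
        if_neg (by omega)]
      simp
  simpa using h.exists_inv (s := 1) (mul_one 1)

theorem Del_cancel {f : HahnSeries ℤ SmoothFun} (h : Del * f = 0) : f = 0 := by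
  obtain ⟨D', h1, -⟩ := Del_unit
  calc f = D' * (Del * f) := by rw [← mul_assoc, mul_comm D', h1, one_mul]
    _ = 0 := by rw [h, mul_zero]

@[simp] theorem liftDer_Del (δ : Derivation ℝ SmoothFun SmoothFun) :
    liftDer δ 0 Del = -(lam * cst (δ fa)) + lam ^ 2 * cst (δ fb) := by
  simp [Del, Derivation.leibniz_pow]

theorem TH_Del : TH Del = -(lam * cst fa) + 2 * (lam ^ 2 * cst fb) := by
  simp only [Del, map_add, map_sub, Derivation.map_one_eq_zero, Derivation.leibniz, TH_cst,
    Derivation.leibniz_pow, TH_lam, smul_eq_mul, nsmul_eq_mul]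
  push_cast
  ring

theorem TH_liftDer (δ : Derivation ℝ SmoothFun SmoothFun) (f : HahnSeries ℤ SmoothFun) :
    TH (liftDer δ 0 f) = liftDer δ 0 (TH f) := by
  ext n; simp

/-- Compatibility on all nonlocal variables at once is one identity for `w`: it follows from the two
covering equations, their derivatives and the equation for `u_yy`, after cancelling the invertible
series `Del`. -/
theorem totalX_totalY_comm : ⁅totalX p, totalY p⁆ = 0 := by
  have hrel : liftDer ⁅totalX p, totalY p⁆ 0 (wS p) = 0 := by
    rw [← liftDer_lie]
    change DX p (DY p (wS p)) - DY p (DX p (wS p)) = 0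
    have h1 := DY_wS p
    have h2 := Del_mul_DX_wS p
    have h3 := DX_wS p
    have h4 := congrArg (DX p) h1
    have h5 := congrArg (DY p) h3
    have h5' := congrArg (DY p) h1
    have h6 := congrArg (DX p) h2
    have hb : cst (totalY p fb) = cst fa * cst (totalX p fb) - (cst (totalX p fa) + 1) * cst fb := by
      rw [totalY_fb, map_sub, map_mul, map_mul, map_add, map_one]
    have ha : cst (totalY p fa) = cst (totalX p fb) := by rw [totalY_fa, totalX_fb]
    have hT : TH (DY p (wS p)) = DY p (TH (wS p)) := TH_liftDer _ _
    have hT' : TH (DX p (wS p)) = DX p (TH (wS p)) := TH_liftDer _ _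
    have hT1 : TH (DY p (wS p)) = lam * (cst fb * DX p (wS p)) + lam * (cst fb * TH (DX p (wS p))) := by
      rw [h1]
      simp only [Derivation.leibniz, TH_cst, TH_lam, smul_eq_mul]
      ring
    have hD : DX p Del = -(lam * cst (totalX p fa)) + lam ^ 2 * cst (totalX p fb) := liftDer_Del _
    simp only [Derivation.leibniz, DX_cst, DY_cst, DX_lam, DY_lam, smul_eq_mul, map_sub, map_add,
      map_neg, DX_qS, DY_qS, mul_zero, add_zero, hD, ha, hb, ← hT, ← hT'] at h4 h5 h5' h6
    apply Del_cancel
    rw [hT1] at h5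
    have hDel : Del = 1 - lam * cst fa + lam ^ 2 * cst fb := rfl
    rw [hDel] at h6 ⊢
    linear_combination (1 - lam * cst fa + lam ^ 2 * cst fb) * h4 + lam * cst fb * h6 - h5 +
      lam * h5' + lam * qS p * h1
  refine derivation_ext fun c => ?_
  rw [Derivation.commutator_apply, Derivation.zero_apply]
  match c with
  | .x => simp
  | .y => simp
  | .u k => simp
  | .v k => rw [totalY_v, totalX_v, totalY_v, Function.iterate_succ_apply', sub_self]
  | .r n =>
    have := congrArg (fun f => HahnSeries.coeff f ((n + 3 : ℕ) : ℤ)) hrel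
    simp only [liftDer_coeff, zero_mul, zero_smul, add_zero, wS_coeff_nat, coeff_zero] at this
    rwa [Derivation.commutator_apply] at this

end Covering

end RdDym

namespace RdDym

open HahnSeries

/-! ### Encoding symmetries by Laurent series. -/

section SymmetrySeries

variable (p : ℤ)

theorem totalX_totalY (f : SmoothFun) : totalX p (totalY p f) = totalY p (totalX p f) := by
  have := congrArg (fun D => D f) (totalX_totalY_comm p)
  simpa [Derivation.commutator_apply, sub_eq_zero] using this

theorem DX_DY (f : HahnSeries ℤ SmoothFun) : DX p (DY p f) = DY p (DX p f) := by
  ext n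
  simp [totalX_totalY]

theorem TH_DX (f : HahnSeries ℤ SmoothFun) : TH (DX p f) = DX p (TH f) := TH_liftDer _ _

theorem hasLead_DX_wS : HasLead (DX p (wS p)) 1 (algebraMap ℝ SmoothFun (-(qC p))) := by
  constructor
  · intro j hj
    rw [DX_coeff]
    rcases lt_or_ge j 0 with h | h
    · rw [wS_coeff_neg p h, map_zero]
    · obtain rfl : j = 0 := by omega
      have := wS_coeff_nat p 0
      rw [Nat.cast_zero] at this
      simp [this, rSeq]
  · have := wS_coeff_nat p 1
    rw [Nat.cast_one] at this
    rw [DX_coeff, this, totalX_rSeq, rXY_one, Algebra.algebraMap_eq_smul_one]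
    rfl

theorem exists_DX_wS_inv : ∃ g, DX p (wS p) * g = 1 ∧
    HasLead g (-1) (algebraMap ℝ SmoothFun (-(qC p))⁻¹) :=
  (hasLead_DX_wS p).exists_inv (by
    rw [← map_mul, mul_inv_cancel₀ (neg_ne_zero.2 (qC_ne_zero p)), map_one])

/-- The inverse of the `x`-derivative of the generating series. -/
noncomputable def wXI : HahnSeries ℤ SmoothFun := (exists_DX_wS_inv p).choose

theorem DX_wS_mul_wXI : DX p (wS p) * wXI p = 1 := (exists_DX_wS_inv p).choose_spec.1

theorem hasLead_wXI : HasLead (wXI p) (-1) (algebraMap ℝ SmoothFun (-(qC p))⁻¹) :=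
  (exists_DX_wS_inv p).choose_spec.2

theorem DX_wS_cancel {f g : HahnSeries ℤ SmoothFun} (h : DX p (wS p) * f = DX p (wS p) * g) :
    f = g := by
  calc f = wXI p * (DX p (wS p) * f) := by
        rw [← mul_assoc, mul_comm (wXI p), DX_wS_mul_wXI, one_mul]
    _ = g := by rw [h, ← mul_assoc, mul_comm (wXI p), DX_wS_mul_wXI, one_mul]

/-- The operator whose kernel consists of the symbols of fields commuting with the `x`-part of
the Lax pair. -/
noncomputable def TT (f : HahnSeries ℤ SmoothFun) : HahnSeries ℤ SmoothFun :=
  Del * DX p f + lam * TH f - DX p Del * f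

/-- The analogous operator for the `y`-part of the Lax pair. -/
noncomputable def YY (f : HahnSeries ℤ SmoothFun) : HahnSeries ℤ SmoothFun :=
  DY p f - lam * cst fb * DX p f + lam * cst (totalX p fb) * f

theorem DX_Del : DX p Del = -(lam * cst (totalX p fa)) + lam ^ 2 * cst (totalX p fb) :=
  liftDer_Del _

theorem TT_coeff (f : HahnSeries ℤ SmoothFun) (n : ℤ) : (TT p f).coeff n =
    totalX p (f.coeff n) - fa * totalX p (f.coeff (n - 1)) + fb * totalX p (f.coeff (n - 2)) +
      ((n - 1 : ℤ) : ℝ) • f.coeff (n - 1) + totalX p fa * f.coeff (n - 1) -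
      totalX p fb * f.coeff (n - 2) := by
  have h : TT p f = DX p f - lam * (cst fa * DX p f) + lam * (lam * (cst fb * DX p f)) +
      lam * TH f + lam * (cst (totalX p fa) * f) - lam * (lam * (cst (totalX p fb) * f)) := by
    rw [TT, DX_Del, Del]; ring
  rw [h]
  simp only [coeff_add, coeff_sub, lam_mul_coeff, cst_mul_coeff, DX_coeff, TH_coeff]
  rw [show n - 1 - 1 = n - 2 by ring]

theorem YY_coeff (f : HahnSeries ℤ SmoothFun) (n : ℤ) : (YY p f).coeff n =
    totalY p (f.coeff n) - fb * totalX p (f.coeff (n - 1)) + totalX p fb * f.coeff (n - 1) := by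
  rw [YY, mul_assoc, mul_assoc]
  simp only [coeff_add, coeff_sub, lam_mul_coeff, cst_mul_coeff, DX_coeff, DY_coeff]

/-- The series describing symmetries of the covering. -/
structure IsSymSeries (h : HahnSeries ℤ SmoothFun) : Prop where
  coeff_eq_zero : ∀ n < 1, h.coeff n = 0
  TT_eq : TT p h = lam * cst (totalX p (h.coeff 1)) - lam ^ 2 * cst (totalY p (h.coeff 1))
  YY_eq : YY p h = lam * cst (totalY p (h.coeff 1))

/-- The linearized equation. -/
def IsLinearized (φ : SmoothFun) : Prop :=
  totalY p (totalY p φ) = totalX p φ * totalX p fb + fa * totalX p (totalY p φ) -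
    totalX p (totalX p φ) * fb - (totalX p fa + 1) * totalY p φ

section OfSymmetry

/-- The series attached to a vector field. -/
noncomputable def symSeries (S : Derivation ℝ SmoothFun SmoothFun) : HahnSeries ℤ SmoothFun :=
  liftDer S 0 (wS p) * wXI p

/-- The series `h` is chosen so that `S - h D_x` annihilates the generating series. -/
theorem symSeries_mul (S : Derivation ℝ SmoothFun SmoothFun) :
    liftDer S 0 (wS p) = DX p (wS p) * symSeries p S := by
  rw [symSeries, mul_left_comm, DX_wS_mul_wXI, mul_one]

theorem symSeries_eq_iff (S : Derivation ℝ SmoothFun SmoothFun) (h : HahnSeries ℤ SmoothFun) :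
    symSeries p S = h ↔ liftDer S 0 (wS p) = DX p (wS p) * h := by
  rw [symSeries_mul]
  exact ⟨fun e => by rw [e], fun e => DX_wS_cancel p e⟩

theorem liftDer_add_apply (S T : Derivation ℝ SmoothFun SmoothFun) (f : HahnSeries ℤ SmoothFun) :
    liftDer (S + T) 0 f = liftDer S 0 f + liftDer T 0 f := by
  ext n; simp

theorem liftDer_smul_apply (c : ℝ) (S : Derivation ℝ SmoothFun SmoothFun)
    (f : HahnSeries ℤ SmoothFun) : liftDer (c • S) 0 f = c • liftDer S 0 f := by
  ext n; simp

theorem symSeries_add (S T : Derivation ℝ SmoothFun SmoothFun) :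
    symSeries p (S + T) = symSeries p S + symSeries p T := by
  simp only [symSeries, liftDer_add_apply, add_mul]

theorem symSeries_smul (c : ℝ) (S : Derivation ℝ SmoothFun SmoothFun) :
    symSeries p (c • S) = c • symSeries p S := by
  simp only [symSeries, liftDer_smul_apply, smul_mul_assoc]

variable {p} {S : Derivation ℝ SmoothFun SmoothFun} (hS : S ∈ allSymmetries p)
include hS

theorem apply_totalX_of_mem (f : SmoothFun) : S (totalX p f) = totalX p (S f) := by
  have := congrArg (fun D => D f) hS.2.2.1
  simpa [Derivation.commutator_apply, sub_eq_zero] using this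

theorem apply_totalY_of_mem (f : SmoothFun) : S (totalY p f) = totalY p (S f) := by
  have := congrArg (fun D => D f) hS.2.2.2
  simpa [Derivation.commutator_apply, sub_eq_zero] using this

theorem apply_fa_of_mem : S fa = totalX p (S (coord (.u 0))) := by
  rw [fa, map_add, hS.1, add_zero, ← apply_totalX_of_mem hS, totalX_u]

theorem apply_fb_of_mem : S fb = totalY p (S (coord (.u 0))) := by
  rw [fb, ← apply_totalY_of_mem hS, totalY_u]

/-- As `S(x) = 0`, the series `S(w)` starts with `-q S(u) z²`, while `w_x` starts with `-q z`. The
two equations arise by applying `S` to the covering equations and subtracting `h` times their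
`x`-derivatives. -/
theorem isSymSeries_symSeries : IsSymSeries p (symSeries p S) ∧
    (symSeries p S).coeff 1 = S (coord (.u 0)) := by
  have hlead : HasLead (liftDer S 0 (wS p)) 2
      (algebraMap ℝ SmoothFun (-(qC p)) * S (coord (.u 0))) := by
    constructor
    · intro j hj
      rw [liftDer_coeff]
      rcases lt_or_ge j 0 with h | h
      · simp [wS_coeff_neg p h]
      · obtain rfl | rfl : j = 0 ∨ j = 1 := by omega
        · have := wS_coeff_nat p 0
          rw [Nat.cast_zero] at this
          simp [this, rSeq]
        · have := wS_coeff_nat p 1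
          rw [Nat.cast_one] at this
          simp [this, rSeq, hS.1]
    · have := wS_coeff_nat p 2
      rw [Nat.cast_ofNat] at this
      simp [this, rSeq, hS.1, Derivation.leibniz_pow, qC, Algebra.algebraMap_eq_smul_one]
  have hl := hlead.mul (hasLead_wXI p)
  have h1 : (symSeries p S).coeff 1 = S (coord (.u 0)) := by
    have := hl.2
    norm_num at this
    rw [symSeries, this, mul_right_comm, ← map_mul,
      mul_inv_cancel₀ (qC_ne_zero p), map_one, one_mul]
  refine ⟨⟨fun n hn => hl.1 n (by norm_num; exact hn), ?_, ?_⟩, h1⟩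
  · rw [h1]
    apply DX_wS_cancel p
    have e1 := Del_mul_DX_wS p
    have e2 := congrArg (liftDer S 0) e1
    have e3 := congrArg (DX p) e1
    have c1 : liftDer S 0 (DX p (wS p)) = DX p (liftDer S 0 (wS p)) := by
      ext n; simp [apply_totalX_of_mem hS]
    have c2 : liftDer S 0 (TH (wS p)) = TH (liftDer S 0 (wS p)) := (TH_liftDer _ _).symm
    have c3 : DX p (TH (wS p)) = TH (DX p (wS p)) := (TH_DX _ _).symm
    simp only [Derivation.leibniz, smul_eq_mul, map_neg, map_add, liftDer_lam, liftDer_qS,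
      liftDer_Del, c1, c2, c3, DX_lam, DX_qS, symSeries_mul, zero_smul, mul_zero, add_zero,
      apply_fa_of_mem hS, apply_fb_of_mem hS] at e2 e3
    rw [TT]
    linear_combination e2 - symSeries p S * e3
  · rw [h1]
    apply DX_wS_cancel p
    have e1 := DY_wS p
    have e2 := congrArg (liftDer S 0) e1
    have e3 := congrArg (DX p) e1
    have c1 : liftDer S 0 (DX p (wS p)) = DX p (liftDer S 0 (wS p)) := by
      ext n; simp [apply_totalX_of_mem hS]
    have c2 : liftDer S 0 (DY p (wS p)) = DY p (liftDer S 0 (wS p)) := by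
      ext n; simp [apply_totalY_of_mem hS]
    simp only [Derivation.leibniz, smul_eq_mul, liftDer_lam, liftDer_cst, c1, c2, DX_DY,
      DX_lam, DX_cst, symSeries_mul, zero_smul, mul_zero, add_zero, apply_fb_of_mem hS] at e2 e3
    rw [YY]
    linear_combination e2 - symSeries p S * e3

theorem isLinearized_of_mem : IsLinearized p (S (coord (.u 0))) := by
  have h := congrArg S (totalY_fb p)
  simp only [map_sub, map_add, Derivation.leibniz, Derivation.map_one_eq_zero, smul_eq_mul,
    apply_totalX_of_mem hS, apply_totalY_of_mem hS, apply_fa_of_mem hS, apply_fb_of_mem hS] at h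
  rw [IsLinearized, h]
  ring

/-- The coefficient at `z` gives `S(u) = 0`, hence zero on all jets by commutation with the total
derivatives; the higher coefficients give the nonlocal components. -/
theorem eq_zero_of_symSeries_eq_zero (h : symSeries p S = 0) : S = 0 := by
  have h0 : S (coord (.u 0)) = 0 := by
    rw [← (isSymSeries_symSeries hS).2, h, coeff_zero]
  have hu : ∀ k, S (coord (.u k)) = 0 := by
    intro k
    induction k with
    | zero => exact h0
    | succ k ih => rw [← totalX_u p, apply_totalX_of_mem hS, ih, map_zero]
  refine derivation_ext fun c => ?_
  rw [Derivation.zero_apply]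
  match c with
  | .x => exact hS.1
  | .y => exact hS.2.1
  | .u k => exact hu k
  | .v k => rw [← totalY_u p, apply_totalY_of_mem hS, hu, map_zero]
  | .r n =>
    have h2 := congrArg (fun f => HahnSeries.coeff f ((n + 3 : ℕ) : ℤ)) (symSeries_mul p S)
    simp only [h, mul_zero, coeff_zero, liftDer_coeff, wS_coeff_nat, zero_mul, zero_smul,
      add_zero] at h2
    exact h2

end OfSymmetry

section ToSymmetry

/-- The vertical vector field with a given series. -/
noncomputable def symField (h : HahnSeries ℤ SmoothFun) : Derivation ℝ SmoothFun SmoothFun :=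
  vectorField fun
    | .x => 0
    | .y => 0
    | .u k => (totalX p)^[k] (h.coeff 1)
    | .v k => (totalX p)^[k] (totalY p (h.coeff 1))
    -- The variable `r n` stands at `z^{n+3}` in `w`.
    | .r n => (DX p (wS p) * h).coeff ((n + 3 : ℕ) : ℤ)

variable {h : HahnSeries ℤ SmoothFun}

theorem symField_x : symField p h (coord .x) = 0 := vectorField_coord _ _
theorem symField_y : symField p h (coord .y) = 0 := vectorField_coord _ _
theorem symField_u (k : ℕ) : symField p h (coord (.u k)) = (totalX p)^[k] (h.coeff 1) :=
  vectorField_coord _ _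
theorem symField_v (k : ℕ) :
    symField p h (coord (.v k)) = (totalX p)^[k] (totalY p (h.coeff 1)) := vectorField_coord _ _
theorem symField_r (n : ℕ) :
    symField p h (coord (.r n)) = (DX p (wS p) * h).coeff ((n + 3 : ℕ) : ℤ) :=
  vectorField_coord _ _

theorem liftDer_symField_wS (hh : ∀ n < 1, h.coeff n = 0) :
    liftDer (symField p h) 0 (wS p) = DX p (wS p) * h := by
  have hl := (hasLead_DX_wS p).mul (⟨hh, rfl⟩ : HasLead h 1 (h.coeff 1))
  norm_num at hl
  ext n
  rw [liftDer_coeff, zero_mul, zero_smul, add_zero]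
  rcases lt_or_ge n 0 with hn | hn
  · rw [wS_coeff_neg p hn, map_zero, hl.1 n (by omega)]
  · obtain ⟨m, rfl⟩ := Int.eq_ofNat_of_zero_le hn
    rw [wS_coeff_nat]
    match m with
    | 0 => rw [hl.1 _ (by norm_num)]; simp [rSeq]
    | 1 => rw [hl.1 _ (by norm_num)]; simp [rSeq, symField_x]
    | 2 =>
      rw [Nat.cast_ofNat, hl.2]
      simp only [rSeq, map_add, Derivation.map_smul, symField_u, Function.iterate_zero, id,
        Derivation.leibniz_pow, symField_x, smul_zero, add_zero, qC]
      rw [← map_add, ← Algebra.smul_def, neg_smul]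
    | n + 3 => exact symField_r p n

theorem symSeries_symField (hh : ∀ n < 1, h.coeff n = 0) : symSeries p (symField p h) = h :=
  (symSeries_eq_iff p _ _).2 (liftDer_symField_wS p hh)

theorem totalY_iterate (k : ℕ) (f : SmoothFun) :
    totalY p ((totalX p)^[k] f) = (totalX p)^[k] (totalY p f) := by
  induction k with
  | zero => rfl
  | succ k ih => rw [Function.iterate_succ_apply', Function.iterate_succ_apply', ← totalX_totalY, ih]

/-- The equations `TT` and `YY` express commutation with `D_x` and `D_y` on `w`, that is, on the
nonlocal variables. Commutation with `D_y` on the coordinates `v k` is the linearized equation. -/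
theorem symField_mem (hh : IsSymSeries p h) (hl : IsLinearized p (h.coeff 1)) :
    symField p h ∈ allSymmetries p := by
  set S := symField p h with hS
  have hw : liftDer S 0 (wS p) = DX p (wS p) * h := liftDer_symField_wS p hh.coeff_eq_zero
  have hfa : S fa = totalX p (h.coeff 1) := by
    rw [fa, map_add, symField_x, add_zero, symField_u]; rfl
  have hfb : S fb = totalY p (h.coeff 1) := symField_v p 0
  have e1 := Del_mul_DX_wS p
  have e2 := congrArg (liftDer S 0) e1
  have e3 := congrArg (DX p) e1
  have f1 := DY_wS p
  have f2 := congrArg (liftDer S 0) f1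
  have f3 := congrArg (DX p) f1
  have c2 : liftDer S 0 (TH (wS p)) = TH (DX p (wS p) * h) := by rw [← TH_liftDer, hw]
  have c3 : DX p (TH (wS p)) = TH (DX p (wS p)) := (TH_DX _ _).symm
  have t1 := hh.TT_eq
  have y1 := hh.YY_eq
  rw [TT] at t1
  rw [YY] at y1
  simp only [Derivation.leibniz, smul_eq_mul, map_neg, map_add, liftDer_lam, liftDer_qS,
    liftDer_Del, liftDer_cst, c2, c3, hw, DX_lam, DX_qS, DX_cst, DX_DY, zero_smul, mul_zero,
    add_zero, hfa, hfb] at e2 e3 f2 f3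
  have hX : liftDer ⁅S, totalX p⁆ 0 (wS p) = 0 := by
    apply Del_cancel
    rw [← liftDer_lie, hw]
    change Del * (liftDer S 0 (DX p (wS p)) - DX p (DX p (wS p) * h)) = 0
    simp only [Derivation.leibniz, smul_eq_mul]
    linear_combination e2 - h * e3 - DX p (wS p) * t1
  have hX' : liftDer S 0 (DX p (wS p)) = DX p (DX p (wS p) * h) := by
    rw [← liftDer_lie, hw] at hX
    exact sub_eq_zero.1 hX
  have hY : liftDer ⁅S, totalY p⁆ 0 (wS p) = 0 := by
    rw [← liftDer_lie, hw]
    change liftDer S 0 (DY p (wS p)) - DY p (DX p (wS p) * h) = 0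
    rw [hX'] at f2
    simp only [Derivation.leibniz, smul_eq_mul] at f2 ⊢
    linear_combination f2 - h * f3 - DX p (wS p) * y1
  have hr : ∀ (D : Derivation ℝ SmoothFun SmoothFun), liftDer D 0 (wS p) = 0 →
      ∀ n, D (coord (.r n)) = 0 := by
    intro D hD n
    have := congrArg (fun f => HahnSeries.coeff f ((n + 3 : ℕ) : ℤ)) hD
    simp only [liftDer_coeff, zero_mul, zero_smul, add_zero, wS_coeff_nat, coeff_zero] at this
    exact this
  have hCX : ⁅S, totalX p⁆ = 0 := by
    refine derivation_ext fun c => ?_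
    rw [Derivation.zero_apply]
    match c with
    | .x => simp [Derivation.commutator_apply, hS, symField_x]
    | .y => simp [Derivation.commutator_apply, hS, symField_y]
    | .u k =>
      simp [Derivation.commutator_apply, hS, symField_u, -Function.iterate_succ,
        Function.iterate_succ_apply']
    | .v k =>
      simp [Derivation.commutator_apply, hS, symField_v, -Function.iterate_succ,
        Function.iterate_succ_apply']
    | .r n => exact hr _ hX n
  have hCX' : ∀ k f, S ((totalX p)^[k] f) = (totalX p)^[k] (S f) := by
    intro k f
    induction k with
    | zero => rfl
    | succ k ih =>
      rw [Function.iterate_succ_apply', Function.iterate_succ_apply', ← ih]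
      have := congrArg (fun D => D ((totalX p)^[k] f)) hCX
      simpa [Derivation.commutator_apply, sub_eq_zero] using this
  refine ⟨symField_x p, symField_y p, hCX, derivation_ext fun c => ?_⟩
  rw [Derivation.zero_apply]
  match c with
  | .x => simp [Derivation.commutator_apply, hS, symField_x]
  | .y => simp [Derivation.commutator_apply, hS, symField_y]
  | .u k =>
    rw [Derivation.commutator_apply, totalY_u, hS, symField_u, symField_v, totalY_iterate, sub_self]
  | .v k =>
    rw [Derivation.commutator_apply, totalY_v, hCX', hS, symField_v, totalY_iterate, ← hS]
    -- The only place where the linearized equation enters.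
    have : S rhs = totalY p (totalY p (h.coeff 1)) := by
      have h1 : (rhs : SmoothFun) = fa * coord (.v 1) - (coord (.u 2) + 2) * fb := rfl
      have h2 : (2 : SmoothFun) = algebraMap ℝ SmoothFun 2 := (map_ofNat _ 2).symm
      have h3 : S (coord (.v 1)) = totalX p (totalY p (h.coeff 1)) := symField_v p 1
      have h4 : S (coord (.u 2)) = totalX p (totalX p (h.coeff 1)) := symField_u p 2
      rw [hl, h1, map_sub, Derivation.leibniz, Derivation.leibniz, map_add, h2,
        Derivation.map_algebraMap, hfa, hfb, h3, h4, totalX_fb, totalX_fa, ← h2]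
      simp only [smul_eq_mul]
      ring
    rw [this, sub_self]
  | .r n => exact hr _ hY n

end ToSymmetry

theorem symField_symSeries {S : Derivation ℝ SmoothFun SmoothFun} (hS : S ∈ allSymmetries p) :
    symField p (symSeries p S) = S := by
  obtain ⟨h1, h2⟩ := isSymSeries_symSeries hS
  have h3 : symField p (symSeries p S) ∈ allSymmetries p :=
    symField_mem p h1 (by rw [h2]; exact isLinearized_of_mem hS)
  have h4 := eq_zero_of_symSeries_eq_zero ((allSymmetries p).sub_mem h3 hS) (by
    rw [sub_eq_add_neg, ← neg_one_smul ℝ S, symSeries_add, symSeries_smul,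
      symSeries_symField p h1.coeff_eq_zero]
    simp)
  exact sub_eq_zero.1 h4

theorem symSeries_injective {S T : Derivation ℝ SmoothFun SmoothFun} (hS : S ∈ allSymmetries p)
    (hT : T ∈ allSymmetries p) (h : symSeries p S = symSeries p T) : S = T := by
  rw [← symField_symSeries p hS, h, symField_symSeries p hT]

end SymmetrySeries

end RdDym

namespace RdDym

open HahnSeries

/-! ### The first integral of the Lax pair and truncation of its functions. -/

section FirstIntegral

variable (p : ℤ)

theorem exists_root : ∃ a : (PowerSeries SmoothFun)ˣ,
    PowerSeries.constantCoeff (a : PowerSeries SmoothFun) = 1 ∧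
      ((a ^ (level p + 2) : (PowerSeries SmoothFun)ˣ) : PowerSeries SmoothFun) = wPS p :=
  exists_powerSeries_root (wPS p) (by
    rw [← PowerSeries.coeff_zero_eq_constantCoeff_apply, wPS, PowerSeries.coeff_mk]; rfl)
    (by
      have := level_add_two_ne_zero p
      exact_mod_cast this)

/-- The root of the generating series. -/
noncomputable def aPS : (PowerSeries SmoothFun)ˣ := (exists_root p).choose

noncomputable def aU : (HahnSeries ℤ SmoothFun)ˣ :=
  Units.map (ofPowerSeries ℤ SmoothFun : PowerSeries SmoothFun →* HahnSeries ℤ SmoothFun) (aPS p)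

theorem aU_zpow (n : ℤ) : ((aU p ^ n : (HahnSeries ℤ SmoothFun)ˣ) : HahnSeries ℤ SmoothFun) =
    ofPowerSeries ℤ SmoothFun ((aPS p ^ n : (PowerSeries SmoothFun)ˣ) : PowerSeries SmoothFun) := by
  rw [aU, ← map_zpow]; rfl

theorem aU_zpow_level :
    ((aU p ^ (level p + 2) : (HahnSeries ℤ SmoothFun)ˣ) : HahnSeries ℤ SmoothFun) = wS p := by
  rw [aU_zpow, aPS, (exists_root p).choose_spec.2, wS]

theorem hasLead_aU_zpow (n : ℤ) :
    HasLead ((aU p ^ n : (HahnSeries ℤ SmoothFun)ˣ) : HahnSeries ℤ SmoothFun) 0 1 := by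
  have h := hasLead_powerSeries (A := SmoothFun)
    ((aPS p ^ n : (PowerSeries SmoothFun)ˣ) : PowerSeries SmoothFun) 0
  have h0 : (PowerSeries.constantCoeff.toMonoidHom.comp (Units.coeHom _)) (aPS p) =
      (1 : SmoothFun) := (exists_root p).choose_spec.1
  have h1 : PowerSeries.constantCoeff
      ((aPS p ^ n : (PowerSeries SmoothFun)ˣ) : PowerSeries SmoothFun) = 1 := by
    have hu : Units.map (PowerSeries.constantCoeff (R := SmoothFun)).toMonoidHom (aPS p) = 1 :=
      Units.ext h0
    have := congrArg Units.val (map_zpow (Units.map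
      (PowerSeries.constantCoeff (R := SmoothFun)).toMonoidHom) (aPS p) n)
    rw [hu, one_zpow] at this
    exact this
  rw [h1] at h
  rw [aU_zpow]
  simpa using h

/-- The variable as a unit. -/
noncomputable def lamU : (HahnSeries ℤ SmoothFun)ˣ :=
  ⟨single 1 1, single (-1) 1, by simp [single_mul_single], by simp [single_mul_single]⟩

theorem hasLead_lamU_zpow (n : ℤ) :
    ((lamU ^ n : (HahnSeries ℤ SmoothFun)ˣ) : HahnSeries ℤ SmoothFun) = single n 1 := by
  obtain ⟨m, rfl | rfl⟩ := n.eq_nat_or_neg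
  · rw [zpow_natCast, Units.val_pow_eq_pow_val]
    simp [lamU, single_pow]
  · rw [zpow_neg, zpow_natCast, ← inv_pow, Units.val_pow_eq_pow_val]
    change single (-1) (1 : SmoothFun) ^ m = _
    simp [single_pow]

/-- The first integral of the Lax pair. -/
noncomputable def WU : (HahnSeries ℤ SmoothFun)ˣ := lamU * aU p

theorem WU_val : (WU p : HahnSeries ℤ SmoothFun) = lam * aU p := rfl

theorem hasLead_WU_zpow (n : ℤ) :
    HasLead ((WU p ^ n : (HahnSeries ℤ SmoothFun)ˣ) : HahnSeries ℤ SmoothFun) n 1 := by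
  have h := (hasLead_powerSeries (A := SmoothFun) 1 n).mul (hasLead_aU_zpow p n)
  rw [map_one (ofPowerSeries ℤ SmoothFun), mul_one,
    map_one (PowerSeries.constantCoeff (R := SmoothFun)), mul_one, add_zero] at h
  rw [WU, mul_zpow, Units.val_mul, hasLead_lamU_zpow]
  exact h

theorem qS_eq : qS p = ((level p + 2 : ℤ) : HahnSeries ℤ SmoothFun) := by
  rw [qS, qC, map_add, map_intCast, map_add, map_intCast, map_ofNat, map_ofNat]
  push_cast
  rfl

theorem qS_cancel {f : HahnSeries ℤ SmoothFun} (h : qS p * f = 0) : f = 0 := by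
  rw [qS, cst_algebraMap_mul] at h
  exact (smul_eq_zero.1 h).resolve_left (qC_ne_zero p)

theorem wS_cancel {f : HahnSeries ℤ SmoothFun} (h : wS p * f = 0) : f = 0 := by
  rw [← aU_zpow_level] at h
  exact (Units.mul_right_eq_zero _).1 h

/-- The rule `a D(a^q) = q a^q D(a)` for `w = a^q`, which transfers first-order equations from `w`
to its root. -/
theorem aU_mul_derivation_wS
    (D : Derivation ℝ (HahnSeries ℤ SmoothFun) (HahnSeries ℤ SmoothFun)) :
    (aU p : HahnSeries ℤ SmoothFun) * D (wS p) = qS p * (wS p * D (aU p)) := by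
  rw [← aU_zpow_level, derivation_units_zpow, ← qS_eq, smul_eq_mul, smul_eq_mul, mul_left_comm,
    ← mul_assoc (aU p : HahnSeries ℤ SmoothFun), ← Units.val_mul, ← zpow_one_add,
    add_sub_cancel]

/-- The `x`-part of the Lax pair. -/
noncomputable def laxX : Derivation ℝ (HahnSeries ℤ SmoothFun) (HahnSeries ℤ SmoothFun) :=
  Del • DX p + lam • TH
/-- The `y`-part of the Lax pair. -/
noncomputable def laxY : Derivation ℝ (HahnSeries ℤ SmoothFun) (HahnSeries ℤ SmoothFun) :=
  DY p - (lam * cst fb) • DX p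

theorem laxX_apply (f : HahnSeries ℤ SmoothFun) :
    laxX p f = Del * DX p f + lam * TH f := rfl
theorem laxY_apply (f : HahnSeries ℤ SmoothFun) :
    laxY p f = DY p f - lam * cst fb * DX p f := rfl

/-- The operator sends `w` to `-q z w`, hence the root `a` to `-z a`; in `W = z a` this cancels
against its value `z²` on `z`. -/
theorem laxX_WU : laxX p (WU p) = 0 := by
  have h := aU_mul_derivation_wS p (laxX p)
  rw [laxX_apply, Del_mul_DX_wS] at h
  have h2 : laxX p (aU p) = -(lam * aU p) := by
    rw [eq_neg_iff_add_eq_zero]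
    apply wS_cancel p
    apply qS_cancel p
    linear_combination -h
  rw [WU_val, Derivation.leibniz, h2, laxX_apply, DX_lam, TH_lam]
  simp only [smul_eq_mul]
  ring

theorem laxY_WU : laxY p (WU p) = 0 := by
  have h := aU_mul_derivation_wS p (laxY p)
  have h1 : laxY p (wS p) = 0 := by rw [laxY_apply, DY_wS, mul_assoc, sub_self]
  rw [h1, mul_zero] at h
  have h2 : laxY p (aU p) = 0 := wS_cancel p (qS_cancel p h.symm)
  rw [WU_val, Derivation.leibniz, h2, laxY_apply, DX_lam, DY_lam]
  simp

/-- Evaluation of Laurent polynomials at the first integral. -/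
noncomputable def ev : LaurentPolynomial ℝ →+* HahnSeries ℤ SmoothFun :=
  LaurentPolynomial.eval₂ (algebraMap ℝ _) (WU p)

theorem ev_T (n : ℤ) : ev p (LaurentPolynomial.T n) =
    ((WU p ^ n : (HahnSeries ℤ SmoothFun)ˣ) : HahnSeries ℤ SmoothFun) :=
  LaurentPolynomial.eval₂_T _ _ _

theorem ev_T_one : ev p (LaurentPolynomial.T 1) = WU p := by rw [ev_T, zpow_one]

theorem ev_smul (c : ℝ) (F : LaurentPolynomial ℝ) : ev p (c • F) = c • ev p F := by
  rw [LaurentPolynomial.smul_eq_C_mul, map_mul, Algebra.smul_def, ev, LaurentPolynomial.eval₂_C]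

theorem derivation_ev (δ : Derivation ℝ (HahnSeries ℤ SmoothFun) (HahnSeries ℤ SmoothFun))
    (D : Derivation ℝ (LaurentPolynomial ℝ) (LaurentPolynomial ℝ))
    (h : δ (WU p) = ev p (D (LaurentPolynomial.T 1))) (G : LaurentPolynomial ℝ) :
    δ (ev p G) = ev p (D G) := derivation_eval₂ (WU p) δ D h G

theorem laxX_ev (G : LaurentPolynomial ℝ) : laxX p (ev p G) = 0 := by
  rw [derivation_ev p (laxX p) 0 (by rw [laxX_WU]; simp)]; simp

theorem laxY_ev (G : LaurentPolynomial ℝ) : laxY p (ev p G) = 0 := by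
  rw [derivation_ev p (laxY p) 0 (by rw [laxY_WU]; simp)]; simp

theorem hasLead_DX_WU : HasLead (DX p (WU p)) 2 (-1) := by
  obtain ⟨g, hg, hgl⟩ := ((hasLead_aU_zpow p (level p + 2)).exists_inv (s := 1) (mul_one 1))
  have h := aU_mul_derivation_wS p (DX p)
  -- Logarithmic differentiation: `q W_x / W = w_x / w`, with `g = 1 / w`.
  have h1 : qS p * DX p (WU p) = WU p * DX p (wS p) * g := by
    rw [WU_val, Derivation.leibniz, DX_lam, smul_zero, add_zero, smul_eq_mul, mul_assoc lam, h]
    rw [aU_zpow_level] at hg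
    linear_combination (-(lam * qS p * DX p (aU p))) * hg
  have h2 := ((hasLead_WU_zpow p 1).mul (hasLead_DX_wS p)).mul hgl
  rw [zpow_one, ← h1, qS, cst_algebraMap_mul] at h2
  norm_num at h2
  constructor
  · intro j hj
    have := h2.1 j hj
    rw [coeff_smul] at this
    exact (smul_eq_zero.1 this).resolve_left (qC_ne_zero p)
  · have := h2.2
    rw [coeff_smul, Algebra.algebraMap_eq_smul_one, ← smul_neg] at this
    exact smul_right_injective _ (qC_ne_zero p) this

theorem exists_DX_WU_inv : ∃ g, DX p (WU p) * g = 1 ∧ HasLead g (-2) (-1) :=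
  (hasLead_DX_WU p).exists_inv (by ring)

/-- The inverse of the `x`-derivative of the first integral. -/
noncomputable def WXI : HahnSeries ℤ SmoothFun := (exists_DX_WU_inv p).choose

theorem DX_WU_mul_WXI : DX p (WU p) * WXI p = 1 := (exists_DX_WU_inv p).choose_spec.1
theorem hasLead_WXI : HasLead (WXI p) (-2) (-1) := (exists_DX_WU_inv p).choose_spec.2

theorem DX_WU_cancel {f g : HahnSeries ℤ SmoothFun} (h : DX p (WU p) * f = DX p (WU p) * g) :
    f = g := by
  calc f = WXI p * (DX p (WU p) * f) := by
        rw [← mul_assoc, mul_comm (WXI p), DX_WU_mul_WXI, one_mul]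
    _ = g := by rw [h, ← mul_assoc, mul_comm (WXI p), DX_WU_mul_WXI, one_mul]

/-- The symbol of the vector field `F(W) ∂/∂W`. -/
noncomputable def HS (F : LaurentPolynomial ℝ) : HahnSeries ℤ SmoothFun := ev p F * WXI p

theorem DX_WU_mul_HS (F : LaurentPolynomial ℝ) : DX p (WU p) * HS p F = ev p F := by
  rw [HS, mul_left_comm, DX_WU_mul_WXI, mul_one]

theorem HS_add (F G : LaurentPolynomial ℝ) : HS p (F + G) = HS p F + HS p G := by
  rw [HS, map_add, add_mul]; rfl

theorem HS_smul (c : ℝ) (F : LaurentPolynomial ℝ) : HS p (c • F) = c • HS p F := by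
  rw [HS, ev_smul, smul_mul_assoc]; rfl

/-- With `F(W) = W_x H`, subtract `H` times the `x`-derivative of the Lax equation for `W` from the
Lax equation for `F(W)`; the difference is `W_x` times `TT H`. -/
theorem TT_HS (F : LaurentPolynomial ℝ) : TT p (HS p F) = 0 := by
  apply DX_WU_cancel p
  have h1 := laxX_ev p F
  have h2 := congrArg (DX p) (laxX_WU p)
  rw [← DX_WU_mul_HS, laxX_apply] at h1
  rw [laxX_apply] at h2
  simp only [Derivation.leibniz, smul_eq_mul, map_add, map_zero, DX_lam, ← TH_DX] at h1 h2
  rw [TT]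
  linear_combination h1 - HS p F * h2

theorem YY_HS (F : LaurentPolynomial ℝ) : YY p (HS p F) = 0 := by
  apply DX_WU_cancel p
  have h1 := laxY_ev p F
  have h2 := congrArg (DX p) (laxY_WU p)
  rw [← DX_WU_mul_HS, laxY_apply] at h1
  rw [laxY_apply] at h2
  simp only [Derivation.leibniz, smul_eq_mul, map_sub, map_zero, DX_lam, DX_cst, DX_DY] at h1 h2
  rw [YY]
  linear_combination h1 - HS p F * h2

/-- Truncation disturbs the equations only at `z` and `z²`, and the defects are exactly the
right-hand sides required in `IsSymSeries`. -/
theorem isSymSeries_posPart {H : HahnSeries ℤ SmoothFun} (hT : TT p H = 0) (hY : YY p H = 0) :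
    IsSymSeries p (posPart H) := by
  have hT' := fun n => (TT_coeff p H n).symm.trans (by rw [hT, coeff_zero])
  have hY' := fun n => (YY_coeff p H n).symm.trans (by rw [hY, coeff_zero])
  have hlam2 : ∀ (g : SmoothFun) (n : ℤ), (lam ^ 2 * cst g).coeff n = if n = 2 then g else 0 := by
    intro g n
    rw [pow_two, mul_assoc, lam_mul_coeff, lam_mul_coeff, cst_coeff]
    congr 1
    exact propext ⟨fun h => by omega, fun h => by omega⟩
  have hlam1 : ∀ (g : SmoothFun) (n : ℤ), (lam * cst g).coeff n = if n = 1 then g else 0 := by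
    intro g n
    rw [lam_mul_coeff, cst_coeff]
    congr 1
    exact propext ⟨fun h => by omega, fun h => by omega⟩
  have hpos : ∀ n, 1 ≤ n → (posPart H).coeff n = H.coeff n := fun n hn => by
    rw [posPart_coeff, if_pos hn]
  have hneg : ∀ n, n < 1 → (posPart H).coeff n = 0 := fun n hn => by
    rw [posPart_coeff, if_neg (not_le.2 hn)]
  refine ⟨hneg, ?_, ?_⟩
  · ext n
    rw [TT_coeff, coeff_sub, hlam1, hlam2, hpos 1 le_rfl]
    rcases lt_trichotomy n 1 with hn | rfl | hn
    · rw [hneg n hn, hneg (n - 1) (by omega), hneg (n - 2) (by omega), if_neg (by omega),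
        if_neg (by omega)]
      simp
    · rw [hpos 1 le_rfl, hneg (1 - 1) (by omega), hneg (1 - 2) (by omega), if_pos rfl,
        if_neg (by omega)]
      simp
    · rcases eq_or_lt_of_le (Int.add_one_le_of_lt hn) with h2 | h2
      · obtain rfl : n = 2 := by omega
        have e1 := hT' 2
        have e2 := hY' 1
        norm_num at e1 e2 ⊢
        rw [hpos 2 (by omega), hpos 1 le_rfl, hneg 0 (by omega)]
        simp only [map_zero, mul_zero]
        -- The missing contribution of the coefficient at `z⁰` is its `YY` expression for the
        -- `y`-derivative of the coefficient at `z`.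
        linear_combination e1 + e2
      · rw [hpos n (by omega), hpos (n - 1) (by omega), hpos (n - 2) (by omega),
          if_neg (by omega), if_neg (by omega), sub_zero]
        exact hT' n
  · ext n
    rw [YY_coeff, hlam1, hpos 1 le_rfl]
    rcases lt_trichotomy n 1 with hn | rfl | hn
    · rw [hneg n hn, hneg (n - 1) (by omega), if_neg (by omega)]
      simp
    · rw [hpos 1 le_rfl, hneg (1 - 1) (by omega), if_pos rfl]
      simp
    · rw [hpos n (by omega), hpos (n - 1) (by omega), if_neg (by omega)]
      exact hY' n

/-- The coefficients of `TT` at `z` and of `YY` at `1` and `z` express `D_y` of the coefficients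
`H₀`, `H₁` through their `x`-derivatives; differentiating the formula for `D_y H₁` and eliminating
`H₀` gives the linearized equation. -/
theorem isLinearized_coeff {H : HahnSeries ℤ SmoothFun} (hT : TT p H = 0) (hY : YY p H = 0) :
    IsLinearized p (H.coeff 1) := by
  have x1 := (TT_coeff p H 1).symm.trans (by rw [hT, coeff_zero])
  have y1 := (YY_coeff p H 1).symm.trans (by rw [hY, coeff_zero])
  have y0 := (YY_coeff p H 0).symm.trans (by rw [hY, coeff_zero])
  norm_num at x1 y1 y0
  have hy1 : totalY p (H.coeff 1) = fb * totalX p (H.coeff 0) - totalX p fb * H.coeff 0 := by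
    linear_combination y1
  have hy0 : totalY p (H.coeff 0) =
      fa * totalX p (H.coeff 0) - totalX p fa * H.coeff 0 - totalX p (H.coeff 1) := by
    linear_combination y0 + x1
  have hb := totalY_fb p
  have hyy := congrArg (totalY p) hy1
  have hxy := congrArg (totalX p) hy1
  have hx0 := congrArg (totalX p) hy0
  have hxb := congrArg (totalX p) hb
  simp only [map_sub, map_add, Derivation.leibniz, smul_eq_mul, Derivation.map_one_eq_zero,
    totalX_totalY, add_zero] at hyy hxy hx0 hxb
  rw [IsLinearized, totalX_totalY]
  linear_combination hyy - fa * hxy + fb * hx0 + totalX p (H.coeff 0) * hb -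
    totalX p fb * hy0 - H.coeff 0 * hxb + (totalX p fa + 1) * hy1

end FirstIntegral

end RdDym

namespace RdDym

open HahnSeries LaurentPolynomial

/-! ### The Witt algebra inside the symmetries. -/

section WittFields

variable (p : ℤ)

/-- The nonlocal symmetry with symbol the truncation of `F(W) ∂/∂W`. -/
noncomputable def wittField (F : LaurentPolynomial ℝ) : Derivation ℝ SmoothFun SmoothFun :=
  symField p (posPart (HS p F))

theorem posPart_coeff_of_lt (f : HahnSeries ℤ SmoothFun) (n : ℤ) (hn : n < 1) :
    (posPart f).coeff n = 0 := by
  rw [posPart_coeff, if_neg (not_le.2 hn)]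

theorem posPart_eq_self {f : HahnSeries ℤ SmoothFun} (hf : ∀ n < 1, f.coeff n = 0) :
    posPart f = f := by
  ext n
  rw [posPart_coeff]
  split_ifs with h
  · rfl
  · exact (hf n (not_le.1 h)).symm

theorem wittField_mem (F : LaurentPolynomial ℝ) : wittField p F ∈ allSymmetries p := by
  refine symField_mem p (isSymSeries_posPart p (TT_HS p F) (YY_HS p F)) ?_
  rw [posPart_coeff, if_pos le_rfl]
  exact isLinearized_coeff p (TT_HS p F) (YY_HS p F)

theorem symSeries_wittField (F : LaurentPolynomial ℝ) :
    symSeries p (wittField p F) = posPart (HS p F) :=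
  symSeries_symField p (posPart_coeff_of_lt _)

theorem wittField_add (F G : LaurentPolynomial ℝ) :
    wittField p (F + G) = wittField p F + wittField p G := by
  refine symSeries_injective p (wittField_mem p _)
    ((allSymmetries p).add_mem (wittField_mem p _) (wittField_mem p _)) ?_
  rw [symSeries_add, symSeries_wittField, symSeries_wittField, symSeries_wittField, HS_add, map_add]

theorem wittField_smul (c : ℝ) (F : LaurentPolynomial ℝ) :
    wittField p (c • F) = c • wittField p F := by
  refine symSeries_injective p (wittField_mem p _)
    ((allSymmetries p).smul_mem c (wittField_mem p _)) ?_
  rw [symSeries_smul, symSeries_wittField, symSeries_wittField, HS_smul, map_smul]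

/-- The chain rule: `W` is a function of `z` and `w`, and both `D` and `D_x` vanish on `z`. -/
theorem derivation_WU
    (D : Derivation ℝ (HahnSeries ℤ SmoothFun) (HahnSeries ℤ SmoothFun)) (hD : D lam = 0)
    {h : HahnSeries ℤ SmoothFun} (hw : D (wS p) = DX p (wS p) * h) :
    D (WU p) = DX p (WU p) * h := by
  have h1 := aU_mul_derivation_wS p D
  have h2 := aU_mul_derivation_wS p (DX p)
  have h3 : D (aU p) - DX p (aU p) * h = 0 := by
    apply wS_cancel p
    apply qS_cancel p
    rw [hw] at h1
    linear_combination h * h2 - h1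
  rw [WU_val, Derivation.leibniz, Derivation.leibniz, hD, DX_lam]
  simp only [smul_eq_mul]
  linear_combination lam * h3

theorem liftDer_WU (S : Derivation ℝ SmoothFun SmoothFun) :
    liftDer S 0 (WU p) = DX p (WU p) * symSeries p S :=
  derivation_WU p _ (by simp) (symSeries_mul p S)

theorem coeff_mul_eq_zero_of_nonpos {f g : HahnSeries ℤ SmoothFun}
    (hf : ∀ n, 1 ≤ n → f.coeff n = 0) (hg : ∀ n, 1 ≤ n → g.coeff n = 0) (n : ℤ) (hn : 1 ≤ n) :
    (f * g).coeff n = 0 := by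
  rw [coeff_mul]
  refine Finset.sum_eq_zero fun ij hij => ?_
  have h := (Finset.mem_antidiagonal.1 hij).2.2
  rcases le_or_gt 1 ij.1 with h1 | h1
  · rw [hf _ h1, zero_mul]
  · rw [hg _ (by omega), mul_zero]

theorem liftDer_DX_of_mem {S : Derivation ℝ SmoothFun SmoothFun} (hS : S ∈ allSymmetries p)
    (f : HahnSeries ℤ SmoothFun) : liftDer S 0 (DX p f) = DX p (liftDer S 0 f) := by
  ext n; simp [apply_totalX_of_mem hS]

/-- Compare two lifted derivations that act on functions of `W` as `F ∂_W` and `G ∂_W`. Their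
commutator differs from the lift of the bracket of the symmetries by a series without positive
exponents times `D_x`. -/
theorem symSeries_lie_wittField (F G : LaurentPolynomial ℝ) :
    symSeries p ⁅wittField p F, wittField p G⁆ =
      posPart (HS p (laurentDer F G - laurentDer G F)) := by
  let nF := HS p F - posPart (HS p F)
  let nG := HS p G - posPart (HS p G)
  have hn : ∀ H : HahnSeries ℤ SmoothFun, ∀ n, 1 ≤ n → (H - posPart H).coeff n = 0 := by
    intro H n hn
    rw [coeff_sub, posPart_coeff, if_pos hn, sub_self]
  -- Restoring the discarded part of `F(W) / W_x` as a multiple of `D_x` gives a derivation with `W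
  -- ↦ F(W)`.
  have hT : ∀ F, (liftDer (wittField p F) 0 + (HS p F - posPart (HS p F)) • DX p) (WU p) =
      ev p F := by
    intro F
    rw [← DX_WU_mul_HS]
    refine derivation_WU p _ (by simp) ?_
    rw [Derivation.add_apply, Derivation.smul_apply, symSeries_mul, symSeries_wittField,
      smul_eq_mul]
    ring
  have hT2 : ∀ F G, (liftDer (wittField p F) 0 + (HS p F - posPart (HS p F)) • DX p) (ev p G) =
      ev p (laurentDer F G) := fun F G =>
    derivation_ev p _ _ (by rw [hT, laurentDer_T_one]) G
  have e1 := hT2 F G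
  have e2 := hT2 G F
  rw [← hT G] at e1
  rw [← hT F] at e2
  have c1 := liftDer_DX_of_mem p (wittField_mem p F)
  have c2 := liftDer_DX_of_mem p (wittField_mem p G)
  have hL := liftDer_lie (wittField p F) (wittField p G) 0 0 (WU p : HahnSeries ℤ SmoothFun)
  rw [liftDer_WU p ⁅wittField p F, wittField p G⁆] at hL
  set h := symSeries p ⁅wittField p F, wittField p G⁆ with hh
  -- The `D_x`-component of the commutator of the two lifts; positive exponents cannot arise, since
  -- series without them are closed under products and coefficientwise derivations.
  let N := liftDer (wittField p F) 0 nG - liftDer (wittField p G) 0 nF + nF * DX p nG -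
    nG * DX p nF
  have hN : ∀ n, 1 ≤ n → N.coeff n = 0 := by
    intro n h1
    have d1 : ∀ n, 1 ≤ n → (DX p nG).coeff n = 0 := fun n hh => by
      rw [DX_coeff, hn _ n hh, map_zero]
    have d2 : ∀ n, 1 ≤ n → (DX p nF).coeff n = 0 := fun n hh => by
      rw [DX_coeff, hn _ n hh, map_zero]
    simp only [N, coeff_sub, coeff_add, liftDer_coeff]
    rw [coeff_mul_eq_zero_of_nonpos (hn _) d1 n h1, coeff_mul_eq_zero_of_nonpos (hn _) d2 n h1,
      hn _ n h1, hn _ n h1]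
    simp
  have key : h + N = HS p (laurentDer F G - laurentDer G F) := by
    apply DX_WU_cancel p
    rw [DX_WU_mul_HS, map_sub, ← e1, ← e2]
    simp only [Derivation.add_apply, Derivation.smul_apply, smul_eq_mul, map_add,
      Derivation.leibniz, c1, c2]
    simp only [N]
    linear_combination -hL
  have hmem := (isSymSeries_symSeries ((allSymmetries p).lie_mem (wittField_mem p F)
    (wittField_mem p G))).1.coeff_eq_zero
  rw [← key, map_add, posPart_eq_self hmem]
  have : posPart N = 0 := by
    ext n
    rw [posPart_coeff]
    split_ifs with h1
    · exact hN n h1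
    · rfl
  rw [this, add_zero]

theorem wittField_lie (F G : LaurentPolynomial ℝ) :
    ⁅wittField p F, wittField p G⁆ = wittField p (laurentDer F G - laurentDer G F) :=
  symSeries_injective p ((allSymmetries p).lie_mem (wittField_mem p F) (wittField_mem p G))
    (wittField_mem p _) (by rw [symSeries_lie_wittField, symSeries_wittField])

end WittFields

/-! ### The weight grading and translations in `y`. -/

section Normalizer

variable (p : ℤ)

/-- A field normalizing the covering acts on its symmetries. -/
theorem lie_mem_and_symSeries {δ S : Derivation ℝ SmoothFun SmoothFun} {κ c : ℝ}
    (hX : ⁅δ, totalX p⁆ = c • totalX p) (hY : ⁅δ, totalY p⁆ = 0)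
    (hw : liftDer δ κ (wS p) = 0) (hS : S ∈ allSymmetries p)
    (hx : S (δ (coord .x)) = 0) (hy : S (δ (coord .y)) = 0) :
    ⁅δ, S⁆ ∈ allSymmetries p ∧
      symSeries p ⁅δ, S⁆ = liftDer δ κ (symSeries p S) + c • symSeries p S := by
  obtain ⟨h1, h2, h3, h4⟩ := id hS
  refine ⟨⟨?_, ?_, ?_, ?_⟩, ?_⟩
  · rw [Derivation.commutator_apply, h1, hx, map_zero, sub_zero]
  · rw [Derivation.commutator_apply, h2, hy, map_zero, sub_zero]
  · rw [lie_lie, h3, hX, lie_zero, lie_smul, h3, smul_zero, sub_zero]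
  · rw [lie_lie, h4, hY, lie_zero, lie_zero, sub_zero]
  · rw [symSeries_eq_iff, ← liftDer_lie δ S κ 0, hw, map_zero, sub_zero, symSeries_mul,
      Derivation.leibniz]
    have : liftDer δ κ (DX p (wS p)) = c • DX p (wS p) := by
      have h5 := liftDer_lie δ (totalX p) κ 0 (wS p)
      rw [hw, map_zero, sub_zero, hX, liftDer_smul_apply] at h5
      exact h5
    rw [this, smul_eq_mul, smul_eq_mul, mul_smul_comm, mul_add, mul_smul_comm, mul_comm (symSeries p S)]

theorem euler_coord (c : Coord) : euler (coord c) = (weight c : ℝ) • coord c :=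
  vectorField_coord _ _

theorem euler_fa : euler fa = fa := by
  rw [fa, map_add, euler_coord, euler_coord]
  simp only [weight]
  norm_num

theorem euler_fb : euler fb = (2 : ℝ) • fb := by
  rw [fb, euler_coord]
  simp only [weight]
  norm_num

theorem euler_rSeq (l : ℤ) (m : ℕ) : euler (rSeq l m) = (m : ℝ) • rSeq l m := by
  match m with
  | 0 => simp [rSeq]
  | 1 => simp [rSeq, euler_coord, weight]
  | 2 =>
    simp only [rSeq, map_add, Derivation.map_smul, euler_coord, weight, Derivation.leibniz_pow,
      smul_add, smul_smul]
    simp only [pow_one, smul_eq_mul, Nat.add_one_sub_one, Algebra.smul_def, map_mul,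
      map_natCast, map_intCast]
    push_cast
    simp only [map_ofNat, map_intCast]
    ring
  | n + 3 =>
    rw [rSeq, euler_coord]
    simp [weight]

theorem euler_rXY (l : ℤ) (m : ℕ) : euler (rXY l m).1 = ((m : ℝ) - 1) • (rXY l m).1 ∧
    euler (rXY l m).2 = (m : ℝ) • (rXY l m).2 := by
  induction m with
  | zero => simp [rXY]
  | succ m ih =>
    rw [rXY_succ_fst, rXY_succ_snd]
    simp only [map_sub, Derivation.leibniz, Derivation.map_smul, ih.1, ih.2, euler_fa, euler_fb,
      euler_rSeq, smul_eq_mul, smul_smul]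
    simp only [Algebra.smul_def, Nat.cast_succ, add_sub_cancel_right, map_mul, map_add, map_sub,
      map_one, map_natCast, map_intCast, map_ofNat]
    constructor <;> ring

theorem euler_lie_totalX : ⁅euler, totalX p⁆ = (-1 : ℝ) • totalX p := by
  refine derivation_ext fun c => ?_
  rw [Derivation.commutator_apply, Derivation.smul_apply, euler_coord, Derivation.map_smul]
  match c with
  | .x => simp [weight]
  | .y => simp
  | .u k =>
    rw [totalX_u, euler_coord, ← sub_smul]
    congr 1
    simp only [weight]
    push_cast
    ring
  | .v k =>
    rw [totalX_v, euler_coord, ← sub_smul]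
    congr 1
    simp only [weight]
    push_cast
    ring
  | .r n =>
    rw [totalX_r, (euler_rXY _ _).1, ← sub_smul]
    congr 1
    simp only [weight]
    push_cast
    ring

theorem euler_totalX (f : SmoothFun) :
    euler (totalX p f) = totalX p (euler f) - totalX p f := by
  have := congrArg (fun D => D f) (euler_lie_totalX p)
  rw [Derivation.commutator_apply, Derivation.smul_apply, neg_one_smul] at this
  linear_combination this

theorem euler_rhs : euler rhs = (2 : ℝ) • rhs := by
  have h1 : (rhs : SmoothFun) = fa * coord (.v 1) - (coord (.u 2) + 2) * fb := rfl
  have h2 : (2 : SmoothFun) = algebraMap ℝ SmoothFun 2 := (map_ofNat _ 2).symm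
  have h3 : euler 2 = 0 := Derivation.map_natCast _ 2
  rw [h1]
  simp only [map_sub, map_add, Derivation.leibniz, h3, euler_fa, euler_fb,
    euler_coord, weight, smul_eq_mul, Algebra.smul_def, ← h2]
  simp
  ring

theorem euler_lie_totalY : ⁅euler, totalY p⁆ = 0 := by
  refine derivation_ext fun c => ?_
  rw [Derivation.commutator_apply, Derivation.zero_apply, euler_coord, Derivation.map_smul]
  match c with
  | .x => simp
  | .y => simp [weight]
  | .u k => simp [euler_coord, weight]
  | .v k =>
    rw [totalY_v, sub_eq_zero]
    simp only [weight]
    induction k with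
    | zero => simpa using euler_rhs
    | succ k ih =>
      rw [Function.iterate_succ_apply', euler_totalX, ih, Derivation.map_smul]
      push_cast
      simp only [sub_smul, add_smul, one_smul]
      ring
  | .r n =>
    rw [totalY_r, (euler_rXY _ _).2, ← sub_smul]
    simp [weight]

/-- With `z` given weight `-1`, the series `w` is homogeneous of weight zero. -/
theorem liftDer_euler_wS : liftDer euler (-1) (wS p) = 0 := by
  ext n
  rw [liftDer_coeff, coeff_zero]
  rcases lt_or_ge n 0 with hn | hn
  · simp [wS_coeff_neg p hn]
  · obtain ⟨m, rfl⟩ := Int.eq_ofNat_of_zero_le hn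
    rw [wS_coeff_nat, euler_rSeq, ← add_smul]
    simp

theorem liftDer_euler_DX (f : HahnSeries ℤ SmoothFun) :
    liftDer euler (-1) (DX p f) = DX p (liftDer euler (-1) f) - DX p f := by
  ext n
  simp only [liftDer_coeff, DX_coeff, coeff_sub, euler_totalX, map_add, Derivation.map_smul]
  ring

theorem symSeries_euler_lie {S : Derivation ℝ SmoothFun SmoothFun} (hS : S ∈ allSymmetries p) :
    ⁅euler, S⁆ ∈ allSymmetries p ∧
      symSeries p ⁅euler, S⁆ = liftDer euler (-1) (symSeries p S) - symSeries p S := by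
  have := lie_mem_and_symSeries p (euler_lie_totalX p) (euler_lie_totalY p) (liftDer_euler_wS p) hS
    (by rw [euler_coord, Derivation.map_smul, hS.1, smul_zero])
    (by rw [euler_coord, Derivation.map_smul, hS.2.1, smul_zero])
  rwa [neg_one_smul, ← sub_eq_add_neg] at this

/-- Since `w` has weight zero and `D_x` lowers weight by one, `S(w) / w_x` has weight `k + 1`; the
weight `-1` of `z` shifts the coefficient at `zⁿ` by `n`. -/
theorem isHomogeneous_iff {S : Derivation ℝ SmoothFun SmoothFun} (hS : S ∈ allSymmetries p)
    (k : ℤ) : IsHomogeneous k S ↔ ∀ n : ℤ, euler ((symSeries p S).coeff n) =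
      ((k + 1 + n : ℤ) : ℝ) • (symSeries p S).coeff n := by
  obtain ⟨h1, h2⟩ := symSeries_euler_lie p hS
  have h3 : IsHomogeneous k S ↔ symSeries p ⁅euler, S⁆ = symSeries p ((k : ℝ) • S) :=
    ⟨fun h => by rw [h], symSeries_injective p h1 ((allSymmetries p).smul_mem _ hS)⟩
  rw [h3, h2, symSeries_smul, HahnSeries.ext_iff, funext_iff]
  refine forall_congr' fun n => ?_
  simp only [coeff_sub, liftDer_coeff, coeff_smul]
  push_cast
  simp only [add_smul, one_smul, neg_mul, neg_smul, one_mul]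
  constructor
  · intro h
    linear_combination h
  · intro h
    linear_combination h

theorem liftDer_euler_WU : liftDer euler (-1) (WU p : HahnSeries ℤ SmoothFun) = -WU p := by
  have h := aU_mul_derivation_wS p (liftDer euler (-1))
  rw [liftDer_euler_wS, mul_zero] at h
  have h2 : liftDer euler (-1) (aU p : HahnSeries ℤ SmoothFun) = 0 :=
    wS_cancel p (qS_cancel p h.symm)
  rw [WU_val, Derivation.leibniz, h2, liftDer_lam]
  simp only [smul_eq_mul, neg_smul, one_smul]
  ring

theorem liftDer_euler_HS (n : ℤ) :
    liftDer euler (-1) (HS p (T n)) = ((2 - n : ℤ) : ℝ) • HS p (T n) := by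
  apply DX_WU_cancel p
  have h1 := congrArg (liftDer euler (-1)) (DX_WU_mul_HS p (T n))
  have h2 : liftDer euler (-1) (ev p (T n)) = -(n : ℝ) • ev p (T n) := by
    have := derivation_ev p (liftDer euler (-1)) (laurentDer (-T 1)) (by
      rw [laurentDer_T_one, map_neg, ev_T_one, liftDer_euler_WU]) (T n)
    rw [this, laurentDer_T, mul_neg, ← T_add, sub_add_cancel, smul_neg, map_neg, ev_smul, neg_smul]
  rw [h2, Derivation.leibniz, liftDer_euler_DX, liftDer_euler_WU, ← DX_WU_mul_HS] at h1
  rw [smul_eq_mul, smul_eq_mul, map_neg] at h1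
  push_cast
  rw [sub_smul, mul_sub, mul_smul_comm, mul_smul_comm]
  rw [neg_smul] at h1
  have h3 : (2 : ℝ) • (DX p (WU p) * HS p (T n)) = 2 * (DX p (WU p) * HS p (T n)) := by
    rw [two_smul, two_mul]
  rw [h3]
  linear_combination h1

theorem isHomogeneous_wittField (k : ℤ) : IsHomogeneous k (wittField p (T (1 - k))) := by
  rw [isHomogeneous_iff p (wittField_mem p _)]
  intro n
  rw [symSeries_wittField, posPart_coeff]
  split_ifs with h
  · have := congrArg (fun f => HahnSeries.coeff f n) (liftDer_euler_HS p (1 - k))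
    simp only [liftDer_coeff, coeff_smul] at this
    rw [eq_sub_of_add_eq this, ← sub_smul]
    congr 1
    push_cast
    ring
  · simp

/-- The symmetry induced by translations in `y`. -/
noncomputable def yField : Derivation ℝ SmoothFun SmoothFun := symField p (lam * cst fb)

theorem lam_mul_cst_coeff (f : SmoothFun) (n : ℤ) :
    (lam * cst f).coeff n = if n = 1 then f else 0 := by
  rw [lam_mul_coeff, cst_coeff]
  congr 1
  exact propext ⟨fun h => by omega, fun h => by omega⟩

theorem yField_mem : yField p ∈ allSymmetries p := by
  have hb := totalY_fb p
  have h1 : (lam * cst fb).coeff 1 = fb := by rw [lam_mul_cst_coeff, if_pos rfl]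
  refine symField_mem p ⟨fun n hn => by rw [lam_mul_cst_coeff, if_neg hn.ne], ?_, ?_⟩ ?_
  · rw [h1, hb, TT, DX_Del, Del]
    simp only [Derivation.leibniz, smul_eq_mul, DX_lam, DX_cst, TH_lam, TH_cst, map_sub, map_mul,
      map_add, map_one]
    ring
  · rw [h1, YY]
    simp only [Derivation.leibniz, smul_eq_mul, DX_lam, DX_cst, DY_lam, DY_cst]
    ring
  · rw [h1, IsLinearized]
    have h2 := congrArg (totalY p) hb
    have h3 : totalY p fa = totalX p fb := by rw [totalY_fa, totalX_fb]
    simp only [map_sub, map_add, Derivation.leibniz, smul_eq_mul, Derivation.map_one_eq_zero,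
      ← totalX_totalY, h3] at h2
    linear_combination h2

theorem symSeries_yField : symSeries p (yField p) = lam * cst fb :=
  symSeries_symField p fun n hn => by rw [lam_mul_cst_coeff, if_neg hn.ne]

theorem isHomogeneous_yField : IsHomogeneous 0 (yField p) := by
  rw [isHomogeneous_iff p (yField_mem p)]
  intro n
  rw [symSeries_yField, lam_mul_cst_coeff]
  split_ifs with h
  · subst h
    rw [euler_fb]
    norm_num
  · simp

/-- The field with series `z u_y` is the vertical form of translation in `y`, up to sign; in this
shape its brackets are easy to compute. -/
theorem yField_eq : yField p = totalY p - pd .y := by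
  have hb : (lam * cst fb).coeff 1 = fb := by rw [lam_mul_cst_coeff, if_pos rfl]
  have hv : ∀ k, (totalX p)^[k] fb = coord (.v k) := by
    intro k
    induction k with
    | zero => rfl
    | succ k ih => rw [Function.iterate_succ_apply', ih, totalX_v]
  refine derivation_ext fun c => ?_
  rw [Derivation.sub_apply, yField]
  match c with
  | .x => simp [symField_x, pd_coord]
  | .y => simp [symField_y]
  | .u k => rw [symField_u, totalY_u, pd_coord_of_ne (by simp), hb, hv, sub_zero]
  | .v k =>
    rw [symField_v, totalY_v, pd_coord_of_ne (by simp), hb, fb, totalY_v, sub_zero]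
    rfl
  | .r n =>
    rw [symField_r, pd_coord_of_ne (by simp), sub_zero, mul_comm, mul_assoc, ← DY_wS, DY_coeff,
      wS_coeff_nat]
    rfl

theorem pd_y_rXY (l : ℤ) (m : ℕ) : pd .y (rXY l m).1 = 0 ∧ pd .y (rXY l m).2 = 0 := by
  have hr : ∀ m, pd .y (rSeq l m) = 0 := fun m => by
    match m with
    | 0 => simp [rSeq]
    | 1 => simp [rSeq, pd_coord]
    | 2 => simp [rSeq, pd_coord, Derivation.leibniz_pow]
    | n + 3 => simp [rSeq, pd_coord]
  induction m with
  | zero => simp [rXY]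
  | succ m ih =>
    rw [rXY_succ_fst, rXY_succ_snd]
    simp [ih.1, ih.2, hr, fa, fb, pd_coord]

theorem pd_y_lie_totalX : ⁅pd .y, totalX p⁆ = 0 := by
  refine derivation_ext fun c => ?_
  rw [Derivation.commutator_apply, Derivation.zero_apply]
  match c with
  | .x => simp [pd_coord]
  | .y => simp
  | .u k => simp [pd_coord]
  | .v k => simp [pd_coord]
  | .r n => rw [totalX_r, (pd_y_rXY _ _).1, pd_coord_of_ne (by simp)]; simp

theorem liftDer_pd_y_wS : liftDer (pd .y) 0 (wS p) = 0 := by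
  ext n
  rw [liftDer_coeff, coeff_zero, zero_mul, zero_smul, add_zero]
  rcases lt_or_ge n 0 with hn | hn
  · simp [wS_coeff_neg p hn]
  · obtain ⟨m, rfl⟩ := Int.eq_ofNat_of_zero_le hn
    rw [wS_coeff_nat]
    match m with
    | 0 => simp [rSeq]
    | 1 => simp [rSeq, pd_coord]
    | 2 => simp [rSeq, pd_coord, Derivation.leibniz_pow]
    | n + 3 => simp [rSeq, pd_coord]

theorem liftDer_pd_y_HS (F : LaurentPolynomial ℝ) : liftDer (pd .y) 0 (HS p F) = 0 := by
  have hW : liftDer (pd .y) 0 (WU p : HahnSeries ℤ SmoothFun) = 0 := by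
    rw [derivation_WU p (liftDer (pd .y) 0) (h := 0) (by simp)
      (by rw [liftDer_pd_y_wS, mul_zero]), mul_zero]
  have hWx : liftDer (pd .y) 0 (DX p (WU p)) = 0 := by
    have := liftDer_lie (pd .y) (totalX p) 0 0 (WU p : HahnSeries ℤ SmoothFun)
    rw [hW, map_zero, sub_zero, pd_y_lie_totalX] at this
    rw [DX, this]
    ext n; simp
  have hev : liftDer (pd .y) 0 (ev p F) = 0 := by
    rw [derivation_ev p (liftDer (pd .y) 0) 0 (by rw [hW]; simp)]; simp
  apply DX_WU_cancel p
  rw [← DX_WU_mul_HS, Derivation.leibniz, hWx, smul_zero, add_zero, smul_eq_mul] at hev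
  rw [hev, mul_zero]

/-- A symmetry commutes with `D_y`, so only the bracket with `∂_y` remains. It vanishes because `w`,
hence `W` and every `F(W) / W_x`, is free of `y`. -/
theorem yField_lie_wittField (F : LaurentPolynomial ℝ) : ⁅yField p, wittField p F⁆ = 0 := by
  have hm := wittField_mem p F
  refine eq_zero_of_symSeries_eq_zero ((allSymmetries p).lie_mem (yField_mem p) hm) ?_
  have hY : ⁅pd .y, totalY p⁆ = 0 := by
    have hx : ∀ f, pd .y (totalX p f) = totalX p (pd .y f) := fun f => by
      have := congrArg (fun D => D f) (pd_y_lie_totalX p)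
      simpa [Derivation.commutator_apply, sub_eq_zero] using this
    refine derivation_ext fun c => ?_
    rw [Derivation.commutator_apply, Derivation.zero_apply]
    match c with
    | .x => simp [pd_coord]
    | .y => simp
    | .u k => simp [pd_coord]
    | .v k =>
      rw [totalY_v, pd_coord_of_ne (by simp), map_zero, sub_zero]
      have : ∀ k, pd .y ((totalX p)^[k] rhs) = 0 := by
        intro k
        induction k with
        | zero =>
          have h2 : pd .y (2 : SmoothFun) = 0 := Derivation.map_natCast _ 2
          simp [rhs, pd_coord, h2]
        | succ k ih => rw [Function.iterate_succ_apply', hx, ih, map_zero]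
      exact this k
    | .r n => rw [totalY_r, (pd_y_rXY _ _).2, pd_coord_of_ne (by simp)]; simp
  have h3 := lie_mem_and_symSeries p (c := 0) (κ := 0) (δ := pd .y)
      (by rw [pd_y_lie_totalX, zero_smul]) hY (liftDer_pd_y_wS p) hm
      (by rw [pd_coord_of_ne (by simp), map_zero]) (by rw [pd_coord_self]; simp)
  have h4 : ⁅yField p, wittField p F⁆ = (-1 : ℝ) • ⁅pd .y, wittField p F⁆ := by
    rw [yField_eq, sub_lie, ← lie_skew, hm.2.2.2, neg_zero, zero_sub, neg_one_smul]
  rw [h4, symSeries_smul, h3.2, symSeries_wittField, zero_smul, add_zero]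
  have h5 : liftDer (pd .y) 0 (posPart (HS p F)) = 0 := by
    ext n
    have := congrArg (fun f => HahnSeries.coeff f n) (liftDer_pd_y_HS p F)
    simp only [liftDer_coeff, zero_mul, zero_smul, add_zero, coeff_zero] at this
    rw [liftDer_coeff, posPart_coeff]
    split_ifs
    · simpa using this
    · simp
  rw [h5, smul_zero]

end Normalizer

end RdDym

namespace RdDym

open HahnSeries LaurentPolynomial

/-! ### The common kernel of the total derivatives. -/

section Kernel

variable (p : ℤ)

theorem exists_bound (f : SmoothFun) :
    ∃ N : ℕ, ∀ k ≥ N, pd (.u k) f = 0 ∧ pd (.v k) f = 0 ∧ pd (.r k) f = 0 := by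
  obtain ⟨s, hs, -⟩ := exists_finset_derivation_apply f
  let idx : Coord → ℕ := fun c => match c with
    | .x => 0
    | .y => 0
    | .u k => k
    | .v k => k
    | .r k => k
  have h : ∀ c, s.sup idx + 1 ≤ idx c → pd c f = 0 := fun c hc => hs c fun hcs => by
    have := Finset.le_sup (f := idx) hcs
    omega
  exact ⟨s.sup idx + 1, fun k hk => ⟨h _ hk, h _ hk, h _ hk⟩⟩

theorem pd_rSeq_of_ne {c : Coord} (l : ℤ) (hx : c ≠ .x) (hu : c ≠ .u 0) (hr : ∀ n, c ≠ .r n)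
    (m : ℕ) : pd c (rSeq l m) = 0 := by
  match m with
  | 0 => simp [rSeq]
  | 1 => simp [rSeq, pd_coord, hx.symm]
  | 2 => simp [rSeq, pd_coord, hx.symm, hu.symm, Derivation.leibniz_pow]
  | n + 3 => simp [rSeq, pd_coord, (hr n).symm]

theorem pd_rXY_of_ne {c : Coord} (l : ℤ) (ha : pd c fa = 0) (hb : pd c fb = 0)
    (hr : ∀ m, pd c (rSeq l m) = 0) (m : ℕ) : pd c (rXY l m).1 = 0 ∧ pd c (rXY l m).2 = 0 := by
  induction m with
  | zero => simp [rXY]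
  | succ m ih =>
    rw [rXY_succ_fst, rXY_succ_snd]
    simp [ih.1, ih.2, hr, ha, hb]

/-- The index starts at `2`: the derivatives of the nonlocal variables involve `u_x`, so `∂/∂u_x`
has further terms in its commutator with `D_x`. -/
theorem pd_u_totalX (k : ℕ) (f : SmoothFun) :
    pd (.u (k + 2)) (totalX p f) = totalX p (pd (.u (k + 2)) f) + pd (.u (k + 1)) f := by
  have h : ⁅pd (.u (k + 2)), totalX p⁆ = pd (.u (k + 1)) := by
    refine derivation_ext fun c => ?_
    rw [Derivation.commutator_apply]
    match c with
    | .x => simp [pd_coord]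
    | .y => simp [pd_coord]
    | .u j =>
      rw [totalX_u, pd_coord, pd_coord, pd_coord]
      simp only [Coord.u.injEq]
      by_cases h1 : j = k + 1 <;> by_cases h2 : j = k + 2 <;> simp [h1, h2]
    | .v j => simp [pd_coord]
    | .r n =>
      rw [totalX_r, (pd_rXY_of_ne _ (by simp [fa, pd_coord]) (by simp [fb, pd_coord])
        (pd_rSeq_of_ne _ (by simp) (by simp) (by simp)) _).1, pd_coord_of_ne (by simp),
        pd_coord_of_ne (by simp)]
      simp
  have := congrArg (fun D => D f) h
  rw [← this, Derivation.commutator_apply, add_sub_cancel]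

theorem pd_v_totalX (k : ℕ) (f : SmoothFun) :
    pd (.v (k + 1)) (totalX p f) = totalX p (pd (.v (k + 1)) f) + pd (.v k) f := by
  have h : ⁅pd (.v (k + 1)), totalX p⁆ = pd (.v k) := by
    refine derivation_ext fun c => ?_
    rw [Derivation.commutator_apply]
    match c with
    | .x => simp [pd_coord]
    | .y => simp [pd_coord]
    | .u j => simp [pd_coord]
    | .v j =>
      rw [totalX_v, pd_coord, pd_coord, pd_coord]
      simp only [Coord.v.injEq]
      by_cases h1 : j = k <;> by_cases h2 : j = k + 1 <;> simp [h1, h2]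
    | .r n =>
      rw [totalX_r, (pd_rXY_of_ne _ (by simp [fa, pd_coord]) (by simp [fb, pd_coord])
        (pd_rSeq_of_ne _ (by simp) (by simp) (by simp)) _).1, pd_coord_of_ne (by simp),
        pd_coord_of_ne (by simp)]
      simp
  have := congrArg (fun D => D f) h
  rw [← this, Derivation.commutator_apply, add_sub_cancel]

section Iterates

variable {A : Type*} [CommRing A] [Algebra ℝ A] (D : Derivation ℝ A A)

theorem iterate_derivation_zero (i : ℕ) : D^[i] 0 = 0 := by
  induction i with
  | zero => rfl
  | succ i ih => rw [Function.iterate_succ_apply', ih, map_zero]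

theorem iterate_derivation_sub (i : ℕ) (f g : A) : D^[i] (f - g) = D^[i] f - D^[i] g := by
  induction i with
  | zero => rfl
  | succ i ih => simp only [Function.iterate_succ_apply', ih, map_sub]

theorem iterate_derivation_add (i : ℕ) (f g : A) : D^[i] (f + g) = D^[i] f + D^[i] g := by
  induction i with
  | zero => rfl
  | succ i ih => simp only [Function.iterate_succ_apply', ih, map_add]

theorem iterate_derivation_smul (i : ℕ) (r : ℝ) (f : A) : D^[i] (r • f) = r • D^[i] f := by
  induction i with
  | zero => rfl
  | succ i ih => simp only [Function.iterate_succ_apply', ih, Derivation.map_smul]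

theorem iterate_derivation_mul_of_eq_zero (i : ℕ) {e : A} (he : D e = 0) (f : A) :
    D^[i] (e * f) = e * D^[i] f := by
  induction i with
  | zero => rfl
  | succ i ih =>
    simp only [Function.iterate_succ_apply', ih, Derivation.leibniz, he, mul_zero, add_zero,
      smul_eq_mul]

theorem iterate_derivation_mul_of_eq_one (i : ℕ) {e : A} (he : D e = 1) (f : A) :
    D^[i + 1] (e * f) = e * D^[i + 1] f + ((i : A) + 1) * D^[i] f := by
  induction i with
  | zero => simp [he]
  | succ i ih =>
    rw [Function.iterate_succ_apply', ih]
    simp only [Function.iterate_succ_apply', map_add, Derivation.leibniz, he, smul_eq_mul, mul_one,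
      Derivation.map_natCast, Derivation.map_one_eq_zero, mul_zero, add_zero]
    push_cast
    ring

theorem iterate_derivation_eq_zero_of_le {i j : ℕ} (h : i ≤ j) {f : A} (hf : D^[i] f = 0) :
    D^[j] f = 0 := by
  obtain ⟨k, rfl⟩ := Nat.exists_eq_add_of_le' h
  rw [Function.iterate_add_apply, hf, iterate_derivation_zero]

end Iterates

/-- The recursion multiplies by `u_x + x` at each stage, so the `x`-derivative at index `m + 1` has
degree exactly `m` in `u_x`, with constant leading coefficient. These distinct degrees separate the
nonlocal variables. -/
theorem iterate_pd_u_rXY (l : ℤ) (m : ℕ) :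
    (pd (.u 1))^[m] (rXY l (m + 1)).1 =
      algebraMap ℝ SmoothFun (-((l : ℝ) + 2) * (m.factorial : ℝ)) ∧
    (pd (.u 1))^[m] (rXY l (m + 1)).2 = 0 := by
  induction m with
  | zero => simp [rXY_one, Algebra.algebraMap_eq_smul_one]
  | succ m ih =>
    have ha : pd (.u 1) fa = 1 := by simp [fa, pd_coord]
    have hb : pd (.u 1) fb = 0 := by simp [fb, pd_coord]
    have hr : (pd (.u 1))^[m + 1] (rSeq l (m + 1)) = 0 := by
      rw [Function.iterate_succ_apply, pd_rSeq_of_ne l (by simp) (by simp) (by simp),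
        iterate_derivation_zero]
    have h1 : (pd (.u 1))^[m + 1] (rXY l (m + 1)).1 = 0 := by
      rw [Function.iterate_succ_apply', ih.1, Derivation.map_algebraMap]
    have h2 : (pd (.u 1))^[m + 1] (rXY l (m + 1)).2 = 0 := by
      rw [Function.iterate_succ_apply', ih.2, map_zero]
    rw [rXY_succ_fst l (m + 1), rXY_succ_snd l (m + 1), iterate_derivation_sub,
      iterate_derivation_sub, iterate_derivation_smul, iterate_derivation_mul_of_eq_one _ _ ha,
      iterate_derivation_mul_of_eq_zero _ _ hb, h1, h2, hr, ih.1]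
    refine ⟨?_, mul_zero _⟩
    rw [mul_zero, zero_add, sub_zero, smul_zero, sub_zero, Nat.factorial_succ]
    simp only [map_mul, map_natCast]
    push_cast
    ring

theorem iterate_pd_v_rXY (l : ℤ) (m : ℕ) :
    (pd (.v 0))^[m + 1] (rXY l (m + 1)).1 = 0 ∧
    (pd (.v 0))^[m + 1] (rXY l (m + 1)).2 = 0 := by
  induction m with
  | zero => simp [rXY_one]
  | succ m ih =>
    have ha : pd (.v 0) fa = 0 := by simp [fa, pd_coord]
    have hb : pd (.v 0) fb = 1 := by simp [fb]
    have hr : (pd (.v 0))^[m + 1 + 1] (rSeq l (m + 1)) = 0 := by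
      rw [Function.iterate_succ_apply, pd_rSeq_of_ne l (by simp) (by simp) (by simp),
        iterate_derivation_zero]
    have h1 := iterate_derivation_eq_zero_of_le _ (Nat.le_succ _) ih.1
    have h2 := iterate_derivation_eq_zero_of_le _ (Nat.le_succ _) ih.2
    rw [Nat.succ_eq_add_one] at h1 h2
    rw [rXY_succ_fst l (m + 1), rXY_succ_snd l (m + 1), iterate_derivation_sub,
      iterate_derivation_sub, iterate_derivation_smul, iterate_derivation_mul_of_eq_one _ _ hb,
      iterate_derivation_mul_of_eq_zero _ _ ha, h1, h2, hr, ih.1]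
    simp

/-- Functions killed by the total `x`-derivative depend on `y` only. -/
theorem pd_eq_zero_of_totalX_eq_zero {f : SmoothFun} (hf : totalX p f = 0) (c : Coord)
    (hc : c ≠ .y) : pd c f = 0 := by
  obtain ⟨N, hN⟩ := exists_bound f
  have desc : ∀ P : ℕ → Prop, (∀ k ≥ N, P k) → (∀ k, P (k + 1) → P k) → ∀ k, P k := by
    intro P h1 h2 k
    by_contra hk
    have : ∀ j, ¬ P (k + j) := fun j => by
      induction j with
      | zero => exact hk
      | succ j ih => exact fun h => ih (h2 _ h)
    exact this N (h1 _ (by omega))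
  -- Descent from the finite bound: the commutator with `D_x` passes from each jet variable to the
  -- one below, down to `u_x` and `u_y`.
  have hu : ∀ k, pd (.u (k + 1)) f = 0 := desc (fun k => pd (.u (k + 1)) f = 0)
    (fun k hk => (hN _ (by omega)).1) fun k hk => by
      have := pd_u_totalX p k f
      rw [hf, hk, map_zero, map_zero, zero_add] at this
      exact this.symm
  have hv : ∀ k, pd (.v k) f = 0 := desc _ (fun k hk => (hN _ hk).2.1) fun k hk => by
    have := pd_v_totalX p k f
    rw [hf, hk, map_zero, map_zero, zero_add] at this
    exact this.symm
  obtain ⟨s, hs, hsum⟩ := exists_finset_derivation_apply f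
  -- The relation `D_x f = 0` may be differentiated in `u_x` on its coefficients only, because the
  -- partial derivatives of `f` no longer involve `u_x`.
  have hit : ∀ i, ∑ c ∈ s, (pd (.u 1))^[i] (totalX p (coord c)) * pd c f = 0 := by
    intro i
    induction i with
    | zero => rw [Function.iterate_zero, ← hf, hsum (totalX p)]; rfl
    | succ i ih =>
      have := congrArg (pd (.u 1)) ih
      rw [map_sum, map_zero] at this
      rw [← this]
      refine Finset.sum_congr rfl fun c _ => ?_
      rw [Derivation.leibniz, pd_pd_comm, hu, map_zero, smul_zero, zero_add, smul_eq_mul,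
        Function.iterate_succ_apply', mul_comm]
  have single : ∀ (c : Coord) (i : ℕ) (r : ℝ), r ≠ 0 →
      (pd (.u 1))^[i] (totalX p (coord c)) = algebraMap ℝ SmoothFun r →
      (∀ d ≠ c, (pd (.u 1))^[i] (totalX p (coord d)) * pd d f = 0) → pd c f = 0 := by
    intro c i r hr h1 h2
    by_cases hcs : c ∈ s
    · have h3 := hit i
      rw [Finset.sum_eq_single_of_mem c hcs fun d _ hd => h2 d hd, h1, ← Algebra.smul_def] at h3
      exact (smul_eq_zero.1 h3).resolve_left hr
    · exact hs c hcs
  -- Starting with the highest nonlocal variable `r k` present, `k + 2` derivatives in `u_x` leave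
  -- only its term, with a nonzero constant coefficient.
  have hrr : ∀ n, pd (.r n) f = 0 := by
    have : ∀ k, ∀ n ≥ k, pd (.r n) f = 0 := desc _
      (fun k hk n hn => (hN n (le_trans hk hn)).2.2) fun k hk n hn => by
      rcases eq_or_lt_of_le hn with rfl | h
      · refine single (.r k) (k + 2) (-((level p : ℝ) + 2) * ((k + 2).factorial : ℝ))
          (mul_ne_zero (neg_ne_zero.2 (level_add_two_ne_zero p))
            (Nat.cast_ne_zero.2 (Nat.factorial_ne_zero _)))
          (by rw [totalX_r]; exact (iterate_pd_u_rXY _ (k + 2)).1) fun d hd => ?_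
        match d with
        | .x =>
          rw [totalX_x, Function.iterate_succ_apply, Derivation.map_one_eq_zero,
            iterate_derivation_zero, zero_mul]
        | .y => rw [totalX_y, iterate_derivation_zero, zero_mul]
        | .u 0 =>
          rw [totalX_u, Function.iterate_succ_apply, Function.iterate_succ_apply, zero_add,
            pd_coord_self, Derivation.map_one_eq_zero, iterate_derivation_zero, zero_mul]
        | .u (k + 1) => rw [hu, mul_zero]
        | .v k => rw [hv, mul_zero]
        | .r j =>
          rcases lt_trichotomy j k with h | h | h
          · rw [totalX_r, iterate_derivation_eq_zero_of_le _ (i := j + 2 + 1) (by omega), zero_mul]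
            rw [Function.iterate_succ_apply', (iterate_pd_u_rXY _ (j + 2)).1,
              Derivation.map_algebraMap]
          · exact absurd (by rw [h]) hd
          · rw [hk j (by omega), mul_zero]
      · exact hk n h
    exact fun n => this 0 n (Nat.zero_le _)
  -- The same argument for `D_x u = u_x`, of degree one; below, `D_x x = 1`, of degree zero, handles
  -- `x`.
  have hu0 : pd (.u 0) f = 0 := by
    refine single (.u 0) 1 1 one_ne_zero (by simp) fun d hd => ?_
    match d with
    | .x => simp
    | .y => simp
    | .u 0 => exact absurd rfl hd
    | .u (k + 1) => rw [hu, mul_zero]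
    | .v k => rw [hv, mul_zero]
    | .r j => rw [hrr, mul_zero]
  match c with
  | .x =>
    refine single .x 0 1 one_ne_zero (by simp) fun d hd => ?_
    match d with
    | .x => exact absurd rfl hd
    | .y => simp
    | .u 0 => rw [hu0, mul_zero]
    | .u (k + 1) => rw [hu, mul_zero]
    | .v k => rw [hv, mul_zero]
    | .r j => rw [hrr, mul_zero]
  | .y => exact absurd rfl hc
  | .u 0 => exact hu0
  | .u (k + 1) => exact hu k
  | .v k => exact hv k
  | .r n => exact hrr n

theorem exists_eq_algebraMap_of_total {f : SmoothFun} (hX : totalX p f = 0)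
    (hY : totalY p f = 0) : ∃ r : ℝ, f = algebraMap ℝ SmoothFun r := by
  have h := pd_eq_zero_of_totalX_eq_zero p hX
  refine exists_eq_algebraMap fun c => ?_
  by_cases hc : c = .y
  · subst hc
    rw [derivation_apply_eq_single (totalY p) f .y (fun c hc => by rw [h c hc, mul_zero]),
      totalY_y, one_mul] at hY
    exact hY
  · exact h c hc

end Kernel

/-! ### Symmetries with vanishing component along `u`. -/

section Invisible

variable (p : ℤ) {S : Derivation ℝ SmoothFun SmoothFun}

/-- The basis field of weight `k`. -/
noncomputable def basisField (k : ℤ) : Derivation ℝ SmoothFun SmoothFun := wittField p (T (1 - k))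

theorem basisField_mem (k : ℤ) : basisField p k ∈ allSymmetries p := wittField_mem p _

theorem isHomogeneous_basisField (k : ℤ) : IsHomogeneous k (basisField p k) :=
  isHomogeneous_wittField p k

theorem basisField_lie (i j : ℤ) :
    ⁅basisField p i, basisField p j⁆ = ((i - j : ℤ) : ℝ) • basisField p (i + j) := by
  rw [basisField, basisField, wittField_lie, basisField, ← wittField_smul, laurentDer_T,
    laurentDer_T, ← T_add, ← T_add, show 1 - j - 1 + (1 - i) = 1 - (i + j) by ring,
    show 1 - i - 1 + (1 - j) = 1 - (i + j) by ring, ← sub_smul]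
  congr 2
  push_cast
  ring

theorem hasLead_HS_T (n : ℤ) : HasLead (HS p (T n)) (n - 2) (-1) := by
  have := (hasLead_WU_zpow p n).mul (hasLead_WXI p)
  rw [one_mul, ← ev_T] at this
  exact this

/-- For these weights `W^{1-k} / W_x` has no nonpositive exponents, so nothing is truncated. -/
theorem symSeries_basisField (k : ℤ) (hk : k ≤ -2) : symSeries p (basisField p k) = HS p (T (1 - k)) ∧
    HasLead (symSeries p (basisField p k)) (-k - 1) (-1) := by
  have h := hasLead_HS_T p (1 - k)
  rw [show 1 - k - 2 = -k - 1 by ring] at h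
  have h2 : symSeries p (basisField p k) = HS p (T (1 - k)) := by
    rw [basisField, symSeries_wittField, posPart_eq_self]
    exact fun n hn => h.1 n (by omega)
  exact ⟨h2, h2 ▸ h⟩

theorem basisField_ne_zero (k : ℤ) (hk : k ≤ -2) : basisField p k ≠ 0 := by
  intro h
  have h1 := (symSeries_basisField p k hk).2.2
  have h2 : symSeries p 0 = 0 := by
    have := symSeries_smul p 0 0
    rwa [zero_smul, zero_smul] at this
  rw [h, h2, coeff_zero] at h1
  have := congrArg (fun f => SmoothFun.eval f 0) h1
  simp at this

variable {p}

/-- When `S(u) = 0` both series equations are homogeneous, so the first possibly nonzero coefficient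
is killed by `D_x` and `D_y` and is constant. Its weight is `k + 1 + m`, so a nonzero constant
forces `m = -k - 1`. -/
theorem exists_coeff_eq_algebraMap (hS : S ∈ allSymmetries p) {k : ℤ} (hk : IsHomogeneous k S)
    (h0 : S (coord (.u 0)) = 0) {m : ℤ} (hm : ∀ j < m, (symSeries p S).coeff j = 0) :
    ∃ r : ℝ, (symSeries p S).coeff m = algebraMap ℝ SmoothFun r ∧ (m ≠ -k - 1 → r = 0) := by
  obtain ⟨h1, h2⟩ := isSymSeries_symSeries hS
  rw [h0] at h2
  have hT := h1.TT_eq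
  have hY := h1.YY_eq
  simp only [h2, map_zero, mul_zero, sub_zero] at hT hY
  have t := (TT_coeff p (symSeries p S) m).symm.trans (by rw [hT, coeff_zero])
  have y := (YY_coeff p (symSeries p S) m).symm.trans (by rw [hY, coeff_zero])
  rw [hm _ (by omega : m - 1 < m), hm _ (by omega : m - 2 < m)] at t
  rw [hm _ (by omega : m - 1 < m)] at y
  simp only [map_zero, mul_zero, smul_zero, sub_zero, add_zero] at t y
  obtain ⟨r, hr⟩ := exists_eq_algebraMap_of_total p t y
  refine ⟨r, hr, fun hkm => ?_⟩
  have h3 := (isHomogeneous_iff p hS k).1 hk m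
  rw [hr, Derivation.map_algebraMap] at h3
  have h4 := congrArg (fun f => SmoothFun.eval f 0) h3
  simp only [eval_zero, eval_smul, eval_algebraMap] at h4
  refine (mul_eq_zero.1 h4.symm).resolve_left fun h5 => hkm ?_
  have := Int.cast_eq_zero.1 h5
  omega

theorem coeff_eq_zero_of_forall {h : HahnSeries ℤ SmoothFun} (h1 : ∀ n < 1, h.coeff n = 0) (b : ℤ)
    (hb : ∀ m < b, (∀ j < m, h.coeff j = 0) → h.coeff m = 0) : ∀ j < b, h.coeff j = 0 := by
  have key : ∀ m : ℕ, ∀ j : ℤ, j < m → j < b → h.coeff j = 0 := by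
    intro m
    induction m with
    | zero => exact fun j hj _ => h1 j (by omega)
    | succ m ih =>
      intro j hj hjb
      rcases lt_or_ge j m with h | h
      · exact ih j h hjb
      · obtain rfl : j = m := by omega
        exact hb _ hjb fun i hi => ih i hi (by omega)
  exact fun j hj => key (j.toNat + 1) j (by omega) hj

/-- The only constant leading term allowed by the weight is also the leading term of the basis
field; after subtracting the right multiple no leading coefficient can remain. -/
theorem exists_eq_smul_basisField (hS : S ∈ allSymmetries p) {k : ℤ} (hk : IsHomogeneous k S)
    (h0 : S (coord (.u 0)) = 0) (hk3 : k ≤ -3) : ∃ c : ℝ, S = c • basisField p k := by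
  obtain ⟨h1, -⟩ := isSymSeries_symSeries hS
  have hB := symSeries_basisField p k (by omega)
  obtain ⟨-, g2⟩ := isSymSeries_symSeries (basisField_mem p k)
  rw [hB.2.1 1 (by omega)] at g2
  have hlow := coeff_eq_zero_of_forall h1.coeff_eq_zero (-k - 1) fun m hm hm2 => by
    obtain ⟨r, hr, hr0⟩ := exists_coeff_eq_algebraMap hS hk h0 hm2
    rw [hr, hr0 (by omega), map_zero]
  obtain ⟨r, hr, -⟩ := exists_coeff_eq_algebraMap hS hk h0 hlow
  -- The basis field has leading coefficient `-1`.
  refine ⟨-r, ?_⟩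
  have hU : S - (-r) • basisField p k ∈ allSymmetries p :=
    (allSymmetries p).sub_mem hS ((allSymmetries p).smul_mem _ (basisField_mem p k))
  have hUk : IsHomogeneous k (S - (-r) • basisField p k) := by
    have hk' := isHomogeneous_basisField p k
    unfold IsHomogeneous at *
    rw [lie_sub, lie_smul, hk, hk', smul_sub, smul_comm]
  have hU0 : (S - (-r) • basisField p k) (coord (.u 0)) = 0 := by
    rw [Derivation.sub_apply, Derivation.smul_apply, h0, ← g2, smul_zero, sub_zero]
  have hser : symSeries p (S - (-r) • basisField p k) =
      symSeries p S + r • symSeries p (basisField p k) := by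
    rw [neg_smul, sub_neg_eq_add, symSeries_add, symSeries_smul]
  refine sub_eq_zero.1 (eq_zero_of_symSeries_eq_zero hU ?_)
  ext j
  rw [coeff_zero]
  refine coeff_eq_zero_of_forall (isSymSeries_symSeries hU).1.coeff_eq_zero (j + 1)
    (fun m _ hm2 => ?_) j (by omega)
  obtain ⟨r', hr', hr0⟩ := exists_coeff_eq_algebraMap hU hUk hU0 hm2
  by_cases hm : m = -k - 1
  · subst hm
    rw [hser, coeff_add, coeff_smul, hB.2.2, hr, Algebra.algebraMap_eq_smul_one, smul_neg,
      add_neg_cancel]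
  · rw [hr', hr0 hm, map_zero]

end Invisible

/-! ### A one-cocycle on the far negative half of the Witt algebra. -/

section Cocycle

/-- Eventually every cocycle is a multiple of `m ↦ m + k`, the solution coming from brackets with
the basis field of weight `k`. -/
theorem exists_eq_mul_of_cocycle {c : ℤ → ℝ} {k M : ℤ} (hc : ∀ m l : ℤ, M ≤ m → M ≤ l →
    ((l - m : ℤ) : ℝ) * c (m + l) =
      c l * ((l - m - k : ℤ) : ℝ) - c m * ((m - l - k : ℤ) : ℝ)) :
    ∃ (α : ℝ) (M' : ℤ), ∀ m ≥ M', c m = α * ((m + k : ℤ) : ℝ) := by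
  -- Computing `c (5 n)` from `n + 4 n` and from `2 n + 3 n`, with `3 n` and `4 n` reached by adding
  -- `n`, gives a linear relation between `c n` and `c (2 n)`.
  have hdouble : ∀ n : ℤ, M ≤ n → 0 < n → |k| < n →
      ((n + k : ℤ) : ℝ) * c (2 * n) = ((2 * n + k : ℤ) : ℝ) * c n := by
    intro n hn h0 hk
    have e12 := hc n (2 * n) hn (by omega)
    have e13 := hc n (3 * n) hn (by omega)
    have e14 := hc n (4 * n) hn (by omega)
    have e23 := hc (2 * n) (3 * n) (by omega) (by omega)
    rw [show n + 2 * n = 3 * n by ring] at e12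
    rw [show n + 3 * n = 4 * n by ring] at e13
    rw [show n + 4 * n = 5 * n by ring] at e14
    rw [show 2 * n + 3 * n = 5 * n by ring] at e23
    have hk1 := (abs_lt.1 hk).1
    have hk2 := (abs_lt.1 hk).2
    have hn' : (0 : ℝ) < n := by exact_mod_cast h0
    have hk1' : -(n : ℝ) < k := by exact_mod_cast hk1
    have hk2' : (k : ℝ) < n := by exact_mod_cast hk2
    push_cast at e12 e13 e14 e23 ⊢
    -- The factor multiplying that relation is a positive definite form in `n` and `k`.
    have hf : (6 * (n : ℝ) ^ 2 - n * k + k ^ 2) ≠ 0 := by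
      have : 0 < 6 * (n : ℝ) ^ 2 - n * k + k ^ 2 := by
        nlinarith [sq_nonneg ((n : ℝ) - k), mul_pos hn' hn']
      exact this.ne'
    apply mul_left_cancel₀ hf
    linear_combination (2 * (n : ℝ) ^ 2) * e14 + (n * (3 * n - k)) * e13 +
      ((3 * n - k) * (2 * n - k) - 6 * n * (n - k)) * e12 - 6 * (n : ℝ) ^ 2 * e23
  have hmul : ∀ n : ℤ, M ≤ n → 0 < n → |k| < n → ∀ j : ℕ,
      ((n + k : ℤ) : ℝ) * c ((j + 1 : ℕ) * n) = (((j + 1 : ℕ) * n + k : ℤ) : ℝ) * c n := by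
    intro n hn h0 hk j
    induction j with
    | zero => simp
    | succ j ih =>
      rcases Nat.eq_zero_or_pos j with rfl | hj
      · exact hdouble n hn h0 hk
      · have e := hc n ((j + 1 : ℕ) * n) hn (by push_cast; nlinarith)
        rw [show n + (j + 1 : ℕ) * n = (j + 1 + 1 : ℕ) * n by push_cast; ring] at e
        have hn' : (n : ℝ) ≠ 0 := by exact_mod_cast h0.ne'
        have hj' : (j : ℝ) ≠ 0 := by exact_mod_cast hj.ne'
        apply mul_left_cancel₀ (mul_ne_zero hj' hn')
        push_cast at e ih ⊢
        linear_combination ((n : ℝ) + k) * e + (j * n - k) * ih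
  -- Fix one large index `m₀`; the value at `m m₀`, computed from `m` and from `m₀`, shows that `c m
  -- / (m + k)` does not depend on `m`.
  obtain ⟨m₀, hm₀, hm0, hmk⟩ : ∃ m₀ : ℤ, M ≤ m₀ ∧ 0 < m₀ ∧ |k| < m₀ :=
    ⟨|M| + |k| + 1, by have := le_abs_self M; have := abs_nonneg k; omega,
      by have := abs_nonneg M; have := abs_nonneg k; omega,
      by have := abs_nonneg M; omega⟩
  have hk1 := (abs_lt.1 hmk).1
  refine ⟨c m₀ / ((m₀ + k : ℤ) : ℝ), m₀, fun m hm => ?_⟩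
  have h1 := hmul m (by omega) (by omega) (by omega) (m₀.toNat - 1)
  have h2 := hmul m₀ hm₀ hm0 hmk (m.toNat - 1)
  rw [show ((m₀.toNat - 1 + 1 : ℕ) : ℤ) = m₀ by omega] at h1
  rw [show ((m.toNat - 1 + 1 : ℕ) : ℤ) = m by omega, mul_comm m m₀] at h2
  have h3 : ((m₀ + k : ℤ) : ℝ) ≠ 0 := Int.cast_ne_zero.2 (by omega)
  have h4 : ((m₀ * m + k : ℤ) : ℝ) ≠ 0 := Int.cast_ne_zero.2 (by nlinarith)
  field_simp
  apply mul_left_cancel₀ h4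
  linear_combination (-((m₀ + k : ℤ) : ℝ)) * h1 + ((m + k : ℤ) : ℝ) * h2

end Cocycle

end RdDym

namespace RdDym

open HahnSeries LaurentPolynomial

/-! ### Reduction to symmetries commuting with basis fields of very negative weight. -/

section Commuting

variable {p : ℤ} {S : Derivation ℝ SmoothFun SmoothFun}

theorem coeff_one_basisField {m : ℤ} (hm : 3 ≤ m) :
    (posPart (HS p (T (1 - -m)))).coeff 1 = 0 := by
  have h := symSeries_basisField p (-m) (by omega)
  rw [basisField, symSeries_wittField] at h
  exact h.2.1 1 (by omega)

theorem basisField_u {m : ℤ} (hm : 3 ≤ m) (k : ℕ) : basisField p (-m) (coord (.u k)) = 0 := by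
  rw [basisField, wittField, symField_u, coeff_one_basisField hm, iterate_derivation_zero]

theorem basisField_v {m : ℤ} (hm : 3 ≤ m) (k : ℕ) : basisField p (-m) (coord (.v k)) = 0 := by
  rw [basisField, wittField, symField_v, coeff_one_basisField hm, map_zero, iterate_derivation_zero]

/-- Triangularity: the product of `w_x = -q z + …` with the series `-z^{m-1} + …` starts with `q
zᵐ`, so `B_{-m}` is `q` times the derivative in the variable at `zᵐ`, plus derivatives in later
ones. -/
theorem basisField_r {m : ℤ} (hm : 3 ≤ m) (n : ℕ) :
    ((n : ℤ) + 3 < m → basisField p (-m) (coord (.r n)) = 0) ∧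
    ((n : ℤ) + 3 = m → basisField p (-m) (coord (.r n)) = algebraMap ℝ SmoothFun (qC p)) := by
  have h := symSeries_basisField p (-m) (by omega)
  rw [basisField, symSeries_wittField] at h
  have hl := (hasLead_DX_wS p).mul h.2
  rw [basisField, wittField, symField_r]
  refine ⟨fun hn => hl.1 _ (by push_cast; omega), fun hn => ?_⟩
  have h2 := hl.2
  rw [show 1 + (- -m - 1) = ((n + 3 : ℕ) : ℤ) by push_cast; omega] at h2
  rw [h2, map_neg, mul_neg_one, neg_neg]

/-- Here the basis field itself maps `W` to `W^{m+1}`, without correction. In its commutator with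
`S` on `W`, the term `(W^{m+1})_x h` cancels against `S(W^{m+1})`. -/
theorem symSeries_basisField_lie (S : Derivation ℝ SmoothFun SmoothFun) {m : ℤ} (hm : 2 ≤ m) :
    symSeries p ⁅basisField p (-m), S⁆ = liftDer (basisField p (-m)) 0 (symSeries p S) := by
  have hB := basisField_mem p (-m)
  have h1 := (symSeries_basisField p (-m) (by omega)).1
  have hW : liftDer (basisField p (-m)) 0 (WU p : HahnSeries ℤ SmoothFun) =
      ev p (T (1 - -m)) := by
    rw [liftDer_WU, h1, DX_WU_mul_HS]
  have hS2 := derivation_units_zpow (liftDer S 0) (WU p) (1 - -m)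
  have hX2 := derivation_units_zpow (DX p) (WU p) (1 - -m)
  have hL := liftDer_lie (basisField p (-m)) S 0 0 (WU p : HahnSeries ℤ SmoothFun)
  rw [hW, liftDer_WU p S, liftDer_WU p ⁅_, _⁆, ev_T, hS2, Derivation.leibniz,
    liftDer_DX_of_mem p hB, hW, ev_T, hX2, liftDer_WU p S] at hL
  apply DX_WU_cancel p
  simp only [smul_eq_mul] at hL
  linear_combination -hL

/-- A function involves finitely many nonlocal variables, while `B_{-m}` differentiates only in
those from `zᵐ` on. -/
theorem exists_basisField_apply_eq_zero (f : SmoothFun) :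
    ∃ M : ℤ, ∀ m ≥ M, basisField p (-m) f = 0 := by
  obtain ⟨N, hN⟩ := exists_bound f
  refine ⟨N + 3, fun m hm => derivation_apply_eq_zero _ _ fun c => ?_⟩
  have hm3 : 3 ≤ m := by omega
  match c with
  | .x => rw [(basisField_mem p _).1, zero_mul]
  | .y => rw [(basisField_mem p _).2.1, zero_mul]
  | .u k => rw [basisField_u hm3, zero_mul]
  | .v k => rw [basisField_v hm3, zero_mul]
  | .r n =>
    rcases lt_or_ge n N with h | h
    · rw [(basisField_r hm3 n).1 (by omega), zero_mul]
    · rw [(hN n h).2.2, mul_zero]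

/-- Up to a multiple of the basis field, a homogeneous symmetry commutes with all basis fields of
sufficiently negative weight. -/
theorem exists_lie_basisField_eq_zero (hS : S ∈ allSymmetries p) {k : ℤ} (hk : IsHomogeneous k S) :
    ∃ (α : ℝ) (M : ℤ), ∀ m ≥ M, ⁅basisField p (-m), S + α • basisField p k⁆ = 0 := by
  obtain ⟨M₀, hM₀⟩ := exists_basisField_apply_eq_zero (p := p) (S (coord (.u 0)))
  -- For large `m` the field `B_{-m}` kills both `u` and `S(u)`, so the bracket has no component
  -- along `u`; its weight is at most `-3`, and the classification of such symmetries applies.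
  have hex : ∀ m : ℤ, ∃ c : ℝ, max M₀ (|k| + 3) ≤ m →
      ⁅basisField p (-m), S⁆ = c • basisField p (-m + k) := by
    intro m
    by_cases hm : max M₀ (|k| + 3) ≤ m
    · have hm1 := (le_max_left _ _).trans hm
      have hm2 := (le_max_right _ _).trans hm
      have hk1 := abs_nonneg k
      have hk2 := le_abs_self k
      obtain ⟨c, hc⟩ := exists_eq_smul_basisField
        ((allSymmetries p).lie_mem (basisField_mem p (-m)) hS)
        ((isHomogeneous_basisField p (-m)).lie hk)
        (by rw [Derivation.commutator_apply, hM₀ m hm1, basisField_u (by omega), map_zero, sub_zero])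
        (by omega)
      exact ⟨c, fun _ => hc⟩
    · exact ⟨0, fun h => absurd h hm⟩
  choose c hc using hex
  obtain ⟨α, M', hα⟩ := exists_eq_mul_of_cocycle (c := c) (k := k) (M := max M₀ (|k| + 3))
    fun m l hm hl => by
      have hm2 := (le_max_right _ _).trans hm
      have hl2 := (le_max_right _ _).trans hl
      have hk1 := abs_nonneg k
      have hk2 := le_abs_self k
      -- The Jacobi identity for two basis fields and `S` is the cocycle identity for `c`.
      have J := leibniz_lie (basisField p (-m)) (basisField p (-l)) S
      rw [hc m hm, hc l hl, lie_smul, lie_smul, basisField_lie, basisField_lie, basisField_lie,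
        smul_lie, show -m + -l = -(m + l) by ring, hc (m + l) (by omega),
        show -m + (-l + k) = -(m + l) + k by ring, show -l + (-m + k) = -(m + l) + k by ring,
        smul_smul, smul_smul, smul_smul, ← add_smul] at J
      have := smul_left_injective ℝ (basisField_ne_zero p (-(m + l) + k) (by omega)) J
      push_cast at this ⊢
      linear_combination -this
  refine ⟨α, max M' (max M₀ (|k| + 3)), fun m hm => ?_⟩
  rw [lie_add, lie_smul, hc m ((le_max_right _ _).trans hm), hα m ((le_max_left _ _).trans hm),
    basisField_lie, smul_smul, ← add_smul]
  have : α * ((m + k : ℤ) : ℝ) + α * ((-m - k : ℤ) : ℝ) = 0 := by push_cast; ring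
  rw [this, zero_smul]

/-- A function killed by the basis fields of weight at most `-M` does not involve the nonlocal
variables of weight at least `M`. -/
theorem pd_r_eq_zero {f : SmoothFun} {M : ℤ}
    (hf : ∀ m ≥ M, basisField p (-m) f = 0) (n : ℕ) (hn : M ≤ n + 3) : pd (.r n) f = 0 := by
  obtain ⟨N, hN⟩ := exists_bound f
  -- Descending induction: once the later variables are excluded, `B_{-(n+3)} f` reduces to `q`
  -- times the derivative in `r n`.
  have key : ∀ j : ℕ, ∀ n : ℕ, M ≤ n + 3 → N ≤ n + j → pd (.r n) f = 0 := by
    intro j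
    induction j with
    | zero => exact fun n _ h => (hN n h).2.2
    | succ j ih =>
      intro n hn hj
      have h := hf (n + 3) hn
      rw [derivation_apply_eq_single _ f (.r n), (basisField_r (by omega) n).2 rfl,
        ← Algebra.smul_def] at h
      · exact (smul_eq_zero.1 h).resolve_left (qC_ne_zero p)
      · intro c hc
        match c with
        | .x => rw [(basisField_mem p _).1, zero_mul]
        | .y => rw [(basisField_mem p _).2.1, zero_mul]
        | .u k => rw [basisField_u (by omega), zero_mul]
        | .v k => rw [basisField_v (by omega), zero_mul]
        | .r i =>
          rcases lt_trichotomy i n with h | h | h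
          · rw [(basisField_r (by omega) i).1 (by omega), zero_mul]
          · exact absurd (by rw [h]) hc
          · rw [ih i (by omega) (by omega), mul_zero]
  exact key N n hn (by omega)

end Commuting

/-! ### A bound on the jet order, uniform in all coefficients of the series. -/

section Jets

variable (p : ℤ)

/-- The coefficientwise partial derivative of a series. -/
noncomputable def PD (c : Coord) : Derivation ℝ (HahnSeries ℤ SmoothFun) (HahnSeries ℤ SmoothFun) :=
  liftDer (pd c) 0

@[simp] theorem PD_coeff (c : Coord) (f : HahnSeries ℤ SmoothFun) (n : ℤ) :
    (PD c f).coeff n = pd c (f.coeff n) := by simp [PD]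

@[simp] theorem PD_lam (c : Coord) : PD c lam = 0 := by simp [PD]
@[simp] theorem PD_cst (c : Coord) (f : SmoothFun) : PD c (cst f) = cst (pd c f) := by simp [PD]
theorem PD_Del (c : Coord) : PD c Del = -(lam * cst (pd c fa)) + lam ^ 2 * cst (pd c fb) :=
  liftDer_Del _

theorem PD_TH (c : Coord) (f : HahnSeries ℤ SmoothFun) : PD c (TH f) = TH (PD c f) :=
  (TH_liftDer _ _).symm

theorem PD_PD (c d : Coord) (f : HahnSeries ℤ SmoothFun) : PD c (PD d f) = PD d (PD c f) := by
  ext n; simp [pd_pd_comm c d]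

theorem PD_u_DX (k : ℕ) (f : HahnSeries ℤ SmoothFun) :
    PD (.u (k + 2)) (DX p f) = DX p (PD (.u (k + 2)) f) + PD (.u (k + 1)) f := by
  ext n; simp [pd_u_totalX]

theorem PD_v_DX (k : ℕ) (f : HahnSeries ℤ SmoothFun) :
    PD (.v (k + 1)) (DX p f) = DX p (PD (.v (k + 1)) f) + PD (.v k) f := by
  ext n; simp [pd_v_totalX]

theorem PD_u_Del (k : ℕ) : PD (.u (k + 2)) Del = 0 := by
  rw [PD_Del]; simp [fa, fb, pd_coord]

theorem PD_v_Del (k : ℕ) : PD (.v (k + 1)) Del = 0 := by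
  rw [PD_Del]; simp [fa, fb, pd_coord]

/-- The commutator of `∂/∂u_{k+2}` with `TT` reproduces the next lower jet derivative, multiplied by
the invertible `Del`; descent in the jet order rests on this. -/
theorem PD_u_TT (k : ℕ) (f : HahnSeries ℤ SmoothFun) : PD (.u (k + 2)) (TT p f) =
    TT p (PD (.u (k + 2)) f) + Del * PD (.u (k + 1)) f - PD (.u (k + 1)) Del * f := by
  simp only [TT, map_add, map_sub, Derivation.leibniz, smul_eq_mul, PD_u_DX, PD_u_Del, PD_lam,
    PD_TH, map_zero]
  ring

theorem PD_v_TT (k : ℕ) (f : HahnSeries ℤ SmoothFun) : PD (.v (k + 1)) (TT p f) =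
    TT p (PD (.v (k + 1)) f) + Del * PD (.v k) f - PD (.v k) Del * f := by
  simp only [TT, map_add, map_sub, Derivation.leibniz, smul_eq_mul, PD_v_DX, PD_v_Del, PD_lam,
    PD_TH, map_zero]
  ring

theorem Del_mul_coeff (f : HahnSeries ℤ SmoothFun) (n : ℤ) :
    (Del * f).coeff n = f.coeff n - fa * f.coeff (n - 1) + fb * f.coeff (n - 2) := by
  have h : Del * f = f - lam * (cst fa * f) + lam * (lam * (cst fb * f)) := by rw [Del]; ring
  rw [h]
  simp only [coeff_add, coeff_sub, lam_mul_coeff, cst_mul_coeff]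
  rw [show n - 1 - 1 = n - 2 by ring]

/-- Induction on the exponent: once the lower coefficients vanish, the relation says that the `n`-th
coefficient of `e i` is minus `D_x` of that of `e (i + 1)`, and these vanish for large `i`. -/
theorem eq_zero_of_Del_mul_eq_neg_TT {e : ℕ → HahnSeries ℤ SmoothFun} {K : ℕ}
    (he : ∀ i ≥ K, Del * e i = -TT p (e (i + 1))) (h0 : ∀ i, ∀ n < 1, (e i).coeff n = 0)
    (hfin : ∀ n, ∃ N, ∀ i ≥ N, (e i).coeff n = 0) : ∀ i ≥ K, e i = 0 := by
  have key : ∀ m : ℕ, ∀ n : ℤ, n < m → ∀ i ≥ K, (e i).coeff n = 0 := by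
    intro m
    induction m with
    | zero => exact fun n hn i _ => h0 i n (by omega)
    | succ m ih =>
      intro n hn
      rcases lt_or_ge n m with h | h
      · exact ih n h
      · obtain ⟨N, hN⟩ := hfin n
        have step : ∀ j : ℕ, ∀ i ≥ K, N ≤ i + j → (e i).coeff n = 0 := by
          intro j
          induction j with
          | zero => exact fun i _ hi => hN i hi
          | succ j ihj =>
            intro i hi hij
            have h2 := congrArg (fun f => HahnSeries.coeff f n) (he i hi)
            simp only [coeff_neg, Del_mul_coeff, TT_coeff] at h2
            rw [ih (n - 1) (by omega) i hi, ih (n - 2) (by omega) i hi,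
              ih (n - 1) (by omega) (i + 1) (by omega), ih (n - 2) (by omega) (i + 1) (by omega),
              ihj (i + 1) (by omega) (by omega)] at h2
            simpa using h2
        exact fun i hi => step N i hi (by omega)
  intro i hi
  ext n
  exact key (n.toNat + 1) n (by omega) i hi

/-- The right-hand side of the `TT` equation involves only two functions and so has finite order;
beyond that order the jet derivatives of the series satisfy the preceding recursion. -/
theorem exists_jet_bound {h : HahnSeries ℤ SmoothFun} (hh : IsSymSeries p h) :
    ∃ K : ℕ, ∀ i ≥ K, PD (.u i) h = 0 ∧ PD (.v i) h = 0 := by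
  obtain ⟨N₁, h₁⟩ := exists_bound (totalX p (h.coeff 1))
  obtain ⟨N₂, h₂⟩ := exists_bound (totalY p (h.coeff 1))
  have h0 : ∀ c, ∀ n < 1, (PD c h).coeff n = 0 := fun c n hn => by
    rw [PD_coeff, hh.coeff_eq_zero n hn, map_zero]
  have hT : ∀ c, PD c (TT p h) = lam * cst (pd c (totalX p (h.coeff 1))) -
      lam ^ 2 * cst (pd c (totalY p (h.coeff 1))) := fun c => by
    rw [hh.TT_eq]
    simp [Derivation.leibniz_pow]
  have hu := eq_zero_of_Del_mul_eq_neg_TT p (e := fun i => PD (.u i) h) (K := N₁ + N₂ + 2)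
    (fun i hi => by
      obtain ⟨k, rfl⟩ := Nat.exists_eq_add_of_le' (show 2 ≤ i by omega)
      have h3 := PD_u_TT p (k + 1) h
      rw [hT, (h₁ _ (by omega)).1, (h₂ _ (by omega)).1, PD_u_Del] at h3
      simp only [map_zero, mul_zero, sub_zero, zero_mul] at h3
      linear_combination -h3) (fun i => h0 _) fun n => by
    obtain ⟨N, hN⟩ := exists_bound (h.coeff n)
    exact ⟨N, fun i hi => by rw [PD_coeff, (hN i hi).1]⟩
  have hv := eq_zero_of_Del_mul_eq_neg_TT p (e := fun i => PD (.v i) h) (K := N₁ + N₂ + 2)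
    (fun i hi => by
      obtain ⟨k, rfl⟩ := Nat.exists_eq_add_of_le' (show 1 ≤ i by omega)
      have h3 := PD_v_TT p (k + 1) h
      rw [hT, (h₁ _ (by omega)).2.1, (h₂ _ (by omega)).2.1, PD_v_Del] at h3
      simp only [map_zero, mul_zero, sub_zero, zero_mul] at h3
      linear_combination -h3) (fun i => h0 _) fun n => by
    obtain ⟨N, hN⟩ := exists_bound (h.coeff n)
    exact ⟨N, fun i hi => by rw [PD_coeff, (hN i hi).2.1]⟩
  exact ⟨_, fun i hi => ⟨hu i hi, hv i hi⟩⟩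

end Jets

end RdDym

namespace RdDym

open HahnSeries LaurentPolynomial

/-! ### A series in finitely many variables is rational with denominator a power of `Del`. -/

section Rational

/-- The Laurent series that become finite after multiplication with a power of `Del`. -/
def rationalSeries : Subring (HahnSeries ℤ SmoothFun) where
  carrier := {f | ∃ n : ℕ, Del ^ n * f ∈ finiteSeries SmoothFun}
  mul_mem' := by
    rintro f g ⟨n, hn⟩ ⟨m, hm⟩
    exact ⟨n + m, by rw [_root_.pow_add, mul_mul_mul_comm]; exact Subring.mul_mem _ hn hm⟩
  one_mem' := ⟨0, by simp⟩
  add_mem' := by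
    rintro f g ⟨n, hn⟩ ⟨m, hm⟩
    have hD : Del ∈ finiteSeries SmoothFun := by
      have h1 : lam ∈ finiteSeries SmoothFun := single_mem_finiteSeries _ _
      have h2 : ∀ f, cst f ∈ finiteSeries SmoothFun := fun f => single_mem_finiteSeries _ _
      exact add_mem (sub_mem (one_mem _) (mul_mem h1 (h2 _))) (mul_mem (pow_mem h1 2) (h2 _))
    refine ⟨n + m, ?_⟩
    have : Del ^ (n + m) * (f + g) = Del ^ m * (Del ^ n * f) + Del ^ n * (Del ^ m * g) := by ring
    rw [this]
    exact add_mem (mul_mem (pow_mem hD _) hn) (mul_mem (pow_mem hD _) hm)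
  zero_mem' := ⟨0, by simp⟩
  neg_mem' := by
    rintro f ⟨n, hn⟩
    exact ⟨n, by rw [mul_neg]; exact neg_mem hn⟩

theorem lam_mem_finiteSeries : lam ∈ finiteSeries SmoothFun := single_mem_finiteSeries _ _

theorem cst_mem_finiteSeries (f : SmoothFun) : cst f ∈ finiteSeries SmoothFun :=
  single_mem_finiteSeries _ _

theorem Del_mem_finiteSeries : Del ∈ finiteSeries SmoothFun :=
  add_mem (sub_mem (one_mem _) (mul_mem lam_mem_finiteSeries (cst_mem_finiteSeries _)))
    (mul_mem (pow_mem lam_mem_finiteSeries 2) (cst_mem_finiteSeries _))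

theorem finiteSeries_le {f : HahnSeries ℤ SmoothFun} (hf : f ∈ finiteSeries SmoothFun) :
    f ∈ rationalSeries := ⟨0, by rwa [pow_zero, one_mul]⟩

theorem rationalSeries_of_Del_mul {f : HahnSeries ℤ SmoothFun} (hf : Del * f ∈ rationalSeries) :
    f ∈ rationalSeries := by
  obtain ⟨n, hn⟩ := hf
  exact ⟨n + 1, by rwa [pow_succ, mul_assoc]⟩

theorem liftDer_mem_rationalSeries (δ : Derivation ℝ SmoothFun SmoothFun) (κ : ℝ)
    {f : HahnSeries ℤ SmoothFun} (hf : f ∈ rationalSeries) : liftDer δ κ f ∈ rationalSeries := by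
  obtain ⟨n, hn⟩ := hf
  refine ⟨n + 1, ?_⟩
  have h1 : Del ^ (n + 1) * f ∈ finiteSeries SmoothFun := by
    rw [pow_succ', mul_assoc]
    exact mul_mem Del_mem_finiteSeries hn
  have h2 := liftDer_mem_finiteSeries δ κ h1
  have h3 : Del ^ (n + 1) * liftDer δ κ f = liftDer δ κ (Del ^ (n + 1) * f) -
      ((n + 1 : ℕ) : HahnSeries ℤ SmoothFun) * (liftDer δ κ Del * (Del ^ n * f)) := by
    rw [Derivation.leibniz, Derivation.leibniz_pow, smul_eq_mul, smul_eq_mul, nsmul_eq_mul,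
      smul_eq_mul, Nat.add_sub_cancel]
    ring
  rw [h3]
  exact sub_mem h2 (mul_mem (natCast_mem _ _)
    (mul_mem (liftDer_mem_finiteSeries δ κ Del_mem_finiteSeries) hn))

/-- The inverse of `Del`. -/
noncomputable def DelI : HahnSeries ℤ SmoothFun := Del_unit.choose

theorem Del_mul_DelI : Del * DelI = 1 := Del_unit.choose_spec.1

theorem DelI_mem_rationalSeries : DelI ∈ rationalSeries :=
  ⟨1, by rw [pow_one, Del_mul_DelI]; exact one_mem _⟩

theorem iterate_derivation_mul_of_sq {A : Type*} [CommRing A] [Algebra ℝ A] (D : Derivation ℝ A A)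
    (i : ℕ) {e : A} (he : D (D e) = 0) (f : A) :
    D^[i + 1] (e * f) = e * D^[i + 1] f + ((i : A) + 1) * D e * D^[i] f := by
  induction i with
  | zero => simp [mul_comm]
  | succ i ih =>
    rw [Function.iterate_succ_apply', ih]
    simp only [Function.iterate_succ_apply', map_add, Derivation.leibniz, he, smul_eq_mul,
      Derivation.map_natCast, Derivation.map_one_eq_zero, mul_zero, add_zero]
    push_cast
    ring

/-- For `d` affine in the direction of `D`, the iterates on `1 / d` have this closed form. They do
not die out, unlike those on polynomial coefficients. -/
theorem iterate_derivation_inv {A : Type*} [CommRing A] [Algebra ℝ A] (D : Derivation ℝ A A)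
    {d d' : A} (hd : d * d' = 1) (he : D (D d) = 0) (i : ℕ) :
    D^[i] d' = (i.factorial : A) * (-D d) ^ i * d' ^ (i + 1) := by
  have h1 : D d' = -D d * d' ^ 2 := by
    have := congrArg D hd
    rw [Derivation.leibniz, Derivation.map_one_eq_zero, smul_eq_mul, smul_eq_mul] at this
    linear_combination d' * this - D d' * hd
  induction i with
  | zero => simp
  | succ i ih =>
    rw [Function.iterate_succ_apply', ih]
    simp only [Derivation.leibniz, Derivation.leibniz_pow, map_neg, he, h1, neg_zero, smul_zero,
      Derivation.map_natCast, smul_eq_mul, mul_zero, add_zero, nsmul_eq_mul, Nat.add_sub_cancel,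
      Nat.factorial_succ]
    push_cast
    ring

theorem iterate_PD_cst (c : Coord) (i : ℕ) (f : SmoothFun) :
    (PD c)^[i] (cst f) = cst ((pd c)^[i] f) := by
  induction i with
  | zero => rfl
  | succ i ih => rw [Function.iterate_succ_apply', Function.iterate_succ_apply', ih, PD_cst]

theorem PD_mem_rationalSeries (c : Coord) {f : HahnSeries ℤ SmoothFun} (hf : f ∈ rationalSeries) :
    PD c f ∈ rationalSeries := liftDer_mem_rationalSeries _ _ hf

theorem iterate_PD_mem_rationalSeries (c : Coord) (i : ℕ) {f : HahnSeries ℤ SmoothFun}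
    (hf : f ∈ rationalSeries) : (PD c)^[i] f ∈ rationalSeries := by
  induction i with
  | zero => exact hf
  | succ i ih =>
    rw [Function.iterate_succ_apply']
    exact PD_mem_rationalSeries c ih

/-- Modulo rational series, `G` behaves as a constant for `PD c`. -/
theorem iterate_PD_mul_sub_mem (c : Coord) {A G : HahnSeries ℤ SmoothFun} (hA : A ∈ rationalSeries)
    (hG : PD c G ∈ rationalSeries) (i : ℕ) :
    (PD c)^[i] (A * G) - (PD c)^[i] A * G ∈ rationalSeries := by
  induction i with
  | zero => simp
  | succ i ih =>
    have h1 := PD_mem_rationalSeries c ih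
    have h2 : (PD c)^[i + 1] (A * G) - (PD c)^[i + 1] A * G =
        PD c ((PD c)^[i] (A * G) - (PD c)^[i] A * G) + (PD c)^[i] A * PD c G := by
      rw [Function.iterate_succ_apply', Function.iterate_succ_apply', map_sub,
        Derivation.leibniz, smul_eq_mul, smul_eq_mul]
      ring
    rw [h2]
    exact add_mem h1 (mul_mem (iterate_PD_mem_rationalSeries c i hA) hG)

theorem derivation_apply_eq_sum (D : Derivation ℝ SmoothFun SmoothFun) (f : SmoothFun)
    (C : Finset Coord) (hC : ∀ c ∉ C, pd c f = 0) : D f = ∑ c ∈ C, D (coord c) * pd c f := by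
  obtain ⟨s, hs, hsum⟩ := exists_finset_derivation_apply f
  classical
  rw [hsum D, ← Finset.sum_subset (Finset.inter_subset_left (s₁ := s) (s₂ := C)),
    ← Finset.sum_subset (Finset.inter_subset_right (s₁ := s) (s₂ := C))]
  · intro c hc hc'
    rw [hs c fun h => hc' (Finset.mem_inter.2 ⟨h, hc⟩), mul_zero]
  · intro c hc hc'
    rw [hC c fun h => hc' (Finset.mem_inter.2 ⟨hc, h⟩), mul_zero]

theorem DX_eq_sum (p : ℤ) (g : HahnSeries ℤ SmoothFun) (C : Finset Coord)
    (hC : ∀ c ∉ C, PD c g = 0) :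
    DX p g = ∑ c ∈ C, cst (totalX p (coord c)) * PD c g := by
  ext n
  rw [coeff_sum, DX_coeff, derivation_apply_eq_sum (totalX p) (g.coeff n) C fun c hc => by
    rw [← PD_coeff, hC c hc, coeff_zero]]
  simp

theorem iterate_PD_Del_mul_cst (c : Coord) {i : ℕ} {f : SmoothFun} (hD : PD c (PD c Del) = 0)
    (hf : (pd c)^[i] f = 0) : (PD c)^[i + 1] (Del * cst f) = 0 := by
  rw [iterate_derivation_mul_of_sq _ _ hD, iterate_PD_cst, iterate_PD_cst, hf,
    Function.iterate_succ_apply', hf]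
  simp

/-- Differentiating many times in the direction of a coordinate leaves only the nonpolynomial
part of the relation. -/
theorem mul_mem_rationalSeries_of_relation (c₀ : Coord) (C : Finset Coord)
    {A : Coord → HahnSeries ℤ SmoothFun} {g κ e ε' : HahnSeries ℤ SmoothFun} {i : ℕ} (hi : i ≠ 0)
    (hA : ∀ c ∈ C, A c ∈ rationalSeries) (hg : PD c₀ g ∈ rationalSeries)
    (hC : ∀ c ∈ C, PD c g ∈ rationalSeries ∨ (PD c₀)^[i] (A c) = 0)
    (hκ : PD c₀ κ = 0) (hκm : κ ∈ rationalSeries) (he : PD c₀ e = 0) (hem : e ∈ rationalSeries)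
    (hD : PD c₀ (PD c₀ Del) = 0) (hε : PD c₀ Del * ε' = 1) (hεm : ε' ∈ rationalSeries)
    (hrel : (∑ c ∈ C, A c * PD c g) + lam * TH g + (κ + e * DelI) * g ∈ rationalSeries) :
    e * g ∈ rationalSeries := by
  obtain ⟨i, rfl⟩ := Nat.exists_eq_succ_of_ne_zero hi
  rw [Nat.succ_eq_add_one] at *
  have h1 := iterate_PD_mem_rationalSeries c₀ (i + 1) hrel
  rw [iterate_derivation_add, iterate_derivation_add] at h1
  have hsum : ∀ s ⊆ C, (PD c₀)^[i + 1] (∑ c ∈ s, A c * PD c g) ∈ rationalSeries := by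
    classical
    intro s
    induction s using Finset.induction_on with
    | empty =>
      intro _
      rw [Finset.sum_empty, iterate_derivation_zero]
      exact zero_mem _
    | insert c s hcs ih =>
      intro hs
      rw [Finset.sum_insert hcs, iterate_derivation_add]
      have hc : c ∈ C := hs (Finset.mem_insert_self c s)
      refine add_mem ?_ (ih fun d hd => hs (Finset.mem_insert_of_mem hd))
      have h2 := iterate_PD_mul_sub_mem c₀ (hA c hc) (G := PD c g)
        (by rw [PD_PD]; exact PD_mem_rationalSeries c hg) (i + 1)
      rw [← sub_add_cancel ((PD c₀)^[i + 1] (A c * PD c g)) ((PD c₀)^[i + 1] (A c) * PD c g)]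
      refine add_mem h2 ?_
      rcases hC c hc with h3 | h3
      · exact mul_mem (iterate_PD_mem_rationalSeries _ _ (hA c hc)) h3
      · rw [h3, zero_mul]; exact zero_mem _
  have hT : (PD c₀)^[i + 1] (lam * TH g) ∈ rationalSeries := by
    rw [iterate_derivation_mul_of_eq_zero _ _ (PD_lam c₀), Function.iterate_succ_apply, PD_TH]
    exact mul_mem (finiteSeries_le lam_mem_finiteSeries)
      (iterate_PD_mem_rationalSeries c₀ i (liftDer_mem_rationalSeries _ _ hg))
  have h2 : (PD c₀)^[i + 1] ((κ + e * DelI) * g) ∈ rationalSeries := by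
    have := sub_mem (sub_mem h1 hT) (hsum C subset_rfl)
    convert this using 1
    ring
  have h3 := sub_mem h2 (iterate_PD_mul_sub_mem c₀
    (add_mem hκm (mul_mem hem DelI_mem_rationalSeries)) hg (i + 1))
  rw [sub_sub_cancel, iterate_derivation_add, Function.iterate_succ_apply, hκ,
    iterate_derivation_zero, zero_add, iterate_derivation_mul_of_eq_zero _ _ he,
    iterate_derivation_inv _ Del_mul_DelI hD] at h3
  have hfac : cst (algebraMap ℝ SmoothFun (((i + 1).factorial : ℝ)⁻¹)) *
      ((i + 1).factorial : HahnSeries ℤ SmoothFun) = 1 := by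
    have h4 : ((i + 1).factorial : HahnSeries ℤ SmoothFun) =
        cst (algebraMap ℝ SmoothFun ((i + 1).factorial : ℝ)) := by
      rw [map_natCast, map_natCast]
    rw [h4, ← map_mul, ← map_mul, inv_mul_cancel₀ (Nat.cast_ne_zero.2 (Nat.factorial_ne_zero _)),
      map_one, map_one]
  -- Only `(i+1)! (-∂Del)^{i+1} e g / Del^{i+2}` remains, modulo rational series; these factors
  -- invert all but `e g`.
  have h5 := mul_mem (mul_mem (mul_mem (finiteSeries_le (cst_mem_finiteSeries
    (algebraMap ℝ SmoothFun (((i + 1).factorial : ℝ)⁻¹)))) (pow_mem (neg_mem hεm) (i + 1)))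
    (pow_mem (finiteSeries_le Del_mem_finiteSeries) (i + 2))) h3
  have hpow : (-PD c₀ Del) ^ (i + 1) * (-ε') ^ (i + 1) = 1 := by
    rw [← mul_pow, neg_mul_neg, hε, one_pow]
  have hDp : Del ^ (i + 2) * DelI ^ (i + 2) = 1 := by rw [← mul_pow, Del_mul_DelI, one_pow]
  convert h5 using 1
  rw [show i + 1 + 1 = i + 2 from rfl]
  calc e * g = (cst (algebraMap ℝ SmoothFun (((i + 1).factorial : ℝ)⁻¹)) *
      ((i + 1).factorial : HahnSeries ℤ SmoothFun)) * ((-PD c₀ Del) ^ (i + 1) * (-ε') ^ (i + 1)) *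
      (Del ^ (i + 2) * DelI ^ (i + 2)) * (e * g) := by rw [hfac, hpow, hDp]; ring
    _ = _ := by ring

theorem lamInv_mul : single (-1) 1 * lam = (1 : HahnSeries ℤ SmoothFun) := by
  rw [lam, single_mul_single]; simp

theorem TT_mem_rationalSeries (p : ℤ) {f : HahnSeries ℤ SmoothFun} (hf : f ∈ rationalSeries) :
    TT p f ∈ rationalSeries := by
  have hD := finiteSeries_le Del_mem_finiteSeries
  exact sub_mem (add_mem (mul_mem hD (liftDer_mem_rationalSeries _ _ hf))
    (mul_mem (finiteSeries_le lam_mem_finiteSeries) (liftDer_mem_rationalSeries _ _ hf)))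
    (mul_mem (liftDer_mem_rationalSeries _ _ hD) hf)

/-- High jet derivatives of the series are zero, and the commutator with `TT` makes the lower ones
rational. The remaining relation has coefficients polynomial in `u_x` and `u_y` except for one with
`1 / Del`; repeated differentiation in either variable isolates that term. -/
theorem mem_rationalSeries_of_bounds (p : ℤ) {h : HahnSeries ℤ SmoothFun} {K : ℕ}
    (hK : ∀ i ≥ K, PD (.u i) h = 0 ∧ PD (.v i) h = 0 ∧ PD (.r i) h = 0)
    (hT : TT p h ∈ rationalSeries) : h ∈ rationalSeries := by
  classical
  have hDm := finiteSeries_le Del_mem_finiteSeries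
  have desc : ∀ P : ℕ → Prop, (∀ k ≥ K, P k) → (∀ k, P (k + 1) → P k) → ∀ k, P k := by
    intro P h1 h2 k
    by_contra hk
    have : ∀ j, ¬ P (k + j) := fun j => by
      induction j with
      | zero => exact hk
      | succ j ih => exact fun h => ih (h2 _ h)
    exact this K (h1 _ (by omega))
  have hu : ∀ k, PD (.u (k + 2)) h ∈ rationalSeries :=
    desc (fun k => PD (.u (k + 2)) h ∈ rationalSeries)
      (fun k hk => by rw [(hK _ (by omega)).1]; exact zero_mem _) fun k hk => by
        have h1 := PD_u_TT p (k + 1) h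
        rw [PD_u_Del, zero_mul, sub_zero] at h1
        apply rationalSeries_of_Del_mul
        rw [← sub_eq_iff_eq_add'.2 h1]
        exact sub_mem (PD_mem_rationalSeries _ hT) (TT_mem_rationalSeries p hk)
  have hv : ∀ k, PD (.v (k + 1)) h ∈ rationalSeries :=
    desc (fun k => PD (.v (k + 1)) h ∈ rationalSeries)
      (fun k hk => by rw [(hK _ (by omega)).2.1]; exact zero_mem _) fun k hk => by
        have h1 := PD_v_TT p (k + 1) h
        rw [PD_v_Del, zero_mul, sub_zero] at h1
        apply rationalSeries_of_Del_mul
        rw [← sub_eq_iff_eq_add'.2 h1]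
        exact sub_mem (PD_mem_rationalSeries _ hT) (TT_mem_rationalSeries p hk)
  -- In the commutators for `u_x` and `u_y` the term with the derivative of `Del` then cancels, and
  -- `Del²` times the derivative of `g` remains.
  obtain ⟨g, rfl⟩ : ∃ g, h = Del * g := ⟨DelI * h, by rw [← mul_assoc, Del_mul_DelI, one_mul]⟩
  have hPg : ∀ c, PD c (Del * g) = Del * PD c g + PD c Del * g := fun c => by
    rw [Derivation.leibniz, smul_eq_mul, smul_eq_mul, mul_comm g]
  have hgu : ∀ k, PD (.u (k + 1)) g ∈ rationalSeries := fun k => by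
    match k with
    | 0 =>
      have h1 := PD_u_TT p 0 (Del * g)
      apply rationalSeries_of_Del_mul
      apply rationalSeries_of_Del_mul
      have h2 : Del * (Del * PD (.u (0 + 1)) g) = PD (.u (0 + 2)) (TT p (Del * g)) -
          TT p (PD (.u (0 + 2)) (Del * g)) := by
        rw [h1, hPg (.u (0 + 1))]; ring
      rw [h2]
      exact sub_mem (PD_mem_rationalSeries _ hT) (TT_mem_rationalSeries p (hu 0))
    | k + 1 =>
      have h1 := hu k
      rw [hPg, PD_u_Del, zero_mul, add_zero] at h1
      exact rationalSeries_of_Del_mul h1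
  have hgv : ∀ k, PD (.v k) g ∈ rationalSeries := fun k => by
    match k with
    | 0 =>
      have h1 := PD_v_TT p 0 (Del * g)
      apply rationalSeries_of_Del_mul
      apply rationalSeries_of_Del_mul
      have h2 : Del * (Del * PD (.v 0) g) = PD (.v (0 + 1)) (TT p (Del * g)) -
          TT p (PD (.v (0 + 1)) (Del * g)) := by
        rw [h1, hPg (.v 0)]; ring
      rw [h2]
      exact sub_mem (PD_mem_rationalSeries _ hT) (TT_mem_rationalSeries p (hv 0))
    | k + 1 =>
      have h1 := hv k
      rw [hPg, PD_v_Del, zero_mul, add_zero] at h1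
      exact rationalSeries_of_Del_mul h1
  let C : Finset Coord := {.x, .y} ∪ (Finset.range (K + 2)).image .u ∪
    (Finset.range (K + 2)).image .v ∪ (Finset.range (K + 2)).image .r
  have hC : ∀ c ∉ C, PD c g = 0 := by
    intro c hc
    have h1 : ∀ c, PD c (Del * g) = 0 → PD c Del = 0 → PD c g = 0 := fun c h1 h2 => by
      rw [hPg, h2, zero_mul, add_zero] at h1
      exact Del_cancel h1
    match c with
    | .x => simp [C] at hc
    | .y => simp [C] at hc
    | .u k =>
      have hk : K + 2 ≤ k := by simpa [C] using hc
      obtain ⟨j, rfl⟩ := Nat.exists_eq_add_of_le' (show 2 ≤ k by omega)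
      exact h1 _ (hK _ (by omega)).1 (PD_u_Del j)
    | .v k =>
      have hk : K + 2 ≤ k := by simpa [C] using hc
      obtain ⟨j, rfl⟩ := Nat.exists_eq_add_of_le' (show 1 ≤ k by omega)
      exact h1 _ (hK _ (by omega)).2.1 (PD_v_Del j)
    | .r k =>
      have hk : K + 2 ≤ k := by simpa [C] using hc
      refine h1 _ (hK _ (by omega)).2.2 ?_
      rw [PD_Del]; simp [fa, fb, pd_coord]
  have hCr : ∀ n, Coord.r n ∈ C → n < K + 2 := fun n hn => by simpa [C] using hn
  -- This is `TT (Del * g)` divided by `Del`, with `D_x g` expanded over the finitely many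
  -- coordinates involved.
  have hE : (∑ c ∈ C, (Del * cst (totalX p (coord c))) * PD c g) + lam * TH g +
      lam * TH Del * DelI * g ∈ rationalSeries := by
    apply rationalSeries_of_Del_mul
    convert hT using 1
    have h1 := DX_eq_sum p g C hC
    have h2 : (∑ c ∈ C, (Del * cst (totalX p (coord c))) * PD c g) = Del * DX p g := by
      rw [h1, Finset.mul_sum]
      exact Finset.sum_congr rfl fun c _ => mul_assoc _ _ _
    rw [h2, TT]
    simp only [Derivation.leibniz, smul_eq_mul]
    linear_combination lam * TH Del * g * Del_mul_DelI
  have hA : ∀ c ∈ C, Del * cst (totalX p (coord c)) ∈ rationalSeries := fun c _ =>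
    mul_mem hDm (finiteSeries_le (cst_mem_finiteSeries _))
  have hlm := finiteSeries_le lam_mem_finiteSeries
  have hcm : ∀ f, cst f ∈ rationalSeries := fun f => finiteSeries_le (cst_mem_finiteSeries f)
  have hsm : ∀ n, single n (1 : SmoothFun) ∈ rationalSeries := fun n =>
    finiteSeries_le (single_mem_finiteSeries _ _)
  have ha1 : pd (.u 1) fa = 1 := by simp [fa, pd_coord]
  have hb1 : pd (.u 1) fb = 0 := by simp [fb, pd_coord]
  have ha2 : pd (.v 0) fa = 0 := by simp [fa, pd_coord]
  have hb2 : pd (.v 0) fb = 1 := by simp [fb]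
  have hDu : PD (.u 1) Del = -lam := by rw [PD_Del, ha1, hb1]; simp
  have hDv : PD (.v 0) Del = lam ^ 2 := by rw [PD_Del, ha2, hb2]; simp
  have hDu2 : PD (.u 1) (PD (.u 1) Del) = 0 := by rw [hDu]; simp
  have hDv2 : PD (.v 0) (PD (.v 0) Del) = 0 := by rw [hDv]; simp [Derivation.leibniz_pow]
  -- Here `TH Del = Del + (z² u_y - 1)`, whose remainder is free of `u_x`. The order `K + 6` exceeds
  -- the `u_x`-degree of all coefficients not already handled.
  have e1 : (lam * (lam ^ 2 * cst fb - 1)) * g ∈ rationalSeries := by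
    refine mul_mem_rationalSeries_of_relation (.u 1) C (i := K + 6) (κ := lam)
      (ε' := -single (-1) 1) (by omega) hA (hgu 0) (fun c hc => ?_) (PD_lam _) hlm
      (by simp [Derivation.leibniz_pow, hb1])
      (mul_mem hlm (sub_mem (mul_mem (pow_mem hlm 2) (hcm _)) (one_mem _))) hDu2
      (by rw [hDu, neg_mul_neg, mul_comm, lamInv_mul]) (neg_mem (hsm _)) ?_
    · match c with
      | .x =>
        right
        refine iterate_derivation_eq_zero_of_le _ (i := 1 + 1) (by omega)
          (iterate_PD_Del_mul_cst _ hDu2 ?_)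
        simp
      | .y => right; rw [totalX_y, map_zero, mul_zero, iterate_derivation_zero]
      | .u 0 =>
        right
        refine iterate_derivation_eq_zero_of_le _ (i := 2 + 1) (by omega)
          (iterate_PD_Del_mul_cst _ hDu2 ?_)
        simp
      | .u (k + 1) => exact Or.inl (hgu k)
      | .v k => exact Or.inl (hgv k)
      | .r n =>
        right
        have := hCr n hc
        refine iterate_derivation_eq_zero_of_le _ (i := (n + 2 + 1) + 1) (by omega)
          (iterate_PD_Del_mul_cst _ hDu2 ?_)
        rw [totalX_r, Function.iterate_succ_apply', (iterate_pd_u_rXY _ (n + 2)).1,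
          Derivation.map_algebraMap]
    · convert hE using 2
      rw [TH_Del]
      have := Del_mul_DelI
      rw [Del] at this
      linear_combination -lam * g * this
  -- Now `TH Del = 2 Del + (z (u_x + x) - 2)`, whose remainder is free of `u_y`.
  have e2 : (lam * (lam * cst fa - 2)) * g ∈ rationalSeries := by
    have h2 : PD (.v 0) (2 : HahnSeries ℤ SmoothFun) = 0 := Derivation.map_natCast _ 2
    refine mul_mem_rationalSeries_of_relation (.v 0) C (i := K + 6) (κ := 2 * lam)
      (ε' := single (-1) 1 ^ 2) (by omega) hA (hgv 0) (fun c hc => ?_)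
      (by simp [h2]) (mul_mem (natCast_mem _ 2) hlm)
      (by simp [ha2, h2])
      (mul_mem hlm (sub_mem (mul_mem hlm (hcm _)) (natCast_mem _ 2))) hDv2
      (by rw [hDv, ← mul_pow, mul_comm, lamInv_mul, one_pow]) (pow_mem (hsm _) 2) ?_
    · match c with
      | .x =>
        right
        refine iterate_derivation_eq_zero_of_le _ (i := 1 + 1) (by omega)
          (iterate_PD_Del_mul_cst _ hDv2 ?_)
        simp
      | .y => right; rw [totalX_y, map_zero, mul_zero, iterate_derivation_zero]
      | .u 0 =>
        right
        refine iterate_derivation_eq_zero_of_le _ (i := 1 + 1) (by omega)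
          (iterate_PD_Del_mul_cst _ hDv2 ?_)
        simp [pd_coord]
      | .u (k + 1) => exact Or.inl (hgu k)
      | .v k => exact Or.inl (hgv k)
      | .r n =>
        right
        have := hCr n hc
        refine iterate_derivation_eq_zero_of_le _ (i := (n + 2 + 1) + 1) (by omega)
          (iterate_PD_Del_mul_cst _ hDv2 ?_)
        rw [totalX_r]
        exact (iterate_pd_v_rXY _ (n + 2)).1
    · convert hE using 2
      rw [TH_Del]
      have := Del_mul_DelI
      rw [Del] at this
      linear_combination -2 * lam * g * this
  -- The difference of the two multipliers is `z Del`, so it yields `z h`.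
  have e3 := mul_mem (hsm (-1)) (sub_mem e1 e2)
  convert e3 using 1
  rw [Del]
  linear_combination (-(1 - lam * cst fa + lam ^ 2 * cst fb) * g) * lamInv_mul

end Rational

end RdDym

namespace RdDym

open HahnSeries LaurentPolynomial

/-! ### Absence of poles along `Del`. -/

section NoPoles

theorem cst_algebraMap_mem (r : ℝ) : cst (algebraMap ℝ SmoothFun r) ∈ finiteSeries SmoothFun :=
  cst_mem_finiteSeries _

theorem finiteSeries_of_nat_mul {n : ℕ} (hn : n ≠ 0) {f : HahnSeries ℤ SmoothFun}
    (hf : (n : HahnSeries ℤ SmoothFun) * f ∈ finiteSeries SmoothFun) :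
    f ∈ finiteSeries SmoothFun := by
  have h := mul_mem (cst_algebraMap_mem ((n : ℝ)⁻¹)) hf
  have h4 : (n : HahnSeries ℤ SmoothFun) = cst (algebraMap ℝ SmoothFun (n : ℝ)) := by
    rw [map_natCast, map_natCast]
  rwa [h4, ← mul_assoc, ← map_mul, ← map_mul, inv_mul_cancel₀ (Nat.cast_ne_zero.2 hn), map_one,
    map_one, one_mul] at h

theorem finiteSeries_of_lam_mul {f : HahnSeries ℤ SmoothFun}
    (hf : lam * f ∈ finiteSeries SmoothFun) : f ∈ finiteSeries SmoothFun :=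
  finiteSeries_of_single_mul hf

theorem fa_sq_sub_cancel {f : SmoothFun} (h : (fa ^ 2 - 4 * fb) * f = 0) : f = 0 := by
  classical
  refine eq_zero_of_mul_eq_zero_of_line (.v 0) (fun P => ⟨-4, by norm_num, fun t => ?_⟩) h
  have h4 : (4 : SmoothFun) = algebraMap ℝ SmoothFun 4 := (map_ofNat _ 4).symm
  rw [pow_two, h4]
  simp only [fa, fb, eval_sub, eval_mul, eval_add, eval_coord, eval_algebraMap, Pi.add_apply,
    Pi.smul_apply, smul_eq_mul]
  simp
  ring

theorem fb_cancel {f g : SmoothFun} (h : fb * f = fb * g) : f = g := by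
  classical
  refine sub_eq_zero.1 (eq_zero_of_mul_eq_zero_of_line (d := fb) (.v 0)
    (fun P => ⟨1, one_ne_zero, fun t => ?_⟩) (by rw [mul_sub, h, sub_self]))
  simp [fb]

theorem finiteSeries_of_cst_mul {d : SmoothFun} (hd : ∀ f, d * f = 0 → f = 0)
    {f : HahnSeries ℤ SmoothFun} (hf : cst d * f ∈ finiteSeries SmoothFun) :
    f ∈ finiteSeries SmoothFun := by
  refine Set.Finite.subset hf fun n hn => ?_
  rw [HahnSeries.mem_support] at hn ⊢
  rw [cst_mul_coeff]
  exact fun h => hn (hd _ h)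

/-- At a pole of order `n + 1` along `Del`, the `TT` equation makes `TH Del` times the polar part
finite, besides `Del` times it. The two quadratics are coprime up to their resultant, essentially
the discriminant of `Del`, which is not a zero divisor. -/
theorem mem_finiteSeries_of_rational (p : ℤ) {h : HahnSeries ℤ SmoothFun}
    (hT : TT p h ∈ finiteSeries SmoothFun) (hr : h ∈ rationalSeries) :
    h ∈ finiteSeries SmoothFun := by
  have hl := lam_mem_finiteSeries
  have hD := Del_mem_finiteSeries
  have step : ∀ n : ℕ, Del ^ (n + 1) * h ∈ finiteSeries SmoothFun →
      Del ^ n * h ∈ finiteSeries SmoothFun := by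
    intro n hn
    have hX : DX p (Del ^ (n + 1) * h) = ((n + 1 : ℕ) : HahnSeries ℤ SmoothFun) *
        (Del ^ n * (DX p Del * h)) + Del ^ (n + 1) * DX p h := by
      rw [Derivation.leibniz, Derivation.leibniz_pow, smul_eq_mul, smul_eq_mul, nsmul_eq_mul,
        smul_eq_mul, Nat.add_sub_cancel]
      ring
    have hΘ : TH (Del ^ (n + 1) * h) = ((n + 1 : ℕ) : HahnSeries ℤ SmoothFun) *
        (Del ^ n * (TH Del * h)) + Del ^ (n + 1) * TH h := by
      rw [Derivation.leibniz, Derivation.leibniz_pow, smul_eq_mul, smul_eq_mul, nsmul_eq_mul,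
        smul_eq_mul, Nat.add_sub_cancel]
      ring
    have hXm := liftDer_mem_finiteSeries (totalX p) 0 hn
    have hΘm := liftDer_mem_finiteSeries 0 1 hn
    have hXD := liftDer_mem_finiteSeries (totalX p) 0 hD
    have e1 : TH Del * (Del ^ n * h) ∈ finiteSeries SmoothFun := by
      apply finiteSeries_of_nat_mul n.succ_ne_zero
      apply finiteSeries_of_lam_mul
      -- The multiplicity `n + 2` is `n + 1` from differentiating the power of `Del`, plus `1` from
      -- the last term of `TT`.
      have := sub_mem (sub_mem (add_mem (mul_mem hD hXm) (mul_mem hl hΘm))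
        (mul_mem (natCast_mem _ (n + 2)) (mul_mem hXD hn))) (mul_mem (pow_mem hD (n + 1)) hT)
      convert this using 1
      change _ = Del * DX p (Del ^ (n + 1) * h) + lam * TH (Del ^ (n + 1) * h) -
        ((n + 2 : ℕ) : HahnSeries ℤ SmoothFun) * (DX p Del * (Del ^ (n + 1) * h)) -
        Del ^ (n + 1) * TT p h
      rw [hX, hΘ, TT]
      push_cast
      ring
    have e2 : Del * (Del ^ n * h) ∈ finiteSeries SmoothFun := by
      rwa [← mul_assoc, ← pow_succ']
    have hc := cst_mem_finiteSeries
    apply finiteSeries_of_cst_mul (d := fa ^ 2 - 4 * fb) fun f => fa_sq_sub_cancel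
    apply finiteSeries_of_lam_mul
    apply finiteSeries_of_lam_mul
    -- With `a = u_x + x`, `b = u_y`: `4 (Del - TH Del) - (2 + z a) (2 Del - TH Del) = z² (a² - 4
    -- b)`.
    have := sub_mem (mul_mem (natCast_mem _ 4) (sub_mem e2 e1))
      (mul_mem (add_mem (natCast_mem _ 2) (mul_mem hl (hc fa)))
        (sub_mem (mul_mem (natCast_mem _ 2) e2) e1))
    convert this using 1
    rw [TH_Del, Del]
    simp only [map_sub, map_mul, map_pow, map_ofNat]
    push_cast
    ring
  obtain ⟨n, hn⟩ := hr
  induction n with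
  | zero => simpa using hn
  | succ n ih => exact ih (step n hn)

end NoPoles

/-! ### Polynomial series: the two highest coefficients. -/

section TopDegree

variable (p : ℤ)

open Classical in
theorem eval_add_single_of_pd_eq_zero {f : SmoothFun} {c : Coord} (hf : pd c f = 0)
    (P : Coord → ℝ) (t : ℝ) : f.eval (P + t • Pi.single c 1) = f.eval P := by
  have hd : ∀ s : ℝ, HasDerivAt (fun s : ℝ => f.eval (P + s • Pi.single c 1)) 0 s := by
    intro s
    have h1 := f.hasLineDerivAt (P + s • Pi.single c 1) (Pi.single c 1)
    have h2 : lineDeriv ℝ f.eval (P + s • Pi.single c 1) (Pi.single c 1) = 0 := by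
      have h3 : (pd c f).eval (P + s • Pi.single c 1) = 0 := by rw [hf]; rfl
      rw [pd, vectorField_eval] at h3
      rw [← h3]
      congr 1
      funext d
      rw [Pi.single_apply]
      split_ifs <;> rfl
    rw [h2] at h1
    have h3 : HasDerivAt (fun τ : ℝ => f.eval (P + s • Pi.single c 1 + τ • Pi.single c 1)) 0
        (s - s) := by rw [sub_self]; exact h1
    have h4 := h3.comp_sub_const s s
    refine h4.congr_of_eventuallyEq (Filter.Eventually.of_forall fun τ => ?_)
    simp only []
    rw [add_assoc, ← add_smul, add_sub_cancel]
  have h := is_const_of_deriv_eq_zero (fun s => (hd s).differentiableAt) (fun s => (hd s).deriv) t 0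
  simpa using h

/-- The derivative of the equation in the next jet variable leaves `u_y` times the derivative of `f`
in the present one; `u_y` can be cancelled. -/
theorem totalX_jet_descent {f R : SmoothFun} {ι : ℕ → Coord}
    (hι : ∀ k ≥ 1, pd (ι (k + 1)) (totalX p f) = totalX p (pd (ι (k + 1)) f) + pd (ι k) f)
    (hb : ∀ k, pd (ι (k + 2)) fb = 0) (hb' : ∀ k, pd (ι (k + 2)) (totalX p fb) = 0) {k₀ : ℕ}
    (hk₀ : 1 ≤ k₀) (hR : ∀ k ≥ k₀, pd (ι (k + 1)) R = 0)
    (hfin : ∃ N, ∀ k ≥ N, pd (ι k) f = 0)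
    (hf : fb * totalX p f - totalX p fb * f = R) : ∀ k ≥ k₀, pd (ι k) f = 0 := by
  obtain ⟨N, hN⟩ := hfin
  have key : ∀ j : ℕ, ∀ k ≥ k₀, N ≤ k + j → pd (ι k) f = 0 := by
    intro j
    induction j with
    | zero => exact fun k _ h => hN k h
    | succ j ih =>
      intro k hk hj
      obtain ⟨i, rfl⟩ := Nat.exists_eq_add_of_le' (show 1 ≤ k by omega)
      have h1 := congrArg (pd (ι (i + 1 + 1))) hf
      rw [hR _ hk, map_sub, Derivation.leibniz, Derivation.leibniz, hι _ (by omega), hb, hb',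
        ih (i + 1 + 1) (by omega) (by omega)] at h1
      simp only [map_zero, smul_eq_mul, mul_zero, zero_add, add_zero, sub_zero] at h1
      exact fb_cancel (by rw [h1, mul_zero])
  exact fun k hk => key N k hk (by omega)

/-- The equation says formally that `f / u_y` is constant along `D_x`. Its derivative in `u_xy`
shows `f = u_y ∂f/∂u_y`, so the quotient is a smooth function even where `u_y = 0`. -/
theorem exists_mul_of_top {f : SmoothFun} (hf : fb * totalX p f - totalX p fb * f = 0) :
    ∃ c, f = fb * c ∧ totalX p c = 0 := by
  obtain ⟨N, hN⟩ := exists_bound f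
  have hv := totalX_jet_descent p (ι := .v) (fun k _ => pd_v_totalX p k f)
    (by simp [fb, pd_coord]) (by simp [totalX_fb, pd_coord]) le_rfl (by simp)
    ⟨N, fun k hk => (hN k hk).2.1⟩ hf
  have h1 := congrArg (pd (.v 1)) hf
  have hb0 : pd (.v 1) fb = 0 := by simp [fb, pd_coord]
  have hb1 : pd (.v 1) (totalX p fb) = 1 := by simp [totalX_fb]
  rw [map_sub, Derivation.leibniz, Derivation.leibniz, pd_v_totalX p 0, hv 1 le_rfl, hb0, hb1] at h1
  simp only [map_zero, smul_eq_mul, mul_zero, zero_add, add_zero, mul_one] at h1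
  have h2 : f = fb * pd (.v 0) f := (sub_eq_zero.1 h1).symm
  refine ⟨pd (.v 0) f, h2, ?_⟩
  have h3 : fb * (fb * totalX p (pd (.v 0) f)) = fb * (fb * 0) := by
    have h4 := hf
    rw [h2, Derivation.leibniz] at h4
    simp only [smul_eq_mul] at h4
    rw [← h2] at h4
    linear_combination h4 + totalX p fb * h2
  exact fb_cancel (fb_cancel h3)

/-- Differentiation in `u_xy` gives `e = u_y e' - c (u_x + x)`, which reduces the equation to `u_y
D_x e' = -d c`. As `c` does not depend on `u_y`, setting `u_y = 0` gives `c = 0`. -/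
theorem eq_zero_of_second {c e : SmoothFun} {d : ℝ} (hd : d ≠ 0) (hc : totalX p c = 0)
    (he : fb * totalX p e - totalX p fb * e =
      c * (fa * totalX p fb - totalX p fa * fb) - d • (fb * c)) : c = 0 := by
  have hpc := fun i hi => pd_eq_zero_of_totalX_eq_zero p hc i hi
  obtain ⟨N, hN⟩ := exists_bound e
  have hv := totalX_jet_descent p (ι := .v) (fun k _ => pd_v_totalX p k e)
    (by simp [fb, pd_coord]) (by simp [totalX_fb, pd_coord]) le_rfl (fun k hk => by
      obtain ⟨i, rfl⟩ := Nat.exists_eq_add_of_le' hk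
      simp [fa, fb, pd_coord, hpc (.v (i + 1 + 1)) (by simp)])
    ⟨N, fun k hk => (hN k hk).2.1⟩ he
  have h1 := congrArg (pd (.v 1)) he
  have hb0 : pd (.v 1) fb = 0 := by simp [fb, pd_coord]
  have hb1 : pd (.v 0) fb = 1 := by simp [fb]
  have ha0 : pd (.v 1) fa = 0 := by simp [fa, pd_coord]
  have ha1 : pd (.v 0) fa = 0 := by simp [fa, pd_coord]
  have hc1 : pd (.v 1) c = 0 := hpc _ (by simp)
  simp only [map_sub, Derivation.leibniz, Derivation.map_smul, pd_v_totalX p 0, zero_add,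
    hv 1 le_rfl, hb0, hb1, ha0, ha1, hc1, map_zero, smul_eq_mul, mul_zero, add_zero,
    mul_one, smul_zero, sub_zero] at h1
  set e' := pd (.v 0) e
  have h2 : e = fb * e' - c * fa := by linear_combination -h1
  have h3 : fb * totalX p e' = -(d • c) := by
    apply fb_cancel
    have h4 := he
    rw [h2] at h4
    simp only [map_sub, Derivation.leibniz, smul_eq_mul, hc, mul_zero, add_zero] at h4
    rw [mul_neg, mul_smul_comm]
    linear_combination h4
  refine SmoothFun.ext fun P => ?_
  classical
  have h5 := eval_add_single_of_pd_eq_zero (hpc (.v 0) (by simp)) P (-P (.v 0))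
  rw [← h5]
  have h6 := congrArg (fun g => SmoothFun.eval g (P + (-P (.v 0)) • Pi.single (.v 0) 1)) h3
  simp only [eval_mul, eval_neg, eval_smul, fb, eval_coord, Pi.add_apply, Pi.smul_apply,
    Pi.single_eq_same, smul_eq_mul, mul_one, add_neg_cancel, zero_mul] at h6
  rw [eval_zero]
  exact (mul_eq_zero.1 (neg_eq_zero.1 h6.symm)).resolve_left hd

/-- In top degree `d` the coefficient is `u_y c` with `D_x c = 0`. For `d ≥ 2` the next equation
forces `c = 0`; for `d = 1` it gives `D_y c = 0`, so `c` is constant. -/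
theorem eq_smul_of_finite {h : HahnSeries ℤ SmoothFun} (hh : IsSymSeries p h)
    (hf : h ∈ finiteSeries SmoothFun) : ∃ β : ℝ, h = β • (lam * cst fb) := by
  by_cases h0 : h = 0
  · exact ⟨0, by rw [h0, zero_smul]⟩
  have hne : h.support.Nonempty := HahnSeries.support_nonempty_iff.2 h0
  obtain ⟨d, hd, hmax⟩ := Set.exists_max_image h.support id hf hne
  have hgt : ∀ n > d, h.coeff n = 0 := fun n hn => by
    by_contra hc
    exact absurd (hmax n hc) (not_le.2 hn)
  have hd1 : 1 ≤ d := by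
    by_contra hc
    exact hd (hh.coeff_eq_zero d (by omega))
  have hlam2 : ∀ (g : SmoothFun) (n : ℤ), (lam ^ 2 * cst g).coeff n = if n = 2 then g else 0 := by
    intro g n
    rw [pow_two, mul_assoc, lam_mul_coeff, lam_mul_cst_coeff]
    congr 1
    exact propext ⟨fun h => by omega, fun h => by omega⟩
  have hTT := fun n => (TT_coeff p h n).symm.trans (by rw [hh.TT_eq, coeff_sub, lam_mul_cst_coeff,
    hlam2])
  have t2 := hTT (d + 2)
  rw [hgt _ (by omega), hgt (d + 2 - 1) (by omega), if_neg (by omega), if_neg (by omega),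
    show d + 2 - 2 = d by ring] at t2
  simp only [map_zero, mul_zero, smul_zero, sub_zero, add_zero, zero_add] at t2
  obtain ⟨c, hc, hcx⟩ := exists_mul_of_top p t2
  have t1 := hTT (d + 1)
  rw [hgt _ (by omega), if_neg (by omega : ¬ d + 1 = 1), show d + 1 - 1 = d by ring,
    show d + 1 - 2 = d - 1 by ring, hc, Derivation.leibniz, hcx] at t1
  simp only [map_zero, smul_eq_mul, mul_zero, zero_add, zero_sub] at t1
  rcases eq_or_lt_of_le hd1 with rfl | hd2
  · rw [if_pos (by norm_num), hh.coeff_eq_zero (1 - 1) (by norm_num), hc, Derivation.leibniz,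
      totalY_fb] at t1
    simp only [map_zero, smul_eq_mul, mul_zero, add_zero, sub_zero, Int.cast_one, one_smul] at t1
    have hcy : totalY p c = 0 := by
      apply fb_cancel
      linear_combination t1
    obtain ⟨r, rfl⟩ := exists_eq_algebraMap_of_total p hcx hcy
    refine ⟨r, ?_⟩
    ext n
    rw [coeff_smul, lam_mul_cst_coeff]
    split_ifs with hn
    · rw [hn, hc, Algebra.smul_def, mul_comm]
    · rw [smul_zero]
      rcases lt_or_gt_of_ne hn with h1 | h1
      · exact hh.coeff_eq_zero n h1
      · exact hgt n h1
  · rw [if_neg (by omega)] at t1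
    have hc0 := eq_zero_of_second p (c := c) (e := h.coeff (d - 1)) (d := (d : ℝ))
      (Int.cast_ne_zero.2 (by omega)) hcx (by linear_combination t1)
    exact absurd (by rw [hc, hc0, mul_zero]) hd

end TopDegree

/-! ### Classification of homogeneous symmetries. -/

section Classification

variable {p : ℤ} {S : Derivation ℝ SmoothFun SmoothFun}

/-- Once `S` is corrected to commute with far negative basis fields, its series is finite in
nonlocal and jet variables, hence rational, hence a Laurent polynomial in `z`, hence a multiple of
`z u_y`. -/
theorem exists_eq_basisField_add_yField (hS : S ∈ allSymmetries p) {k : ℤ}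
    (hk : IsHomogeneous k S) : ∃ α β : ℝ, S = α • basisField p k + β • yField p := by
  obtain ⟨α, M, hM⟩ := exists_lie_basisField_eq_zero hS hk
  have hmem : S + α • basisField p k ∈ allSymmetries p :=
    (allSymmetries p).add_mem hS ((allSymmetries p).smul_mem α (basisField_mem p k))
  set h := symSeries p (S + α • basisField p k) with hh
  have hsym : IsSymSeries p h := (isSymSeries_symSeries hmem).1
  obtain ⟨K, hK⟩ := exists_jet_bound p hsym
  have hr : ∀ n : ℕ, M ≤ n → PD (.r n) h = 0 := by
    intro n hn
    ext j
    rw [PD_coeff, coeff_zero]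
    -- The bound `2` is where basis fields act on series without truncation.
    refine pd_r_eq_zero (p := p) (M := max M 2) (fun m hm => ?_) n (by omega)
    have h1 := symSeries_basisField_lie (p := p) (S + α • basisField p k) (m := m)
      ((le_max_right _ _).trans hm)
    rw [hM m ((le_max_left _ _).trans hm)] at h1
    have h2 : symSeries p 0 = 0 := by
      have := symSeries_smul p 0 0
      rwa [zero_smul, zero_smul] at this
    rw [h2] at h1
    have h3 := congrArg (fun f => HahnSeries.coeff f j) h1
    simp only [liftDer_coeff, zero_mul, zero_smul, add_zero, coeff_zero] at h3
    exact h3.symm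
  have hT : TT p h ∈ finiteSeries SmoothFun := by
    rw [hsym.TT_eq]
    exact sub_mem (mul_mem lam_mem_finiteSeries (cst_mem_finiteSeries _))
      (mul_mem (pow_mem lam_mem_finiteSeries 2) (cst_mem_finiteSeries _))
  have hrat : h ∈ rationalSeries := mem_rationalSeries_of_bounds p (K := K + M.toNat)
    (fun i hi => ⟨(hK i (by omega)).1, (hK i (by omega)).2, hr i (by omega)⟩)
    (finiteSeries_le hT)
  obtain ⟨β, hβ⟩ := eq_smul_of_finite p hsym (mem_finiteSeries_of_rational p hT hrat)
  refine ⟨-α, β, ?_⟩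
  have h4 : S + α • basisField p k = β • yField p :=
    symSeries_injective p hmem ((allSymmetries p).smul_mem β (yField_mem p))
      (by rw [symSeries_smul, symSeries_yField, ← hβ])
  rw [← h4, neg_smul]
  abel

end Classification

end RdDym

namespace RdDym

open HahnSeries LaurentPolynomial

/-! ### Faithfulness of the realization and the isomorphism. -/

section Main

variable (p : ℤ)

theorem ev_coeff (G : LaurentPolynomial ℝ) (i : ℤ) : (ev p G).coeff i =
    G.coeff.sum fun j r => r • ((WU p ^ j : (HahnSeries ℤ SmoothFun)ˣ) :
      HahnSeries ℤ SmoothFun).coeff i := by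
  induction G using LaurentPolynomial.induction_on' with
  | add f g hf hg =>
    rw [map_add, coeff_add, hf, hg, AddMonoidAlgebra.coeff_add, Finsupp.sum_add_index']
    · simp
    · intro j r s; rw [add_smul]
  | C_mul_T n r =>
    rw [← smul_eq_C_mul, ev_smul, ev_T, coeff_smul, smul_eq_C_mul, ← single_eq_C_mul_T,
      AddMonoidAlgebra.coeff_single]
    rw [Finsupp.sum_single_index]
    exact zero_smul _ _

theorem hasLead_ev {G : LaurentPolynomial ℝ} {n : ℤ} (hG : ∀ j < n, G.coeff j = 0) :
    HasLead (ev p G) n (algebraMap ℝ SmoothFun (G.coeff n)) := by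
  constructor
  · intro i hi
    rw [ev_coeff, Finsupp.sum]
    refine Finset.sum_eq_zero fun j _ => ?_
    rcases lt_or_ge j n with h | h
    · rw [hG j h, zero_smul]
    · rw [(hasLead_WU_zpow p j).1 i (by omega), smul_zero]
  · rw [ev_coeff, Finsupp.sum, Finset.sum_eq_single n]
    · rw [(hasLead_WU_zpow p n).2, Algebra.algebraMap_eq_smul_one]
    · intro j _ hj
      rcases lt_or_ge j n with h | h
      · rw [hG j h, zero_smul]
      · rw [(hasLead_WU_zpow p j).1 n (by omega), smul_zero]
    · intro h
      rw [Finsupp.notMem_support_iff.1 h, zero_smul]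

theorem laurentDer_sub_laurentDer (F : LaurentPolynomial ℝ) (m : ℤ) :
    laurentDer (T (m + 1)) F - laurentDer F (T (m + 1)) =
      T m * (laurentEulerLin F - ((m + 1 : ℤ) : ℝ) • F) := by
  have h1 : laurentDer (T (m + 1)) F = T (m + 1) * T (-1) * laurentEulerLin F := by
    rw [laurentDer, Derivation.smul_apply]
    rfl
  rw [h1, laurentDer_T, ← T_add, mul_sub, mul_smul_comm, add_sub_cancel_right,
    add_neg_cancel_right]

/-- Truncation may hide the low terms of `F`. Bracketing with a high power of `W` removes the
central field and shifts the lowest term to a positive exponent. -/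
theorem eq_zero_of_wittField_add_eq_zero {F : LaurentPolynomial ℝ} {t : ℝ}
    (h : wittField p F + t • yField p = 0) : F = 0 ∧ t = 0 := by
  have hF : F = 0 := by
    by_contra hF
    have hne : F.coeff.support.Nonempty := Finsupp.support_nonempty_iff.2 fun h0 =>
      hF (by ext n; rw [h0]; rfl)
    set n := F.coeff.support.min' hne
    have hn : F.coeff n ≠ 0 := Finsupp.mem_support_iff.1 (Finset.min'_mem _ hne)
    have hlow : ∀ j < n, F.coeff j = 0 := fun j hj => by
      by_contra hc
      exact absurd (Finset.min'_le _ _ (Finsupp.mem_support_iff.2 hc)) (not_le.2 hj)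
    -- Then `m + n - 2 ≥ 1`, so the shifted lowest term is not truncated, and its factor `n - (m +
    -- 1)` is nonzero.
    set m := |n| + 3
    have hm1 := le_abs_self n
    have hm2 := neg_abs_le n
    have h1 : ⁅wittField p (T (m + 1)), wittField p F⁆ = 0 := by
      have h2 := congrArg (fun S => ⁅wittField p (T (m + 1)), S⁆) h
      simp only [lie_add, lie_smul, lie_zero] at h2
      rwa [← lie_skew _ (yField p), yField_lie_wittField, neg_zero, smul_zero, add_zero] at h2
    rw [wittField_lie, laurentDer_sub_laurentDer] at h1
    have h3 := symSeries_wittField p (T m * (laurentEulerLin F - ((m + 1 : ℤ) : ℝ) • F))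
    have h0 : symSeries p 0 = 0 := by
      have := symSeries_smul p 0 0
      rwa [zero_smul, zero_smul] at this
    rw [h1, h0] at h3
    have hco : ∀ j, (laurentEulerLin F - ((m + 1 : ℤ) : ℝ) • F).coeff j =
        ((j - (m + 1) : ℤ) : ℝ) * F.coeff j := fun j => by
      rw [AddMonoidAlgebra.coeff_sub, Finsupp.sub_apply, laurentEulerLin_coeff,
        AddMonoidAlgebra.coeff_smul, Finsupp.smul_apply, smul_eq_mul]
      push_cast
      ring
    have hl := ((hasLead_WU_zpow p m).mul (hasLead_ev p
      (G := laurentEulerLin F - ((m + 1 : ℤ) : ℝ) • F) (n := n)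
      fun j hj => by rw [hco, hlow j hj, mul_zero])).mul (hasLead_WXI p)
    rw [← ev_T, ← map_mul] at hl
    have h4 := congrArg (fun f => HahnSeries.coeff f (m + n + -2)) h3
    simp only [coeff_zero] at h4
    rw [posPart_coeff, if_pos (by omega), HS, hl.2, hco] at h4
    have h5 := congrArg (fun f => SmoothFun.eval f 0) h4
    simp only [eval_neg, eval_algebraMap, eval_zero, one_mul, mul_neg,
      mul_one] at h5
    have h6 := (mul_eq_zero.1 (neg_eq_zero.1 h5.symm)).resolve_right hn
    have := Int.cast_eq_zero.1 h6
    omega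
  refine ⟨hF, ?_⟩
  have h1 := congrArg (symSeries p) h
  have h0 : symSeries p 0 = 0 := by
    have := symSeries_smul p 0 0
    rwa [zero_smul, zero_smul] at this
  rw [h0, symSeries_add, symSeries_smul, symSeries_yField, symSeries_wittField, hF, HS, map_zero,
    zero_mul, map_zero, zero_add] at h1
  have h2 := congrArg (fun f => HahnSeries.coeff f 1) h1
  simp only [coeff_smul, lam_mul_cst_coeff, if_true, coeff_zero] at h2
  -- Evaluation where all coordinates equal `1`, so that `u_y ≠ 0`.
  have h3 := congrArg (fun f => SmoothFun.eval f 1) h2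
  simpa [fb] using h3

/-- The value of a Witt algebra element on the variable. -/
noncomputable def wittSymbol : WittAlgebra →ₗ[ℝ] LaurentPolynomial ℝ where
  toFun D := (show Derivation ℝ (LaurentPolynomial ℝ) (LaurentPolynomial ℝ) from D) (T 1)
  map_add' _ _ := rfl
  map_smul' _ _ := rfl

theorem wittSymbol_injective {D : WittAlgebra} (h : wittSymbol D = 0) : D = 0 :=
  laurentDerivation_ext (D' := 0) h

theorem laurentDer_wittSymbol (D : WittAlgebra) :
    laurentDer (wittSymbol D) = (show Derivation ℝ (LaurentPolynomial ℝ) (LaurentPolynomial ℝ)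
      from D) := laurentDerivation_ext (laurentDer_T_one _)

theorem wittSymbol_lie (D D' : WittAlgebra) : wittSymbol ⁅D, D'⁆ =
    laurentDer (wittSymbol D) (wittSymbol D') - laurentDer (wittSymbol D') (wittSymbol D) := by
  rw [laurentDer_wittSymbol, laurentDer_wittSymbol]
  exact Derivation.commutator_apply _

theorem wittSymbol_surjective (F : LaurentPolynomial ℝ) : ∃ D : WittAlgebra, wittSymbol D = F :=
  ⟨laurentDer F, laurentDer_T_one F⟩

theorem mem_nonlocalSymmetries_of_homogeneous {S : Derivation ℝ SmoothFun SmoothFun}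
    (hS : S ∈ allSymmetries p) {k : ℤ} (hk : IsHomogeneous k S) : S ∈ nonlocalSymmetries p :=
  Submodule.subset_span ⟨hS, k, hk⟩

theorem wittField_mem_nonlocalSymmetries (F : LaurentPolynomial ℝ) :
    wittField p F ∈ nonlocalSymmetries p := by
  induction F using LaurentPolynomial.induction_on' with
  | add f g hf hg => rw [wittField_add]; exact add_mem hf hg
  | C_mul_T n r =>
    rw [← smul_eq_C_mul, wittField_smul]
    refine (nonlocalSymmetries p).smul_mem r ?_
    have := mem_nonlocalSymmetries_of_homogeneous p (basisField_mem p (1 - n))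
      (isHomogeneous_basisField p _)
    rwa [basisField, sub_sub_cancel] at this

/-- The realization of `𝔴 ⊕ 𝔞₁` by nonlocal symmetries. -/
noncomputable def realization : WittAlgebra × AbelianLine →ₗ⁅ℝ⁆ nonlocalSymmetries p where
  toFun z := ⟨wittField p (wittSymbol z.1) + (show ℝ from z.2) • yField p,
    add_mem (wittField_mem_nonlocalSymmetries p _) ((nonlocalSymmetries p).smul_mem _
      (mem_nonlocalSymmetries_of_homogeneous p (yField_mem p) (isHomogeneous_yField p)))⟩
  map_add' z z' := Subtype.ext (by
    change wittField p (wittSymbol (z.1 + z'.1)) + ((show ℝ from z.2) + (show ℝ from z'.2)) •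
      yField p = (_ + _) + (_ + _)
    rw [map_add, wittField_add, add_smul]
    abel)
  map_smul' r z := Subtype.ext (by
    change wittField p (wittSymbol (r • z.1)) + (r * (show ℝ from z.2)) • yField p = r • (_ + _)
    rw [map_smul, wittField_smul, mul_smul, smul_add])
  map_lie' {z z'} := Subtype.ext (by
    change wittField p (wittSymbol ⁅z.1, z'.1⁆) + (0 : ℝ) • yField p = ⁅_ + _, _ + _⁆
    rw [wittSymbol_lie, ← wittField_lie, zero_smul, add_zero, add_lie, lie_add, lie_add, smul_lie,
      smul_lie, lie_smul, lie_smul, lie_self, yField_lie_wittField, ← lie_skew _ (yField p),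
      yField_lie_wittField, neg_zero, smul_zero, smul_zero]
    simp only [add_zero])

theorem realization_coe (z : WittAlgebra × AbelianLine) :
    (realization p z : Derivation ℝ SmoothFun SmoothFun) =
      wittField p (wittSymbol z.1) + (show ℝ from z.2) • yField p := rfl

theorem realization_bijective : Function.Bijective (realization p) := by
  constructor
  · refine (injective_iff_map_eq_zero (realization p)).2 fun z hz => ?_
    have h := congrArg Subtype.val hz
    rw [realization_coe] at h
    obtain ⟨h1, h2⟩ := eq_zero_of_wittField_add_eq_zero p h
    exact Prod.ext (wittSymbol_injective h1) h2
  · rintro ⟨S, hS⟩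
    suffices h : ∃ z, (realization p z : Derivation ℝ SmoothFun SmoothFun) = S by
      obtain ⟨z, hz⟩ := h
      exact ⟨z, Subtype.ext hz⟩
    refine Submodule.span_induction
      (p := fun S _ => ∃ z, (realization p z : Derivation ℝ SmoothFun SmoothFun) = S)
      ?_ ?_ ?_ ?_ hS
    · rintro S ⟨hS, k, hk⟩
      obtain ⟨α, β, rfl⟩ := exists_eq_basisField_add_yField hS hk
      obtain ⟨D, hD⟩ := wittSymbol_surjective (α • T (1 - k))
      refine ⟨(D, β), ?_⟩
      rw [realization_coe, hD, wittField_smul]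
      rfl
    · exact ⟨0, by rw [map_zero]; rfl⟩
    · rintro S T _ _ ⟨z, rfl⟩ ⟨z', rfl⟩
      exact ⟨z + z', by rw [map_add]; rfl⟩
    · rintro r S _ ⟨z, rfl⟩
      exact ⟨r • z, by rw [map_smul]; rfl⟩

end Main

end RdDym

theorem mainTheorem2 (p : ℤ) :
    Nonempty (RdDym.nonlocalSymmetries p ≃ₗ⁅ℝ⁆ (RdDym.WittAlgebra × RdDym.AbelianLine)) :=
  ⟨(LieEquiv.ofBijective (RdDym.realization p) (RdDym.realization_bijective p)).symm⟩
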